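/- Let $G=\mathbb Z_3\times\mathbb Z_{27}$, of order $v=81$, and let $k=5$. A difference family (with $k=5$, $\lambda=1$) in a finite commutative group $G$ is a finite collection of $5$-subsets of $G$ (base blocks) such that every nonzero element of $G$ occurs exactly once among the partial differences of the base blocks. Here the list of partial differences of $B$ is the list of differences $a-b$ ($a,b\in B$, $a\ne b$) with all multiplicities divided by the order of the stabilizer $\{g\in G: g+B=B\}$. The blocks generated by the family are all translates $g+B$ ($g\in G$) of its base blocks $B$. Two families are equivalent up to multipliers if some automorphism of $G$ takes one to the other up to translating each base block separately. The multiplier of a family is the number of automorphisms of $G$ that fix it, up to translating each base block separately. For a Steiner system $S(2,k,v)$ write $ab$ for the block (line) through two distinct points $a,b$. Its fingerprint (hyperbolic frequency) is the function that assigns to $j$ the number of quadruples $(o,x,y,p)$ of points such that $o,x,y$ do not lie on a common block, $p$ lies on $xy$, $p\ne x$, $p\ne y$, and exactly $j$ points $u$ of the line $oy$ have the property that the line $pu$ does not meet the line $ox$. It is written $\{j=\text{value},\dots\}$, with the $j$ of value $0$ left out. Consider the following 72 families of base blocks in $G$, each preceded by a fingerprint. 1. $\{1=42768, 2=476280, 3=958392\}$: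 $\{(0,0),(0,1),(0,3),(0,7),(1,8)\}, \{(0,0),(0,5),(1,15),(1,26),(2,8)\}, \{(0,0),(0,8),(0,17),(1,3),(2,21)\}, \{(0,0),(0,12),(1,2),(1,16),(2,0)\}$. 2. $\{0=648, 1=45198, 2=461700, 3=969894\}$: $\{(0,0),(0,1),(0,3),(0,7),(1,8)\}, \{(0,0),(0,5),(1,15),(1,26),(2,8)\}, \{(0,0),(0,8),(0,17),(1,3),(2,21)\}, \{(0,0),(0,12),(1,12),(2,10),(2,23)\}$. 3. $\{1=50058, 2=479196, 3=948186\}$: $\{(0,0),(0,1),(0,3),(0,7),(1,8)\}, \{(0,0),(0,5),(1,15),(1,26),(2,8)\}, \{(0,0),(0,8),(0,18),(1,14),(2,5)\}, \{(0,0),(0,12),(1,2),(1,16),(2,0)\}$. 4. $\{1=34506, 2=471420, 3=971514\}$: $\{(0,0),(0,1),(0,3),(0,7),(1,8)\}, \{(0,0),(0,5),(1,15),(1,26),(2,8)\}, \{(0,0),(0,8),(0,18),(1,14),(2,5)\}, \{(0,0),(0,12),(1,12),(2,10),(2,23)\}$. 5. $\{0=1296, 1=36450, 2=463644, 3=976050\}$: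 $\{(0,0),(0,1),(0,3),(0,7),(1,8)\}, \{(0,0),(0,5),(1,24),(2,6),(2,17)\}, \{(0,0),(0,8),(0,17),(1,3),(2,21)\}, \{(0,0),(0,12),(1,2),(1,16),(2,0)\}$. 6. $\{1=37908, 2=452952, 3=986580\}$: $\{(0,0),(0,1),(0,3),(0,7),(1,8)\}, \{(0,0),(0,5),(1,24),(2,6),(2,17)\}, \{(0,0),(0,8),(0,17),(1,3),(2,21)\}, \{(0,0),(0,12),(1,12),(2,10),(2,23)\}$. 7. $\{0=648, 1=47628, 2=474336, 3=954828\}$: $\{(0,0),(0,1),(0,3),(0,7),(1,8)\}, \{(0,0),(0,5),(1,24),(2,6),(2,17)\}, \{(0,0),(0,8),(0,18),(1,14),(2,5)\}, \{(0,0),(0,12),(1,2),(1,16),(2,0)\}$. 8. $\{0=648, 1=34020, 2=456840, 3=985932\}$: $\{(0,0),(0,1),(0,3),(0,7),(1,8)\}, \{(0,0),(0,5),(1,24),(2,6),(2,17)\}, \{(0,0),(0,8),(0,18),(1,14),(2,5)\}, \{(0,0),(0,12),(1,12),(2,10),(2,23)\}$. 9. $\{0=1296, 1=48114, 2=469476,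 3=958554\}$: $\{(0,0),(0,1),(0,3),(0,10),(1,2)\}, \{(0,0),(0,4),(1,0),(2,15),(2,20)\}, \{(0,0),(0,6),(0,14),(1,9),(2,23)\}, \{(0,0),(0,11),(1,5),(1,17),(2,3)\}$. 10. $\{0=648, 1=52974, 2=477252, 3=946566\}$: $\{(0,0),(0,1),(0,3),(0,10),(1,2)\}, \{(0,0),(0,4),(1,0),(2,15),(2,20)\}, \{(0,0),(0,6),(0,14),(1,9),(2,23)\}, \{(0,0),(0,11),(1,8),(2,6),(2,21)\}$. 11. $\{0=648, 1=41796, 2=476280, 3=958716\}$: $\{(0,0),(0,1),(0,3),(0,10),(1,2)\}, \{(0,0),(0,4),(1,0),(2,15),(2,20)\}, \{(0,0),(0,6),(0,19),(1,10),(2,24)\}, \{(0,0),(0,11),(1,5),(1,17),(2,3)\}$. 12. $\{0=1944, 1=41310, 2=479196, 3=954990\}$: $\{(0,0),(0,1),(0,3),(0,10),(1,2)\}, \{(0,0),(0,4),(1,0),(2,15),(2,20)\}, \{(0,0),(0,6),(0,19),(1,10),(2,24)\}, \{(0,0),(0,11),(1,8),(2,6),(2,21)\}$. 13. $\{0=1296,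 1=50544, 2=487944, 3=937656\}$: $\{(0,0),(0,1),(0,3),(0,10),(1,2)\}, \{(0,0),(0,4),(1,9),(2,7),(2,19)\}, \{(0,0),(0,5),(1,0),(1,11),(2,14)\}, \{(0,0),(0,6),(0,14),(1,21),(2,10)\}$. 14. $\{1=55404, 2=484056, 3=937980\}$: $\{(0,0),(0,1),(0,3),(0,10),(1,2)\}, \{(0,0),(0,4),(1,9),(2,7),(2,19)\}, \{(0,0),(0,5),(1,0),(1,11),(2,14)\}, \{(0,0),(0,6),(0,19),(1,23),(2,12)\}$. 15. $\{1=47142, 2=481140, 3=949158\}$: $\{(0,0),(0,1),(0,3),(0,10),(1,2)\}, \{(0,0),(0,4),(1,9),(2,7),(2,19)\}, \{(0,0),(0,5),(1,18),(2,5),(2,21)\}, \{(0,0),(0,6),(0,14),(1,21),(2,10)\}$. 16. $\{1=34020, 2=466560, 3=976860\}$: $\{(0,0),(0,1),(0,3),(0,10),(1,2)\}, \{(0,0),(0,4),(1,9),(2,7),(2,19)\}, \{(0,0),(0,5),(1,18),(2,5),(2,21)\}, \{(0,0),(0,6),(0,19),(1,23),(2,12)\}$. 17. $\{0=1296, 1=44226,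 2=463644, 3=968274\}$: $\{(0,0),(0,1),(0,3),(0,10),(1,2)\}, \{(0,0),(0,4),(1,11),(1,16),(2,4)\}, \{(0,0),(0,6),(0,14),(1,9),(2,23)\}, \{(0,0),(0,11),(1,5),(1,17),(2,3)\}$. 18. $\{1=36936, 2=478224, 3=962280\}$: $\{(0,0),(0,1),(0,3),(0,10),(1,2)\}, \{(0,0),(0,4),(1,11),(1,16),(2,4)\}, \{(0,0),(0,6),(0,14),(1,9),(2,23)\}, \{(0,0),(0,11),(1,8),(2,6),(2,21)\}$. 19. $\{1=54432, 2=480168, 3=942840\}$: $\{(0,0),(0,1),(0,3),(0,10),(1,2)\}, \{(0,0),(0,4),(1,11),(1,16),(2,4)\}, \{(0,0),(0,6),(0,19),(1,10),(2,24)\}, \{(0,0),(0,11),(1,5),(1,17),(2,3)\}$. 20. $\{1=58320, 2=478224, 3=940896\}$: $\{(0,0),(0,1),(0,3),(0,10),(1,2)\}, \{(0,0),(0,4),(1,11),(1,16),(2,4)\}, \{(0,0),(0,6),(0,19),(1,10),(2,24)\}, \{(0,0),(0,11),(1,8),(2,6),(2,21)\}$. 21. $\{0=1944, 1=45684, 2=472392,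 3=957420\}$: $\{(0,0),(0,1),(0,3),(0,10),(1,2)\}, \{(0,0),(0,4),(1,12),(1,24),(2,22)\}, \{(0,0),(0,5),(1,0),(1,11),(2,14)\}, \{(0,0),(0,6),(0,14),(1,21),(2,10)\}$. 22. $\{0=648, 1=48600, 2=468504, 3=959688\}$: $\{(0,0),(0,1),(0,3),(0,10),(1,2)\}, \{(0,0),(0,4),(1,12),(1,24),(2,22)\}, \{(0,0),(0,5),(1,0),(1,11),(2,14)\}, \{(0,0),(0,6),(0,19),(1,23),(2,12)\}$. 23. $\{1=62208, 2=491832, 3=923400\}$: $\{(0,0),(0,1),(0,3),(0,10),(1,2)\}, \{(0,0),(0,4),(1,12),(1,24),(2,22)\}, \{(0,0),(0,5),(1,18),(2,5),(2,21)\}, \{(0,0),(0,6),(0,14),(1,21),(2,10)\}$. 24. $\{0=648, 1=56862, 2=502524, 3=917406\}$: $\{(0,0),(0,1),(0,3),(0,10),(1,2)\}, \{(0,0),(0,4),(1,12),(1,24),(2,22)\}, \{(0,0),(0,5),(1,18),(2,5),(2,21)\}, \{(0,0),(0,6),(0,19),(1,23),(2,12)\}$. 25. $\{0=1944, 1=52488,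 2=505440, 3=917568\}$: $\{(0,0),(0,1),(0,3),(0,11),(1,0)\}, \{(0,0),(0,4),(1,6),(2,17),(2,23)\}, \{(0,0),(0,5),(0,12),(1,25),(2,20)\}, \{(0,0),(0,9),(1,3),(2,4),(2,18)\}$. 26. $\{0=2592, 1=61722, 2=481140, 3=931986\}$: $\{(0,0),(0,1),(0,3),(0,11),(1,0)\}, \{(0,0),(0,4),(1,6),(2,17),(2,23)\}, \{(0,0),(0,5),(0,12),(1,25),(2,20)\}, \{(0,0),(0,9),(1,5),(1,18),(2,6)\}$. 27. $\{0=1296, 1=53460, 2=497664, 3=925020\}$: $\{(0,0),(0,1),(0,3),(0,11),(1,0)\}, \{(0,0),(0,4),(1,6),(2,17),(2,23)\}, \{(0,0),(0,5),(0,20),(1,12),(2,7)\}, \{(0,0),(0,9),(1,3),(2,4),(2,18)\}$. 28. $\{1=49086, 2=492804, 3=935550\}$: $\{(0,0),(0,1),(0,3),(0,11),(1,0)\}, \{(0,0),(0,4),(1,6),(2,17),(2,23)\}, \{(0,0),(0,5),(0,20),(1,12),(2,7)\}, \{(0,0),(0,9),(1,5),(1,18),(2,6)\}$. 29. $\{0=1296,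 1=46656, 2=480168, 3=949320\}$: $\{(0,0),(0,1),(0,3),(0,11),(1,0)\}, \{(0,0),(0,4),(1,8),(1,14),(2,25)\}, \{(0,0),(0,5),(0,12),(1,25),(2,20)\}, \{(0,0),(0,9),(1,3),(2,4),(2,18)\}$. 30. $\{0=1944, 1=64638, 2=500580, 3=910278\}$: $\{(0,0),(0,1),(0,3),(0,11),(1,0)\}, \{(0,0),(0,4),(1,8),(1,14),(2,25)\}, \{(0,0),(0,5),(0,12),(1,25),(2,20)\}, \{(0,0),(0,9),(1,5),(1,18),(2,6)\}$. 31. $\{0=2592, 1=60264, 2=487944, 3=926640\}$: $\{(0,0),(0,1),(0,3),(0,11),(1,0)\}, \{(0,0),(0,4),(1,8),(1,14),(2,25)\}, \{(0,0),(0,5),(0,20),(1,12),(2,7)\}, \{(0,0),(0,9),(1,3),(2,4),(2,18)\}$. 32. $\{0=648, 1=66096, 2=503496, 3=907200\}$: $\{(0,0),(0,1),(0,3),(0,11),(1,0)\}, \{(0,0),(0,4),(1,8),(1,14),(2,25)\}, \{(0,0),(0,5),(0,20),(1,12),(2,7)\}, \{(0,0),(0,9),(1,5),(1,18),(2,6)\}$.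 33. $\{0=648, 1=61722, 2=490860, 3=924210\}$: $\{(0,0),(0,1),(0,3),(0,11),(1,1)\}, \{(0,0),(0,4),(1,9),(2,12),(2,17)\}, \{(0,0),(0,6),(0,13),(1,2),(2,20)\}, \{(0,0),(0,9),(1,4),(2,3),(2,15)\}$. 34. $\{0=1296, 1=65124, 2=505440, 3=905580\}$: $\{(0,0),(0,1),(0,3),(0,11),(1,1)\}, \{(0,0),(0,4),(1,9),(2,12),(2,17)\}, \{(0,0),(0,6),(0,13),(1,2),(2,20)\}, \{(0,0),(0,9),(1,6),(1,21),(2,5)\}$. 35. $\{0=1944, 1=52974, 2=479196, 3=943326\}$: $\{(0,0),(0,1),(0,3),(0,11),(1,1)\}, \{(0,0),(0,4),(1,9),(2,12),(2,17)\}, \{(0,0),(0,6),(0,20),(1,13),(2,4)\}, \{(0,0),(0,9),(1,4),(2,3),(2,15)\}$. 36. $\{0=1296, 1=51030, 2=502524, 3=922590\}$: $\{(0,0),(0,1),(0,3),(0,11),(1,1)\}, \{(0,0),(0,4),(1,9),(2,12),(2,17)\}, \{(0,0),(0,6),(0,20),(1,13),(2,4)\}, \{(0,0),(0,9),(1,6),(1,21),(2,5)\}$.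 37. $\{0=2592, 1=52488, 2=487944, 3=934416\}$: $\{(0,0),(0,1),(0,3),(0,11),(1,1)\}, \{(0,0),(0,4),(1,14),(1,19),(2,22)\}, \{(0,0),(0,6),(0,13),(1,2),(2,20)\}, \{(0,0),(0,9),(1,4),(2,3),(2,15)\}$. 38. $\{0=648, 1=61722, 2=498636, 3=916434\}$: $\{(0,0),(0,1),(0,3),(0,11),(1,1)\}, \{(0,0),(0,4),(1,14),(1,19),(2,22)\}, \{(0,0),(0,6),(0,13),(1,2),(2,20)\}, \{(0,0),(0,9),(1,6),(1,21),(2,5)\}$. 39. $\{0=2592, 1=59292, 2=493776, 3=921780\}$: $\{(0,0),(0,1),(0,3),(0,11),(1,1)\}, \{(0,0),(0,4),(1,14),(1,19),(2,22)\}, \{(0,0),(0,6),(0,20),(1,13),(2,4)\}, \{(0,0),(0,9),(1,4),(2,3),(2,15)\}$. 40. $\{1=50544, 2=495720, 3=931176\}$: $\{(0,0),(0,1),(0,3),(0,11),(1,1)\}, \{(0,0),(0,4),(1,14),(1,19),(2,22)\}, \{(0,0),(0,6),(0,20),(1,13),(2,4)\}, \{(0,0),(0,9),(1,6),(1,21),(2,5)\}$.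 41. $\{0=648, 1=64638, 2=504468, 3=907686\}$: $\{(0,0),(0,1),(0,3),(0,12),(1,1)\}, \{(0,0),(0,4),(1,13),(2,5),(2,10)\}, \{(0,0),(0,6),(0,13),(1,18),(2,25)\}, \{(0,0),(0,8),(1,4),(1,14),(2,24)\}$. 42. $\{0=648, 1=56862, 2=492804, 3=927126\}$: $\{(0,0),(0,1),(0,3),(0,12),(1,1)\}, \{(0,0),(0,4),(1,13),(2,5),(2,10)\}, \{(0,0),(0,6),(0,13),(1,18),(2,25)\}, \{(0,0),(0,8),(1,11),(2,4),(2,21)\}$. 43. $\{1=60750, 2=457812, 3=958878\}$: $\{(0,0),(0,1),(0,3),(0,12),(1,1)\}, \{(0,0),(0,4),(1,13),(2,5),(2,10)\}, \{(0,0),(0,6),(0,20),(1,8),(2,15)\}, \{(0,0),(0,8),(1,4),(1,14),(2,24)\}$. 44. $\{0=648, 1=55404, 2=501552, 3=919836\}$: $\{(0,0),(0,1),(0,3),(0,12),(1,1)\}, \{(0,0),(0,4),(1,13),(2,5),(2,10)\}, \{(0,0),(0,6),(0,20),(1,8),(2,15)\}, \{(0,0),(0,8),(1,11),(2,4),(2,21)\}$.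 45. $\{0=648, 1=52002, 2=463644, 3=961146\}$: $\{(0,0),(0,1),(0,3),(0,12),(1,1)\}, \{(0,0),(0,4),(1,14),(1,24),(2,8)\}, \{(0,0),(0,5),(0,19),(1,22),(2,1)\}, \{(0,0),(0,6),(1,8),(1,15),(2,20)\}$. 46. $\{1=46656, 2=486000, 3=944784\}$: $\{(0,0),(0,1),(0,3),(0,12),(1,1)\}, \{(0,0),(0,4),(1,14),(1,24),(2,8)\}, \{(0,0),(0,5),(0,19),(1,22),(2,1)\}, \{(0,0),(0,6),(1,13),(2,18),(2,25)\}$. 47. $\{0=648, 1=56376, 2=482112, 3=938304\}$: $\{(0,0),(0,1),(0,3),(0,12),(1,1)\}, \{(0,0),(0,4),(1,21),(1,26),(2,18)\}, \{(0,0),(0,6),(0,13),(1,18),(2,25)\}, \{(0,0),(0,8),(1,11),(2,4),(2,21)\}$. 48. $\{0=648, 1=72900, 2=491832, 3=912060\}$: $\{(0,0),(0,1),(0,3),(0,12),(1,1)\}, \{(0,0),(0,4),(1,21),(1,26),(2,18)\}, \{(0,0),(0,6),(0,20),(1,8),(2,15)\}, \{(0,0),(0,8),(1,11),(2,4),(2,21)\}$.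 49. $\{0=648, 1=42282, 2=496692, 3=937818\}$: $\{(0,0),(0,1),(0,3),(0,12),(1,5)\}, \{(0,0),(0,4),(0,10),(1,16),(2,14)\}, \{(0,0),(0,5),(1,0),(1,14),(2,24)\}, \{(0,0),(0,7),(1,1),(2,8),(2,16)\}$. 50. $\{0=648, 1=43254, 2=479196, 3=954342\}$: $\{(0,0),(0,1),(0,3),(0,12),(1,5)\}, \{(0,0),(0,4),(0,10),(1,16),(2,14)\}, \{(0,0),(0,5),(1,0),(1,14),(2,24)\}, \{(0,0),(0,7),(1,18),(1,26),(2,6)\}$. 51. $\{1=51516, 2=474336, 3=951588\}$: $\{(0,0),(0,1),(0,3),(0,12),(1,5)\}, \{(0,0),(0,4),(0,10),(1,16),(2,14)\}, \{(0,0),(0,5),(1,8),(2,5),(2,18)\}, \{(0,0),(0,7),(1,1),(2,8),(2,16)\}$. 52. $\{0=2592, 1=73872, 2=495720, 3=905256\}$: $\{(0,0),(0,1),(0,3),(0,12),(1,5)\}, \{(0,0),(0,4),(0,10),(1,16),(2,14)\}, \{(0,0),(0,5),(1,8),(2,5),(2,18)\}, \{(0,0),(0,7),(1,18),(1,26),(2,6)\}$.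 53. $\{0=648, 1=77760, 2=495720, 3=903312\}$: $\{(0,0),(0,1),(0,3),(0,12),(1,5)\}, \{(0,0),(0,4),(0,21),(1,17),(2,15)\}, \{(0,0),(0,5),(1,0),(1,14),(2,24)\}, \{(0,0),(0,7),(1,1),(2,8),(2,16)\}$. 54. $\{0=1296, 1=47628, 2=480168, 3=948348\}$: $\{(0,0),(0,1),(0,3),(0,12),(1,5)\}, \{(0,0),(0,4),(0,21),(1,17),(2,15)\}, \{(0,0),(0,5),(1,0),(1,14),(2,24)\}, \{(0,0),(0,7),(1,18),(1,26),(2,6)\}$. 55. $\{0=1296, 1=74844, 2=489888, 3=911412\}$: $\{(0,0),(0,1),(0,3),(0,12),(1,5)\}, \{(0,0),(0,4),(0,21),(1,17),(2,15)\}, \{(0,0),(0,5),(1,8),(2,5),(2,18)\}, \{(0,0),(0,7),(1,1),(2,8),(2,16)\}$. 56. $\{0=1944, 1=64638, 2=502524, 3=908334\}$: $\{(0,0),(0,1),(0,3),(0,12),(1,5)\}, \{(0,0),(0,4),(0,21),(1,17),(2,15)\}, \{(0,0),(0,5),(1,8),(2,5),(2,18)\}, \{(0,0),(0,7),(1,18),(1,26),(2,6)\}$.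 57. $\{0=1296, 1=51030, 2=502524, 3=922590\}$: $\{(0,0),(0,1),(0,3),(1,3),(1,8)\}, \{(0,0),(0,4),(0,10),(1,23),(2,17)\}, \{(0,0),(0,7),(0,15),(2,9),(2,18)\}, \{(0,0),(0,11),(1,12),(1,26),(2,16)\}$. 58. $\{1=39366, 2=492804, 3=945270\}$: $\{(0,0),(0,1),(0,3),(1,3),(1,8)\}, \{(0,0),(0,4),(0,10),(1,23),(2,17)\}, \{(0,0),(0,7),(0,15),(2,9),(2,18)\}, \{(0,0),(0,11),(1,22),(2,12),(2,26)\}$. 59. $\{1=34992, 2=486000, 3=956448\}$: $\{(0,0),(0,1),(0,3),(1,3),(1,8)\}, \{(0,0),(0,4),(0,10),(1,23),(2,17)\}, \{(0,0),(0,7),(0,19),(1,16),(1,25)\}, \{(0,0),(0,11),(1,12),(1,26),(2,16)\}$. 60. $\{1=46170, 2=483084, 3=948186\}$: $\{(0,0),(0,1),(0,3),(1,3),(1,8)\}, \{(0,0),(0,4),(0,10),(1,23),(2,17)\}, \{(0,0),(0,7),(0,19),(1,16),(1,25)\}, \{(0,0),(0,11),(1,22),(2,12),(2,26)\}$. 61.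 $\{1=65610, 2=483084, 3=928746\}$: $\{(0,0),(0,1),(0,3),(1,3),(1,8)\}, \{(0,0),(0,4),(0,21),(1,14),(2,8)\}, \{(0,0),(0,7),(0,15),(2,9),(2,18)\}, \{(0,0),(0,11),(1,12),(1,26),(2,16)\}$. 62. $\{0=648, 1=48114, 2=488916, 3=939762\}$: $\{(0,0),(0,1),(0,3),(1,3),(1,8)\}, \{(0,0),(0,4),(0,21),(1,14),(2,8)\}, \{(0,0),(0,7),(0,15),(2,9),(2,18)\}, \{(0,0),(0,11),(1,22),(2,12),(2,26)\}$. 63. $\{1=48114, 2=502524, 3=926802\}$: $\{(0,0),(0,1),(0,3),(1,3),(1,8)\}, \{(0,0),(0,4),(0,21),(1,14),(2,8)\}, \{(0,0),(0,7),(0,19),(1,16),(1,25)\}, \{(0,0),(0,11),(1,12),(1,26),(2,16)\}$. 64. $\{0=648, 1=46170, 2=492804, 3=937818\}$: $\{(0,0),(0,1),(0,3),(1,3),(1,8)\}, \{(0,0),(0,4),(0,21),(1,14),(2,8)\}, \{(0,0),(0,7),(0,19),(1,16),(1,25)\}, \{(0,0),(0,11),(1,22),(2,12),(2,26)\}$.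 65. $\{0=1296, 1=89910, 2=500580, 3=885654\}$: $\{(0,0),(0,1),(0,4),(0,9),(1,1)\}, \{(0,0),(0,2),(1,9),(1,16),(2,12)\}, \{(0,0),(0,6),(0,16),(1,18),(2,23)\}, \{(0,0),(0,12),(1,6),(2,1),(2,14)\}$. 66. $\{0=648, 1=59292, 2=486000, 3=931500\}$: $\{(0,0),(0,1),(0,4),(0,9),(1,1)\}, \{(0,0),(0,2),(1,9),(1,16),(2,12)\}, \{(0,0),(0,6),(0,16),(1,18),(2,23)\}, \{(0,0),(0,12),(1,11),(1,25),(2,6)\}$. 67. $\{0=1296, 1=76788, 2=513216, 3=886140\}$: $\{(0,0),(0,1),(0,4),(0,9),(1,1)\}, \{(0,0),(0,2),(1,9),(1,16),(2,12)\}, \{(0,0),(0,6),(0,17),(1,10),(2,15)\}, \{(0,0),(0,12),(1,6),(2,1),(2,14)\}$. 68. $\{0=3240, 1=62694, 2=500580, 3=910926\}$: $\{(0,0),(0,1),(0,4),(0,9),(1,1)\}, \{(0,0),(0,2),(1,9),(1,16),(2,12)\}, \{(0,0),(0,6),(0,17),(1,10),(2,15)\}, \{(0,0),(0,12),(1,11),(1,25),(2,6)\}$.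 69. $\{0=3888, 1=83592, 2=497664, 3=892296\}$: $\{(0,0),(0,1),(0,4),(0,9),(1,1)\}, \{(0,0),(0,2),(1,17),(2,13),(2,20)\}, \{(0,0),(0,6),(0,16),(1,18),(2,23)\}, \{(0,0),(0,12),(1,6),(2,1),(2,14)\}$. 70. $\{0=1296, 1=80190, 2=483084, 3=912870\}$: $\{(0,0),(0,1),(0,4),(0,9),(1,1)\}, \{(0,0),(0,2),(1,17),(2,13),(2,20)\}, \{(0,0),(0,6),(0,16),(1,18),(2,23)\}, \{(0,0),(0,12),(1,11),(1,25),(2,6)\}$. 71. $\{0=648, 1=59292, 2=505440, 3=912060\}$: $\{(0,0),(0,1),(0,4),(0,9),(1,1)\}, \{(0,0),(0,2),(1,17),(2,13),(2,20)\}, \{(0,0),(0,6),(0,17),(1,10),(2,15)\}, \{(0,0),(0,12),(1,6),(2,1),(2,14)\}$. 72. $\{0=1296, 1=62208, 2=526824, 3=887112\}$: $\{(0,0),(0,1),(0,4),(0,9),(1,1)\}, \{(0,0),(0,2),(1,17),(2,13),(2,20)\}, \{(0,0),(0,6),(0,17),(1,10),(2,15)\}, \{(0,0),(0,12),(1,11),(1,25),(2,6)\}$.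 Then the following hold. (a) Each of the 72 families is a difference family with $\lambda=1$, its multiplier is $1$, the blocks that it generates form a Steiner system $S(2,5,81)$, and the fingerprint of this Steiner system is the one given in the list. (b) The list is exhaustive up to multipliers: every difference family in $\mathbb Z_3\times\mathbb Z_{27}$ with $k=5$, $\lambda=1$ is equivalent up to multipliers to exactly one of the 72 families. (c) The fingerprints of the 72 Steiner systems are pairwise distinct, with the single exception that families 36 and 57 have the same fingerprint $\{0=1296,1=51030,2=502524,3=922590\}$. (d) The 72 Steiner systems are pairwise non-isomorphic. -/

import Mathlib

/-! Difference families over a finite commutative group, the designs they generate, and the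
hyperbolic frequency of a design. -/

namespace DiffFamily

open Finset

section General

variable {G : Type*} [AddCommGroup G] [Fintype G] [DecidableEq G]
variable {V : Type*} [Fintype V] [DecidableEq V]
variable {W : Type*} [Fintype W] [DecidableEq W]

/-- The translate `g + B` of a subset `B` of `G`. -/
def translate (g : G) (B : Finset G) : Finset G := B.image (fun b => g + b)

/-- The order of the stabilizer of `B` under translation. -/
def stabCard (B : Finset G) : ℕ := #{g : G | translate g B = B}

/-- The number of pairs `(a, b)` in `B × B` with `a - b = d`. -/
def diffCount (B : Finset G) (d : G) : ℕ := #{p ∈ B ×ˢ B | p.1 - p.2 = d}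

/-- The multiplicity of `d` in the list of partial differences of `B`: the multiplicity in the
list of differences divided by the order of the stabilizer (the division is exact, and the
stabilizer is trivial unless the translation orbit of `B` is short). -/
def partialDiffCount (B : Finset G) (d : G) : ℕ := diffCount B d / stabCard B

/-- `F` is a `(v, k, l)` difference family in `G`, where `v` is the order of `G`: its base blocks
are `k`-subsets, and each nonzero element of `G` occurs exactly `l` times among their partial
differences. -/
def IsDifferenceFamily (k l : ℕ) (F : Multiset (Finset G)) : Prop :=
  (∀ B ∈ F, #B = k) ∧ ∀ d : G, d ≠ 0 → (F.map (fun B => partialDiffCount B d)).sum = l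

/-- The blocks generated by `F`: all translates of all base blocks. -/
def development (F : Multiset (Finset G)) : Finset (Finset G) :=
  F.toFinset.biUnion (fun B => univ.image (fun g : G => translate g B))

/-- `F` and `F'` have the same base blocks up to translating each of them. -/
def TranslationEquiv (F F' : Multiset (Finset G)) : Prop :=
  Multiset.Rel (fun B C => ∃ g : G, C = translate g B) F F'

/-- The image of a family of base blocks under an automorphism of the group. -/
def mapAut (α : G ≃+ G) (F : Multiset (Finset G)) : Multiset (Finset G) :=
  F.map (fun B => B.image α)

/-- `F'` arises from `F` by a group automorphism, up to translating base blocks. -/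
def MultiplierEquiv (F F' : Multiset (Finset G)) : Prop :=
  ∃ α : G ≃+ G, TranslationEquiv (mapAut α F) F'

/-- The number of automorphisms of the group that fix `F`, up to translating base blocks. -/
noncomputable def multiplierCount (F : Multiset (Finset G)) : ℕ :=
  Nat.card {α : G ≃+ G // TranslationEquiv (mapAut α F) F}

/-- `D` is the set of blocks of a Steiner system `S(t, k, v)` on the point set `V`. -/
def IsSteinerSystem (t k v : ℕ) (D : Finset (Finset V)) : Prop :=
  Fintype.card V = v ∧ (∀ B ∈ D, #B = k) ∧ ∀ T : Finset V, #T = t → ∃! B, B ∈ D ∧ T ⊆ B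

/-- Isomorphism of designs: a bijection of the points that maps blocks onto blocks. -/
def DesignIso (D : Finset (Finset V)) (E : Finset (Finset W)) : Prop :=
  ∃ e : V ≃ W, D.image (fun B => B.image e) = E

/-- Three points are collinear if they lie on a common block. -/
def Collinear3 (D : Finset (Finset V)) (a b c : V) : Prop := ∃ B ∈ D, a ∈ B ∧ b ∈ B ∧ c ∈ B

instance (D : Finset (Finset V)) (a b c : V) : Decidable (Collinear3 D a b c) := by
  unfold Collinear3; infer_instance

/-- The line `ab`: for distinct points of a Steiner system `S(2, k, v)`, the block through them. -/
def line (D : Finset (Finset V)) (a b : V) : Finset V := {c : V | Collinear3 D a b c}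

/-- The number of points `u` on the line `oy` such that the line `pu` does not meet the line
`ox`. -/
def missCount (D : Finset (Finset V)) (o x y p : V) : ℕ :=
  #{u ∈ line D o y | Disjoint (line D p u) (line D o x)}

/-- The hyperbolic frequency (fingerprint) of a design: its value at `j` is the number of
quadruples `(o, x, y, p)` such that `o, x, y` are not collinear, `p` is a point of the line `xy`
other than `x` and `y`, and exactly `j` points `u` of the line `oy` are such that the line `pu`
does not meet the line `ox`. -/
def hyperbolicFrequency (D : Finset (Finset V)) (j : ℕ) : ℕ :=
  #{q : V × V × V × V | ¬ Collinear3 D q.1 q.2.1 q.2.2.1 ∧ q.2.2.2 ∈ line D q.2.1 q.2.2.1 ∧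
    q.2.2.2 ≠ q.2.1 ∧ q.2.2.2 ≠ q.2.2.1 ∧ missCount D q.1 q.2.1 q.2.2.1 q.2.2.2 = j}

end General

/-- A line of the table: the values of the fingerprint at `0, 1, 2, 3` (it vanishes elsewhere),
and the base blocks, with points of `ℤ/3 × ℤ/27` given by representatives. -/
structure Entry where
  freq : List ℕ
  blocks : List (List (ℕ × ℕ))

/-- The table of difference families in `ℤ/3 × ℤ/27`. -/
def table : List Entry := [
  ⟨[0, 42768, 476280, 958392],
    [[(0, 0), (0, 1), (0, 3), (0, 7), (1, 8)], [(0, 0), (0, 5), (1, 15), (1, 26), (2, 8)],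
     [(0, 0), (0, 8), (0, 17), (1, 3), (2, 21)], [(0, 0), (0, 12), (1, 2), (1, 16), (2, 0)]]⟩,
  ⟨[648, 45198, 461700, 969894],
    [[(0, 0), (0, 1), (0, 3), (0, 7), (1, 8)], [(0, 0), (0, 5), (1, 15), (1, 26), (2, 8)],
     [(0, 0), (0, 8), (0, 17), (1, 3), (2, 21)], [(0, 0), (0, 12), (1, 12), (2, 10), (2, 23)]]⟩,
  ⟨[0, 50058, 479196, 948186],
    [[(0, 0), (0, 1), (0, 3), (0, 7), (1, 8)], [(0, 0), (0, 5), (1, 15), (1, 26), (2, 8)],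
     [(0, 0), (0, 8), (0, 18), (1, 14), (2, 5)], [(0, 0), (0, 12), (1, 2), (1, 16), (2, 0)]]⟩,
  ⟨[0, 34506, 471420, 971514],
    [[(0, 0), (0, 1), (0, 3), (0, 7), (1, 8)], [(0, 0), (0, 5), (1, 15), (1, 26), (2, 8)],
     [(0, 0), (0, 8), (0, 18), (1, 14), (2, 5)], [(0, 0), (0, 12), (1, 12), (2, 10), (2, 23)]]⟩,
  ⟨[1296, 36450, 463644, 976050],
    [[(0, 0), (0, 1), (0, 3), (0, 7), (1, 8)], [(0, 0), (0, 5), (1, 24), (2, 6), (2, 17)],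
     [(0, 0), (0, 8), (0, 17), (1, 3), (2, 21)], [(0, 0), (0, 12), (1, 2), (1, 16), (2, 0)]]⟩,
  ⟨[0, 37908, 452952, 986580],
    [[(0, 0), (0, 1), (0, 3), (0, 7), (1, 8)], [(0, 0), (0, 5), (1, 24), (2, 6), (2, 17)],
     [(0, 0), (0, 8), (0, 17), (1, 3), (2, 21)], [(0, 0), (0, 12), (1, 12), (2, 10), (2, 23)]]⟩,
  ⟨[648, 47628, 474336, 954828],
    [[(0, 0), (0, 1), (0, 3), (0, 7), (1, 8)], [(0, 0), (0, 5), (1, 24), (2, 6), (2, 17)],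
     [(0, 0), (0, 8), (0, 18), (1, 14), (2, 5)], [(0, 0), (0, 12), (1, 2), (1, 16), (2, 0)]]⟩,
  ⟨[648, 34020, 456840, 985932],
    [[(0, 0), (0, 1), (0, 3), (0, 7), (1, 8)], [(0, 0), (0, 5), (1, 24), (2, 6), (2, 17)],
     [(0, 0), (0, 8), (0, 18), (1, 14), (2, 5)], [(0, 0), (0, 12), (1, 12), (2, 10), (2, 23)]]⟩,
  ⟨[1296, 48114, 469476, 958554],
    [[(0, 0), (0, 1), (0, 3), (0, 10), (1, 2)], [(0, 0), (0, 4), (1, 0), (2, 15), (2, 20)],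
     [(0, 0), (0, 6), (0, 14), (1, 9), (2, 23)], [(0, 0), (0, 11), (1, 5), (1, 17), (2, 3)]]⟩,
  ⟨[648, 52974, 477252, 946566],
    [[(0, 0), (0, 1), (0, 3), (0, 10), (1, 2)], [(0, 0), (0, 4), (1, 0), (2, 15), (2, 20)],
     [(0, 0), (0, 6), (0, 14), (1, 9), (2, 23)], [(0, 0), (0, 11), (1, 8), (2, 6), (2, 21)]]⟩,
  ⟨[648, 41796, 476280, 958716],
    [[(0, 0), (0, 1), (0, 3), (0, 10), (1, 2)], [(0, 0), (0, 4), (1, 0), (2, 15), (2, 20)],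
     [(0, 0), (0, 6), (0, 19), (1, 10), (2, 24)], [(0, 0), (0, 11), (1, 5), (1, 17), (2, 3)]]⟩,
  ⟨[1944, 41310, 479196, 954990],
    [[(0, 0), (0, 1), (0, 3), (0, 10), (1, 2)], [(0, 0), (0, 4), (1, 0), (2, 15), (2, 20)],
     [(0, 0), (0, 6), (0, 19), (1, 10), (2, 24)], [(0, 0), (0, 11), (1, 8), (2, 6), (2, 21)]]⟩,
  ⟨[1296, 50544, 487944, 937656],
    [[(0, 0), (0, 1), (0, 3), (0, 10), (1, 2)], [(0, 0), (0, 4), (1, 9), (2, 7), (2, 19)],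
     [(0, 0), (0, 5), (1, 0), (1, 11), (2, 14)], [(0, 0), (0, 6), (0, 14), (1, 21), (2, 10)]]⟩,
  ⟨[0, 55404, 484056, 937980],
    [[(0, 0), (0, 1), (0, 3), (0, 10), (1, 2)], [(0, 0), (0, 4), (1, 9), (2, 7), (2, 19)],
     [(0, 0), (0, 5), (1, 0), (1, 11), (2, 14)], [(0, 0), (0, 6), (0, 19), (1, 23), (2, 12)]]⟩,
  ⟨[0, 47142, 481140, 949158],
    [[(0, 0), (0, 1), (0, 3), (0, 10), (1, 2)], [(0, 0), (0, 4), (1, 9), (2, 7), (2, 19)],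
     [(0, 0), (0, 5), (1, 18), (2, 5), (2, 21)], [(0, 0), (0, 6), (0, 14), (1, 21), (2, 10)]]⟩,
  ⟨[0, 34020, 466560, 976860],
    [[(0, 0), (0, 1), (0, 3), (0, 10), (1, 2)], [(0, 0), (0, 4), (1, 9), (2, 7), (2, 19)],
     [(0, 0), (0, 5), (1, 18), (2, 5), (2, 21)], [(0, 0), (0, 6), (0, 19), (1, 23), (2, 12)]]⟩,
  ⟨[1296, 44226, 463644, 968274],
    [[(0, 0), (0, 1), (0, 3), (0, 10), (1, 2)], [(0, 0), (0, 4), (1, 11), (1, 16), (2, 4)],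
     [(0, 0), (0, 6), (0, 14), (1, 9), (2, 23)], [(0, 0), (0, 11), (1, 5), (1, 17), (2, 3)]]⟩,
  ⟨[0, 36936, 478224, 962280],
    [[(0, 0), (0, 1), (0, 3), (0, 10), (1, 2)], [(0, 0), (0, 4), (1, 11), (1, 16), (2, 4)],
     [(0, 0), (0, 6), (0, 14), (1, 9), (2, 23)], [(0, 0), (0, 11), (1, 8), (2, 6), (2, 21)]]⟩,
  ⟨[0, 54432, 480168, 942840],
    [[(0, 0), (0, 1), (0, 3), (0, 10), (1, 2)], [(0, 0), (0, 4), (1, 11), (1, 16), (2, 4)],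
     [(0, 0), (0, 6), (0, 19), (1, 10), (2, 24)], [(0, 0), (0, 11), (1, 5), (1, 17), (2, 3)]]⟩,
  ⟨[0, 58320, 478224, 940896],
    [[(0, 0), (0, 1), (0, 3), (0, 10), (1, 2)], [(0, 0), (0, 4), (1, 11), (1, 16), (2, 4)],
     [(0, 0), (0, 6), (0, 19), (1, 10), (2, 24)], [(0, 0), (0, 11), (1, 8), (2, 6), (2, 21)]]⟩,
  ⟨[1944, 45684, 472392, 957420],
    [[(0, 0), (0, 1), (0, 3), (0, 10), (1, 2)], [(0, 0), (0, 4), (1, 12), (1, 24), (2, 22)],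
     [(0, 0), (0, 5), (1, 0), (1, 11), (2, 14)], [(0, 0), (0, 6), (0, 14), (1, 21), (2, 10)]]⟩,
  ⟨[648, 48600, 468504, 959688],
    [[(0, 0), (0, 1), (0, 3), (0, 10), (1, 2)], [(0, 0), (0, 4), (1, 12), (1, 24), (2, 22)],
     [(0, 0), (0, 5), (1, 0), (1, 11), (2, 14)], [(0, 0), (0, 6), (0, 19), (1, 23), (2, 12)]]⟩,
  ⟨[0, 62208, 491832, 923400],
    [[(0, 0), (0, 1), (0, 3), (0, 10), (1, 2)], [(0, 0), (0, 4), (1, 12), (1, 24), (2, 22)],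
     [(0, 0), (0, 5), (1, 18), (2, 5), (2, 21)], [(0, 0), (0, 6), (0, 14), (1, 21), (2, 10)]]⟩,
  ⟨[648, 56862, 502524, 917406],
    [[(0, 0), (0, 1), (0, 3), (0, 10), (1, 2)], [(0, 0), (0, 4), (1, 12), (1, 24), (2, 22)],
     [(0, 0), (0, 5), (1, 18), (2, 5), (2, 21)], [(0, 0), (0, 6), (0, 19), (1, 23), (2, 12)]]⟩,
  ⟨[1944, 52488, 505440, 917568],
    [[(0, 0), (0, 1), (0, 3), (0, 11), (1, 0)], [(0, 0), (0, 4), (1, 6), (2, 17), (2, 23)],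
     [(0, 0), (0, 5), (0, 12), (1, 25), (2, 20)], [(0, 0), (0, 9), (1, 3), (2, 4), (2, 18)]]⟩,
  ⟨[2592, 61722, 481140, 931986],
    [[(0, 0), (0, 1), (0, 3), (0, 11), (1, 0)], [(0, 0), (0, 4), (1, 6), (2, 17), (2, 23)],
     [(0, 0), (0, 5), (0, 12), (1, 25), (2, 20)], [(0, 0), (0, 9), (1, 5), (1, 18), (2, 6)]]⟩,
  ⟨[1296, 53460, 497664, 925020],
    [[(0, 0), (0, 1), (0, 3), (0, 11), (1, 0)], [(0, 0), (0, 4), (1, 6), (2, 17), (2, 23)],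
     [(0, 0), (0, 5), (0, 20), (1, 12), (2, 7)], [(0, 0), (0, 9), (1, 3), (2, 4), (2, 18)]]⟩,
  ⟨[0, 49086, 492804, 935550],
    [[(0, 0), (0, 1), (0, 3), (0, 11), (1, 0)], [(0, 0), (0, 4), (1, 6), (2, 17), (2, 23)],
     [(0, 0), (0, 5), (0, 20), (1, 12), (2, 7)], [(0, 0), (0, 9), (1, 5), (1, 18), (2, 6)]]⟩,
  ⟨[1296, 46656, 480168, 949320],
    [[(0, 0), (0, 1), (0, 3), (0, 11), (1, 0)], [(0, 0), (0, 4), (1, 8), (1, 14), (2, 25)],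
     [(0, 0), (0, 5), (0, 12), (1, 25), (2, 20)], [(0, 0), (0, 9), (1, 3), (2, 4), (2, 18)]]⟩,
  ⟨[1944, 64638, 500580, 910278],
    [[(0, 0), (0, 1), (0, 3), (0, 11), (1, 0)], [(0, 0), (0, 4), (1, 8), (1, 14), (2, 25)],
     [(0, 0), (0, 5), (0, 12), (1, 25), (2, 20)], [(0, 0), (0, 9), (1, 5), (1, 18), (2, 6)]]⟩,
  ⟨[2592, 60264, 487944, 926640],
    [[(0, 0), (0, 1), (0, 3), (0, 11), (1, 0)], [(0, 0), (0, 4), (1, 8), (1, 14), (2, 25)],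
     [(0, 0), (0, 5), (0, 20), (1, 12), (2, 7)], [(0, 0), (0, 9), (1, 3), (2, 4), (2, 18)]]⟩,
  ⟨[648, 66096, 503496, 907200],
    [[(0, 0), (0, 1), (0, 3), (0, 11), (1, 0)], [(0, 0), (0, 4), (1, 8), (1, 14), (2, 25)],
     [(0, 0), (0, 5), (0, 20), (1, 12), (2, 7)], [(0, 0), (0, 9), (1, 5), (1, 18), (2, 6)]]⟩,
  ⟨[648, 61722, 490860, 924210],
    [[(0, 0), (0, 1), (0, 3), (0, 11), (1, 1)], [(0, 0), (0, 4), (1, 9), (2, 12), (2, 17)],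
     [(0, 0), (0, 6), (0, 13), (1, 2), (2, 20)], [(0, 0), (0, 9), (1, 4), (2, 3), (2, 15)]]⟩,
  ⟨[1296, 65124, 505440, 905580],
    [[(0, 0), (0, 1), (0, 3), (0, 11), (1, 1)], [(0, 0), (0, 4), (1, 9), (2, 12), (2, 17)],
     [(0, 0), (0, 6), (0, 13), (1, 2), (2, 20)], [(0, 0), (0, 9), (1, 6), (1, 21), (2, 5)]]⟩,
  ⟨[1944, 52974, 479196, 943326],
    [[(0, 0), (0, 1), (0, 3), (0, 11), (1, 1)], [(0, 0), (0, 4), (1, 9), (2, 12), (2, 17)],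
     [(0, 0), (0, 6), (0, 20), (1, 13), (2, 4)], [(0, 0), (0, 9), (1, 4), (2, 3), (2, 15)]]⟩,
  ⟨[1296, 51030, 502524, 922590],
    [[(0, 0), (0, 1), (0, 3), (0, 11), (1, 1)], [(0, 0), (0, 4), (1, 9), (2, 12), (2, 17)],
     [(0, 0), (0, 6), (0, 20), (1, 13), (2, 4)], [(0, 0), (0, 9), (1, 6), (1, 21), (2, 5)]]⟩,
  ⟨[2592, 52488, 487944, 934416],
    [[(0, 0), (0, 1), (0, 3), (0, 11), (1, 1)], [(0, 0), (0, 4), (1, 14), (1, 19), (2, 22)],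
     [(0, 0), (0, 6), (0, 13), (1, 2), (2, 20)], [(0, 0), (0, 9), (1, 4), (2, 3), (2, 15)]]⟩,
  ⟨[648, 61722, 498636, 916434],
    [[(0, 0), (0, 1), (0, 3), (0, 11), (1, 1)], [(0, 0), (0, 4), (1, 14), (1, 19), (2, 22)],
     [(0, 0), (0, 6), (0, 13), (1, 2), (2, 20)], [(0, 0), (0, 9), (1, 6), (1, 21), (2, 5)]]⟩,
  ⟨[2592, 59292, 493776, 921780],
    [[(0, 0), (0, 1), (0, 3), (0, 11), (1, 1)], [(0, 0), (0, 4), (1, 14), (1, 19), (2, 22)],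
     [(0, 0), (0, 6), (0, 20), (1, 13), (2, 4)], [(0, 0), (0, 9), (1, 4), (2, 3), (2, 15)]]⟩,
  ⟨[0, 50544, 495720, 931176],
    [[(0, 0), (0, 1), (0, 3), (0, 11), (1, 1)], [(0, 0), (0, 4), (1, 14), (1, 19), (2, 22)],
     [(0, 0), (0, 6), (0, 20), (1, 13), (2, 4)], [(0, 0), (0, 9), (1, 6), (1, 21), (2, 5)]]⟩,
  ⟨[648, 64638, 504468, 907686],
    [[(0, 0), (0, 1), (0, 3), (0, 12), (1, 1)], [(0, 0), (0, 4), (1, 13), (2, 5), (2, 10)],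
     [(0, 0), (0, 6), (0, 13), (1, 18), (2, 25)], [(0, 0), (0, 8), (1, 4), (1, 14), (2, 24)]]⟩,
  ⟨[648, 56862, 492804, 927126],
    [[(0, 0), (0, 1), (0, 3), (0, 12), (1, 1)], [(0, 0), (0, 4), (1, 13), (2, 5), (2, 10)],
     [(0, 0), (0, 6), (0, 13), (1, 18), (2, 25)], [(0, 0), (0, 8), (1, 11), (2, 4), (2, 21)]]⟩,
  ⟨[0, 60750, 457812, 958878],
    [[(0, 0), (0, 1), (0, 3), (0, 12), (1, 1)], [(0, 0), (0, 4), (1, 13), (2, 5), (2, 10)],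
     [(0, 0), (0, 6), (0, 20), (1, 8), (2, 15)], [(0, 0), (0, 8), (1, 4), (1, 14), (2, 24)]]⟩,
  ⟨[648, 55404, 501552, 919836],
    [[(0, 0), (0, 1), (0, 3), (0, 12), (1, 1)], [(0, 0), (0, 4), (1, 13), (2, 5), (2, 10)],
     [(0, 0), (0, 6), (0, 20), (1, 8), (2, 15)], [(0, 0), (0, 8), (1, 11), (2, 4), (2, 21)]]⟩,
  ⟨[648, 52002, 463644, 961146],
    [[(0, 0), (0, 1), (0, 3), (0, 12), (1, 1)], [(0, 0), (0, 4), (1, 14), (1, 24), (2, 8)],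
     [(0, 0), (0, 5), (0, 19), (1, 22), (2, 1)], [(0, 0), (0, 6), (1, 8), (1, 15), (2, 20)]]⟩,
  ⟨[0, 46656, 486000, 944784],
    [[(0, 0), (0, 1), (0, 3), (0, 12), (1, 1)], [(0, 0), (0, 4), (1, 14), (1, 24), (2, 8)],
     [(0, 0), (0, 5), (0, 19), (1, 22), (2, 1)], [(0, 0), (0, 6), (1, 13), (2, 18), (2, 25)]]⟩,
  ⟨[648, 56376, 482112, 938304],
    [[(0, 0), (0, 1), (0, 3), (0, 12), (1, 1)], [(0, 0), (0, 4), (1, 21), (1, 26), (2, 18)],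
     [(0, 0), (0, 6), (0, 13), (1, 18), (2, 25)], [(0, 0), (0, 8), (1, 11), (2, 4), (2, 21)]]⟩,
  ⟨[648, 72900, 491832, 912060],
    [[(0, 0), (0, 1), (0, 3), (0, 12), (1, 1)], [(0, 0), (0, 4), (1, 21), (1, 26), (2, 18)],
     [(0, 0), (0, 6), (0, 20), (1, 8), (2, 15)], [(0, 0), (0, 8), (1, 11), (2, 4), (2, 21)]]⟩,
  ⟨[648, 42282, 496692, 937818],
    [[(0, 0), (0, 1), (0, 3), (0, 12), (1, 5)], [(0, 0), (0, 4), (0, 10), (1, 16), (2, 14)],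
     [(0, 0), (0, 5), (1, 0), (1, 14), (2, 24)], [(0, 0), (0, 7), (1, 1), (2, 8), (2, 16)]]⟩,
  ⟨[648, 43254, 479196, 954342],
    [[(0, 0), (0, 1), (0, 3), (0, 12), (1, 5)], [(0, 0), (0, 4), (0, 10), (1, 16), (2, 14)],
     [(0, 0), (0, 5), (1, 0), (1, 14), (2, 24)], [(0, 0), (0, 7), (1, 18), (1, 26), (2, 6)]]⟩,
  ⟨[0, 51516, 474336, 951588],
    [[(0, 0), (0, 1), (0, 3), (0, 12), (1, 5)], [(0, 0), (0, 4), (0, 10), (1, 16), (2, 14)],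
     [(0, 0), (0, 5), (1, 8), (2, 5), (2, 18)], [(0, 0), (0, 7), (1, 1), (2, 8), (2, 16)]]⟩,
  ⟨[2592, 73872, 495720, 905256],
    [[(0, 0), (0, 1), (0, 3), (0, 12), (1, 5)], [(0, 0), (0, 4), (0, 10), (1, 16), (2, 14)],
     [(0, 0), (0, 5), (1, 8), (2, 5), (2, 18)], [(0, 0), (0, 7), (1, 18), (1, 26), (2, 6)]]⟩,
  ⟨[648, 77760, 495720, 903312],
    [[(0, 0), (0, 1), (0, 3), (0, 12), (1, 5)], [(0, 0), (0, 4), (0, 21), (1, 17), (2, 15)],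
     [(0, 0), (0, 5), (1, 0), (1, 14), (2, 24)], [(0, 0), (0, 7), (1, 1), (2, 8), (2, 16)]]⟩,
  ⟨[1296, 47628, 480168, 948348],
    [[(0, 0), (0, 1), (0, 3), (0, 12), (1, 5)], [(0, 0), (0, 4), (0, 21), (1, 17), (2, 15)],
     [(0, 0), (0, 5), (1, 0), (1, 14), (2, 24)], [(0, 0), (0, 7), (1, 18), (1, 26), (2, 6)]]⟩,
  ⟨[1296, 74844, 489888, 911412],
    [[(0, 0), (0, 1), (0, 3), (0, 12), (1, 5)], [(0, 0), (0, 4), (0, 21), (1, 17), (2, 15)],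
     [(0, 0), (0, 5), (1, 8), (2, 5), (2, 18)], [(0, 0), (0, 7), (1, 1), (2, 8), (2, 16)]]⟩,
  ⟨[1944, 64638, 502524, 908334],
    [[(0, 0), (0, 1), (0, 3), (0, 12), (1, 5)], [(0, 0), (0, 4), (0, 21), (1, 17), (2, 15)],
     [(0, 0), (0, 5), (1, 8), (2, 5), (2, 18)], [(0, 0), (0, 7), (1, 18), (1, 26), (2, 6)]]⟩,
  ⟨[1296, 51030, 502524, 922590],
    [[(0, 0), (0, 1), (0, 3), (1, 3), (1, 8)], [(0, 0), (0, 4), (0, 10), (1, 23), (2, 17)],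
     [(0, 0), (0, 7), (0, 15), (2, 9), (2, 18)], [(0, 0), (0, 11), (1, 12), (1, 26), (2, 16)]]⟩,
  ⟨[0, 39366, 492804, 945270],
    [[(0, 0), (0, 1), (0, 3), (1, 3), (1, 8)], [(0, 0), (0, 4), (0, 10), (1, 23), (2, 17)],
     [(0, 0), (0, 7), (0, 15), (2, 9), (2, 18)], [(0, 0), (0, 11), (1, 22), (2, 12), (2, 26)]]⟩,
  ⟨[0, 34992, 486000, 956448],
    [[(0, 0), (0, 1), (0, 3), (1, 3), (1, 8)], [(0, 0), (0, 4), (0, 10), (1, 23), (2, 17)],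
     [(0, 0), (0, 7), (0, 19), (1, 16), (1, 25)], [(0, 0), (0, 11), (1, 12), (1, 26), (2, 16)]]⟩,
  ⟨[0, 46170, 483084, 948186],
    [[(0, 0), (0, 1), (0, 3), (1, 3), (1, 8)], [(0, 0), (0, 4), (0, 10), (1, 23), (2, 17)],
     [(0, 0), (0, 7), (0, 19), (1, 16), (1, 25)], [(0, 0), (0, 11), (1, 22), (2, 12), (2, 26)]]⟩,
  ⟨[0, 65610, 483084, 928746],
    [[(0, 0), (0, 1), (0, 3), (1, 3), (1, 8)], [(0, 0), (0, 4), (0, 21), (1, 14), (2, 8)],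
     [(0, 0), (0, 7), (0, 15), (2, 9), (2, 18)], [(0, 0), (0, 11), (1, 12), (1, 26), (2, 16)]]⟩,
  ⟨[648, 48114, 488916, 939762],
    [[(0, 0), (0, 1), (0, 3), (1, 3), (1, 8)], [(0, 0), (0, 4), (0, 21), (1, 14), (2, 8)],
     [(0, 0), (0, 7), (0, 15), (2, 9), (2, 18)], [(0, 0), (0, 11), (1, 22), (2, 12), (2, 26)]]⟩,
  ⟨[0, 48114, 502524, 926802],
    [[(0, 0), (0, 1), (0, 3), (1, 3), (1, 8)], [(0, 0), (0, 4), (0, 21), (1, 14), (2, 8)],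
     [(0, 0), (0, 7), (0, 19), (1, 16), (1, 25)], [(0, 0), (0, 11), (1, 12), (1, 26), (2, 16)]]⟩,
  ⟨[648, 46170, 492804, 937818],
    [[(0, 0), (0, 1), (0, 3), (1, 3), (1, 8)], [(0, 0), (0, 4), (0, 21), (1, 14), (2, 8)],
     [(0, 0), (0, 7), (0, 19), (1, 16), (1, 25)], [(0, 0), (0, 11), (1, 22), (2, 12), (2, 26)]]⟩,
  ⟨[1296, 89910, 500580, 885654],
    [[(0, 0), (0, 1), (0, 4), (0, 9), (1, 1)], [(0, 0), (0, 2), (1, 9), (1, 16), (2, 12)],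
     [(0, 0), (0, 6), (0, 16), (1, 18), (2, 23)], [(0, 0), (0, 12), (1, 6), (2, 1), (2, 14)]]⟩,
  ⟨[648, 59292, 486000, 931500],
    [[(0, 0), (0, 1), (0, 4), (0, 9), (1, 1)], [(0, 0), (0, 2), (1, 9), (1, 16), (2, 12)],
     [(0, 0), (0, 6), (0, 16), (1, 18), (2, 23)], [(0, 0), (0, 12), (1, 11), (1, 25), (2, 6)]]⟩,
  ⟨[1296, 76788, 513216, 886140],
    [[(0, 0), (0, 1), (0, 4), (0, 9), (1, 1)], [(0, 0), (0, 2), (1, 9), (1, 16), (2, 12)],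
     [(0, 0), (0, 6), (0, 17), (1, 10), (2, 15)], [(0, 0), (0, 12), (1, 6), (2, 1), (2, 14)]]⟩,
  ⟨[3240, 62694, 500580, 910926],
    [[(0, 0), (0, 1), (0, 4), (0, 9), (1, 1)], [(0, 0), (0, 2), (1, 9), (1, 16), (2, 12)],
     [(0, 0), (0, 6), (0, 17), (1, 10), (2, 15)], [(0, 0), (0, 12), (1, 11), (1, 25), (2, 6)]]⟩,
  ⟨[3888, 83592, 497664, 892296],
    [[(0, 0), (0, 1), (0, 4), (0, 9), (1, 1)], [(0, 0), (0, 2), (1, 17), (2, 13), (2, 20)],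
     [(0, 0), (0, 6), (0, 16), (1, 18), (2, 23)], [(0, 0), (0, 12), (1, 6), (2, 1), (2, 14)]]⟩,
  ⟨[1296, 80190, 483084, 912870],
    [[(0, 0), (0, 1), (0, 4), (0, 9), (1, 1)], [(0, 0), (0, 2), (1, 17), (2, 13), (2, 20)],
     [(0, 0), (0, 6), (0, 16), (1, 18), (2, 23)], [(0, 0), (0, 12), (1, 11), (1, 25), (2, 6)]]⟩,
  ⟨[648, 59292, 505440, 912060],
    [[(0, 0), (0, 1), (0, 4), (0, 9), (1, 1)], [(0, 0), (0, 2), (1, 17), (2, 13), (2, 20)],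
     [(0, 0), (0, 6), (0, 17), (1, 10), (2, 15)], [(0, 0), (0, 12), (1, 6), (2, 1), (2, 14)]]⟩,
  ⟨[1296, 62208, 526824, 887112],
    [[(0, 0), (0, 1), (0, 4), (0, 9), (1, 1)], [(0, 0), (0, 2), (1, 17), (2, 13), (2, 20)],
     [(0, 0), (0, 6), (0, 17), (1, 10), (2, 15)], [(0, 0), (0, 12), (1, 11), (1, 25), (2, 6)]]⟩]

theorem table_length : table.length = 72 := rfl

/-- The line of the table with index `i`, counted from `0`. -/
def entry (i : Fin 72) : Entry := table.get (i.cast table_length.symm)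

/-- The family of base blocks with index `i`. -/
def listed (i : Fin 72) : Multiset (Finset (ZMod 3 × ZMod 27)) :=
  ((entry i).blocks.map (fun l =>
    (l.map (fun p => ((p.1 : ZMod 3), (p.2 : ZMod 27)))).toFinset) : List _)

/-- The fingerprint printed in the table at index `i`. -/
def listedFrequency (i : Fin 72) (j : ℕ) : ℕ := (entry i).freq.getD j 0

end DiffFamily

open DiffFamily

/-!
The statement is proved by a computation that the kernel carries out, together with the arguments
that reduce the statement to it.

*Classification.* As no element of `ℤ/3 × ℤ/27` has order five, all blocks have trivial stabilizer,
and a difference family is a set of four blocks whose `80` differences are the nonzero elements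
(`isDifferenceFamily_iff`, `Decomposes`). Some block has the difference `(0, 9)`, and automorphisms,
translations and the negation of single blocks bring it into the form `{0, (0, 9), (0, 1), b, c}`.
If its bit set is chosen minimal, only the `168` pairs `(b, c)` in `representatives` are left
(`classified_of_decomposes`, `classified_of_mem`). For each of them, `search` looks for the other
blocks: it picks a difference `e` that is not covered yet, and tries the blocks `{0, e, a, b, c}`.
Translation and negation of a block do not change its differences, so that blocks are only searched
for up to these operations; in particular `a` and `e - a` need not both be tried.

What makes the search short is a spectral test. For a homomorphism `χ` to `ℤ/27` and an
autocorrelation `g` on `ℤ/27`, the sum of `g (χ (x - y))` over all pairs of points of a block is a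
sum of squares. So the sum of `g ∘ χ` over the differences that are still to be covered by `n` blocks
is at least `-5 * n * g 0` (`Decomposes.le_corrSum`). With an integral approximation of
`3 * cos (2 * π * s / 27)` in the autocorrelation, and for the `40` nonzero homomorphisms up to sign,
this excludes most partial families. All `40` sums and the bit set of the uncovered differences are
kept in one natural number (`stateOf`), which is updated by subtractions. The search finds `11`
families (`solutions`). The signs of their blocks can be chosen in `16` ways, and each of the
resulting `176` families is related by an explicit automorphism to one in the table
(`matching_spec`, `Classified.exists_multiplierEquiv`).

*Fingerprints.* The translates of the blocks of a difference family form a Steiner system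
(`Decomposes.isSteinerSystem`). By translation, the quadruples `(o, x, y, p)` have to be counted for
`o = 0` only (`hyperbolicFrequency_development`). For two lines `A` and `B` through `0` and a point
`p` outside them, let `N` be the number of lines through `p` that meet `A` and `B` in points other
than `0` (`meetCount`). Then there are `N` quadruples with `x` in `A`, `y` in `B` and this `p`, and
they count for `j = 4 - N` (`IsSteinerSystem.flagFrequency_eq`). The numbers `N` are computed for all
points at once by adding bit sets (`histogram`).

*Isomorphism.* Isomorphic designs have the same fingerprint, and families that are equivalent up to
multipliers generate isomorphic designs. The fingerprints differ except for the indices `35` and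
`56`. In that case the number of quadruples with `j = 2`, with `o` a given point and `x` on a given
line through it, is `304` for a suitable choice in the first design, but never in the second
(`not_designIso_35_56`). So the designs are pairwise not isomorphic, which also shows that the family
in the table that is equivalent to a given one is unique.
-/

namespace DiffFamily

open Finset

/-! ### Codes of points -/

/-- The group `ℤ/3 × ℤ/27`. -/
abbrev Pt : Type := ZMod 3 × ZMod 27

/-- The point with code `r`. The code of `(u, t)` is `6 * t + u` with `u < 3` and `t < 27`; the
numbers `6 * t + u` with `u < 6` are read as codes as well, so that differences of points can be
formed by subtracting codes. -/
def pt (r : ℕ) : Pt := ((r % 6 : ℕ), (r / 6 : ℕ))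

/-- The code of a point. -/
def cd (x : Pt) : ℕ := 6 * x.2.val + x.1.val

theorem pt_cd (x : Pt) : pt (cd x) = x := by
  have h1 : x.1.val < 3 := ZMod.val_lt _
  have a1 : cd x % 6 = x.1.val := by unfold cd; omega
  have a2 : cd x / 6 = x.2.val := by unfold cd; omega
  unfold pt
  rw [a1, a2]
  simp

theorem cd_lt (x : Pt) : cd x < 159 := by
  have h1 : x.1.val < 3 := ZMod.val_lt _
  have h2 : x.2.val < 27 := ZMod.val_lt _
  unfold cd; omega

theorem cd_mod (x : Pt) : cd x % 6 < 3 := by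
  have h1 : x.1.val < 3 := ZMod.val_lt _
  unfold cd; omega

theorem cd_injective : Function.Injective cd := fun x y h => by
  rw [← pt_cd x, h, pt_cd]

@[simp] theorem cd_inj {x y : Pt} : cd x = cd y ↔ x = y := cd_injective.eq_iff

@[simp] theorem cd_zero : cd 0 = 0 := rfl

/-- Since `pt 165 = 0`, differences of points are formed by subtracting codes after adding `165`,
which exceeds all codes. -/
theorem pt_sub (x y : Pt) : pt (165 + cd x - cd y) = x - y := by
  have h1 : x.1.val < 3 := ZMod.val_lt _
  have h2 : x.2.val < 27 := ZMod.val_lt _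
  have h3 : y.1.val < 3 := ZMod.val_lt _
  have h4 : y.2.val < 27 := ZMod.val_lt _
  have a1 : (165 + cd x - cd y) % 6 + y.1.val = x.1.val + 3 := by unfold cd; omega
  have a2 : (165 + cd x - cd y) / 6 + y.2.val = x.2.val + 27 := by unfold cd; omega
  have b1 := congrArg (Nat.cast : ℕ → ZMod 3) a1
  have b2 := congrArg (Nat.cast : ℕ → ZMod 27) a2
  have c1 : (3 : ZMod 3) = 0 := rfl
  have c2 : (27 : ZMod 27) = 0 := rfl
  simp only [Nat.cast_add, ZMod.natCast_val, ZMod.cast_id', id_eq, Nat.cast_ofNat, c1, c2,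
    add_zero] at b1 b2
  unfold pt
  ext
  · simp only [Prod.fst_sub]; rw [← b1]; ring
  · simp only [Prod.snd_sub]; rw [← b2]; ring

/-- The code of the point with code `r`. -/
def norm (r : ℕ) : ℕ := Nat.add (Nat.mul 6 (Nat.div (Nat.mod r 162) 6)) (Nat.mod r 3)

theorem cd_pt (r : ℕ) : cd (pt r) = norm r := by
  have e : norm r = 6 * ((r % 162) / 6) + r % 3 := rfl
  have a1 : (pt r).1.val = r % 6 % 3 := ZMod.val_natCast 3 _
  have a2 : (pt r).2.val = r / 6 % 27 := ZMod.val_natCast 27 _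
  rw [e]; unfold cd; rw [a1, a2]; omega

/-! ### Evaluation with forced arguments -/

/-- `force n k` is `k n`. The kernel evaluates the major premise of the recursor, and so replaces
`n` by a literal before it goes on with `k`. -/
@[reducible] noncomputable def force {α : Type} (n : ℕ) (k : ℕ → α) : α :=
  Nat.rec (k 0) (fun m _ => k (Nat.succ m)) n

@[simp] theorem force_eq {α : Type} (n : ℕ) (k : ℕ → α) : force n k = k n := by
  cases n <;> rfl

/-- The sum of `f i` over `i < n`. -/
noncomputable def sumUpTo (f : ℕ → ℕ) (n : ℕ) : ℕ := Nat.rec 0 (fun i s => Nat.add s (f i)) n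

theorem sumUpTo_eq (f : ℕ → ℕ) (n : ℕ) : sumUpTo f n = ∑ i ∈ range n, f i := by
  induction n with
  | zero => rfl
  | succ n ih => rw [sum_range_succ, ← ih]; rfl

/-- Whether `p i` holds for all `i < n`. -/
noncomputable def allUpTo (p : ℕ → Bool) (n : ℕ) : Bool :=
  Nat.rec true (fun i b => Bool.rec false b (p i)) n

theorem allUpTo_spec {p : ℕ → Bool} {n : ℕ} (h : allUpTo p n = true) :
    ∀ i < n, p i = true := by
  induction n with
  | zero => intro i hi; omega
  | succ n ih =>
    have e : allUpTo p (n + 1) = Bool.rec false (allUpTo p n) (p n) := rfl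
    rw [e] at h
    cases hp : p n with
    | false => rw [hp] at h; exact absurd h (by simp)
    | true =>
      rw [hp] at h
      intro i hi
      rcases Nat.lt_succ_iff_lt_or_eq.1 hi with h1 | h1
      · exact ih h i h1
      · rw [h1]; exact hp

/-! ### Bit sets -/

/-- The set of codes of the points of `D`, as a bit set. -/
def maskOf (D : Finset Pt) : ℕ := ∑ d ∈ D, 2 ^ cd d

theorem testBit_sum_two_pow (A : Finset ℕ) (i : ℕ) :
    (∑ a ∈ A, 2 ^ a).testBit i = true ↔ i ∈ A := by
  rw [← Nat.mem_bitIndices, ← List.mem_toFinset, Finset.toFinset_bitIndices_sum_two_pow]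

theorem maskOf_eq (D : Finset Pt) : maskOf D = ∑ a ∈ D.image cd, 2 ^ a := by
  rw [sum_image cd_injective.injOn]; rfl

theorem testBit_maskOf (D : Finset Pt) (i : ℕ) :
    (maskOf D).testBit i = true ↔ ∃ d ∈ D, cd d = i := by
  rw [maskOf_eq, testBit_sum_two_pow, mem_image]

theorem testBit_maskOf_cd (D : Finset Pt) (d : Pt) :
    (maskOf D).testBit (cd d) = true ↔ d ∈ D := by
  rw [testBit_maskOf]; simp

theorem maskOf_injective : Function.Injective maskOf := fun A B h => by
  ext d; rw [← testBit_maskOf_cd, h, testBit_maskOf_cd]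

/-- Extends a bit set of codes to all numbers below `324` that are read as codes. -/
noncomputable def ext (S : ℕ) : ℕ :=
  force (Nat.lor S (Nat.shiftLeft S 3)) fun X => Nat.lor X (Nat.shiftLeft X 162)

theorem testBit_ext {D : Finset Pt} {r : ℕ} (hr : r < 324) (h : pt r ∈ D) :
    (ext (maskOf D)).testBit r = true := by
  have e : ext (maskOf D) = (maskOf D ||| maskOf D <<< 3) |||
      (maskOf D ||| maskOf D <<< 3) <<< 162 := by
    unfold ext; rw [force_eq]; rfl
  have hm : (maskOf D).testBit (norm r) = true := by
    rw [← cd_pt, testBit_maskOf_cd]; exact h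
  have en : norm r = 6 * ((r % 162) / 6) + r % 3 := rfl
  rw [e]
  simp only [Nat.testBit_or, Nat.testBit_shiftLeft, Bool.or_eq_true, Bool.and_eq_true,
    decide_eq_true_eq, ge_iff_le]
  have hc : r = norm r ∨ (3 ≤ r ∧ r - 3 = norm r) ∨ (162 ≤ r ∧ r - 162 = norm r) ∨
      (162 ≤ r ∧ 3 ≤ r - 162 ∧ r - 162 - 3 = norm r) := by omega
  rcases hc with h1 | ⟨h1, h2⟩ | ⟨h1, h2⟩ | ⟨h1, h2, h3⟩
  · exact Or.inl (Or.inl (h1 ▸ hm))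
  · exact Or.inl (Or.inr ⟨h1, h2 ▸ hm⟩)
  · exact Or.inr ⟨h1, Or.inl (h2 ▸ hm)⟩
  · exact Or.inr ⟨h1, Or.inr ⟨h2, h3 ▸ hm⟩⟩

/-- The lowest bit of `m`, as a power of two. -/
def low (m : ℕ) : ℕ := Nat.land m (Nat.xor m (Nat.sub m 1))

theorem low_spec {x : ℕ} (hx : x ≠ 0) :
    ∃ j, low x = 2 ^ j ∧ x.testBit j = true ∧ ∀ i, x.testBit i = true → j ≤ i := by
  obtain ⟨j, m, ⟨k, hk⟩, hm⟩ := Nat.exists_eq_two_pow_mul_odd hx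
  have hp : 0 < 2 ^ j := by positivity
  have hlt : 2 ^ j < 2 ^ (j + 1) := Nat.pow_lt_pow_right (by norm_num) (by omega)
  have e1 : x = 2 ^ (j + 1) * k + 2 ^ j := by rw [hm, hk]; ring
  have e2 : x - 1 = 2 ^ (j + 1) * k + (2 ^ j - 1) := by omega
  have b1 : ∀ i, x.testBit i = if i < j + 1 then decide (j = i) else k.testBit (i - (j + 1)) := by
    intro i
    conv_lhs => rw [e1]
    rw [Nat.testBit_two_pow_mul_add _ hlt, Nat.testBit_two_pow]
  have b2 : ∀ i, (x - 1).testBit i =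
      if i < j + 1 then decide (i < j) else k.testBit (i - (j + 1)) := by
    intro i
    rw [e2, Nat.testBit_two_pow_mul_add _ (by omega), Nat.testBit_two_pow_sub_one]
  refine ⟨j, ?_, ?_, ?_⟩
  · have e : low x = x &&& (x ^^^ (x - 1)) := rfl
    rw [e]
    refine Nat.eq_of_testBit_eq fun i => ?_
    rw [Nat.testBit_and, Nat.testBit_xor, b1, b2, Nat.testBit_two_pow]
    split_ifs with hi
    · by_cases hj : j = i
      · simp [hj]
      · simp [hj]
    · have : j ≠ i := by omega
      simp [this]
  · rw [b1]; simp
  · intro i hi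
    rw [b1] at hi
    split_ifs at hi with h1
    · have := of_decide_eq_true hi; omega
    · omega

/-- The table of discrete logarithms to the base `2` modulo `163`, in bytes. -/
noncomputable def logTable : ℕ :=
  sumUpTo (fun k => Nat.shiftLeft k (Nat.mul 8 (Nat.mod (Nat.pow 2 k) 163))) 162

/-- The exponent of the power of two `p`, by a look-up of `p % 163` in the table `K`: as `2` is a
primitive root modulo `163`, the powers `2 ^ i` with `i < 162` differ modulo `163`. -/
def idx (K p : ℕ) : ℕ := Nat.land (Nat.shiftRight K (Nat.mul 8 (Nat.mod p 163))) 255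

theorem idx_check : (force logTable fun K =>
    allUpTo (fun i => Nat.beq (idx K (Nat.pow 2 i)) i) 162) = true := by decide +kernel

theorem idx_two_pow {i : ℕ} (hi : i < 162) : idx logTable (2 ^ i) = i := by
  have h := idx_check
  rw [force_eq] at h
  exact Nat.eq_of_beq_eq_true (allUpTo_spec h i hi)

/-- Runs through the elements of the bit set `x`, whose bit `i` stands for `o + i`, from below.
For each element `k` the bits up to `k` are dropped, `clr` removes further bits, and `body` has to
succeed with the bits that remain (again with respect to an offset). -/
noncomputable def loop (K : ℕ) (body : ℕ → ℕ → ℕ → Bool) (clr : ℕ → ℕ → ℕ → ℕ) (fuel : ℕ) :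
    ℕ → ℕ → Bool :=
  Nat.rec (fun _ _ => false) (fun _ ih o x => Bool.rec
    (force (idx K (low x)) fun j => force (Nat.add o j) fun k => force (Nat.succ k) fun o' =>
      force (clr k o' (Nat.shiftRight x (Nat.succ j))) fun x' =>
        Bool.rec false (ih o' x') (body k o' x')) true (Nat.beq x 0)) fuel

/-- A successful loop has run `body` at some element `k` of any given nonempty set `T` of targets
in `x`, at a time when all other targets were left, except those that `k` itself removes. Here
`bad k t` says that `t` is removed at `k`, and `T` is such that no target is removed at an element
outside `T`. -/
theorem loop_spec {body : ℕ → ℕ → ℕ → Bool} {clr : ℕ → ℕ → ℕ → ℕ} (V : ℕ → Prop)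
    (bad : ℕ → ℕ → Prop) (T : Finset ℕ)
    (hclr : ∀ k o x t, o ≤ t → t < 162 → ¬ bad k t → x.testBit (t - o) = true →
      (clr k o x).testBit (t - o) = true)
    (hclr' : ∀ k o x t, (clr k o x).testBit t = true → x.testBit t = true)
    (hT : ∀ k, V k → k ∉ T → ∀ t ∈ T, ¬ bad k t) (hne : T.Nonempty) (fuel : ℕ) :
    ∀ o x, (∀ i, x.testBit i = true → V (o + i)) →
      (∀ t ∈ T, o ≤ t ∧ t < 162 ∧ x.testBit (t - o) = true) →
      loop logTable body clr fuel o x = true →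
      ∃ k ∈ T, ∃ o' x', body k o' x' = true ∧
        ∀ t ∈ T, t ≠ k → ¬ bad k t → o' ≤ t ∧ t < 162 ∧ x'.testBit (t - o') = true := by
  induction fuel with
  | zero => intro o x _ _ h; exact absurd h (by simp [loop])
  | succ n ih =>
    intro o x hV hx h
    obtain ⟨t₀, ht₀⟩ := hne
    have hx0 : x ≠ 0 := by
      rintro rfl
      simpa using (hx t₀ ht₀).2.2
    obtain ⟨j, hj, hjx, hmin⟩ := low_spec hx0
    have hj162 : j < 162 := by
      have := hmin _ (hx t₀ ht₀).2.2
      have := (hx t₀ ht₀).2.1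
      omega
    have hb : Nat.beq x 0 = false := by
      cases hxb : Nat.beq x 0 with
      | false => rfl
      | true => exact absurd (Nat.eq_of_beq_eq_true hxb) hx0
    set k := o + j with hk
    set x' := clr k (k + 1) (x >>> (j + 1)) with hx'
    have e : loop logTable body clr (n + 1) o x =
        Bool.rec false (loop logTable body clr n (k + 1) x') (body k (k + 1) x') := by
      unfold loop
      simp only [force_eq, hj, idx_two_pow hj162, hb]
      rfl
    rw [e] at h
    cases hbody : body k (k + 1) x' with
    | false => rw [hbody] at h; exact absurd h (by simp)
    | true =>
      rw [hbody] at h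
      have hrest : ∀ t ∈ T, t ≠ k → ¬ bad k t →
          k + 1 ≤ t ∧ t < 162 ∧ x'.testBit (t - (k + 1)) = true := by
        intro t ht htk hbad
        obtain ⟨h1, h2, h3⟩ := hx t ht
        have h4 := hmin _ h3
        have h5 : k + 1 ≤ t := by omega
        refine ⟨h5, h2, hclr _ _ _ _ h5 h2 hbad ?_⟩
        rw [Nat.testBit_shiftRight]
        have : j + 1 + (t - (k + 1)) = t - o := by omega
        rw [this]; exact h3
      by_cases hkT : k ∈ T
      · exact ⟨k, hkT, k + 1, x', hbody, hrest⟩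
      · refine ih (k + 1) x' ?_ ?_ h
        · intro i hi
          have h1 := hclr' _ _ _ _ hi
          rw [Nat.testBit_shiftRight] at h1
          have := hV _ h1
          have e2 : k + 1 + i = o + (j + 1 + i) := by omega
          rw [e2]; exact this
        · intro t ht
          exact hrest t ht (fun h => hkT (h ▸ ht)) (hT k (hV j hjx) hkT t ht)

/-! ### The spectral weights -/

/-- `131 + g x` for `x = r` in `ℤ/27`, where `g` is the autocorrelation `g x = ∑ s, c s * c (s + x)`
of the approximation `c s` of `3 * cos (2 * π * s / 27)` by integers. The values are packed into
fields of `9` bits. -/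
def autoCorr (r : ℕ) : ℕ :=
  Nat.mod (Nat.shiftRight 0x40df2e8692dd347b2f10050150380000070a8a0805e3da696ed2743e60709
    (Nat.mul 9 (Nat.mod r 27))) 512

/-- The value at the point with code `r` of the `k`-th of `40` homomorphisms to `ℤ/27`: these are
the nonzero ones up to sign. -/
def charVal (k r : ℕ) : ℕ :=
  Bool.rec (Nat.add (Nat.mul 9 (Nat.mod r 6)) (Nat.mul (Nat.sub k 13) (Nat.div r 6)))
    (Nat.mul (Nat.add k 1) (Nat.div r 6)) (Nat.blt k 13)

/-- The values of `autoCorr` at the images of the point with code `r` under the `40`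
homomorphisms, in fields of `16` bits. -/
noncomputable def weight (r : ℕ) : ℕ :=
  sumUpTo (fun k => Nat.shiftLeft (autoCorr (charVal k r)) (Nat.mul 16 k)) 40

/-- The contribution of the point with code `r` to a state: its bit, above its weights. -/
noncomputable def entryCode (r : ℕ) : ℕ := Nat.add (Nat.shiftLeft 1 (Nat.add 640 r)) (weight r)

/-- The `i`-th code, for `i < 81`. -/
def codeAt (i : ℕ) : ℕ := Nat.add (Nat.mul 6 (Nat.div i 3)) (Nat.mod i 3)

/-- For each point `d`, the contributions of `d` and `-d` to a state, in fields of `802` bits. -/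
noncomputable def pairTable : ℕ :=
  sumUpTo (fun i => Nat.shiftLeft
    (Nat.add (entryCode (codeAt i)) (entryCode (norm (Nat.sub 165 (codeAt i)))))
    (Nat.mul 802 i)) 81

/-- Looks up the number `r`, read as a code, in the table `T`, where `M = 2 ^ 802`. -/
def tab (T M r : ℕ) : ℕ :=
  Nat.mod (Nat.shiftRight T (Nat.mul 802
    (Nat.add (Nat.mul 3 (Nat.div (Nat.mod r 162) 6)) (Nat.mod r 3)))) M

/-- The state of the set of all nonzero points. -/
noncomputable def fullState : ℕ := sumUpTo (fun i => entryCode (codeAt (Nat.succ i))) 80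

/-- The number with `1` in each of `40` fields of `16` bits. -/
noncomputable def unitFields : ℕ := sumUpTo (fun k => Nat.shiftLeft 1 (Nat.mul 16 k)) 40

/-- The spectral test for the state `Z` of the differences of `n` blocks, with `U = unitFields`:
whether all `40` sums of `autoCorr` are at least `1950 * n`. Adding `2 ^ 15 - 1950 * n` to a field
sets its top bit if and only if this holds. -/
noncomputable def feasible (U n Z : ℕ) : Bool :=
  force (Nat.shiftLeft U 15) fun W =>
  Nat.beq (Nat.land (Nat.add Z (Nat.sub W (Nat.mul (Nat.mul 1950 n) U))) W) W

theorem tab_check : (force pairTable fun T => force (Nat.pow 2 802) fun M =>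
    allUpTo (fun r => Nat.beq (tab T M r)
      (Nat.add (entryCode (norm r)) (entryCode (norm (Nat.sub 165 (norm r)))))) 330) = true := by
  decide +kernel

/-- The state that stands for a set of differences: the bit set of its codes above `40` fields of
`16` bits for its sums of weights. Disjoint unions of sets correspond to sums of states, so that
one subtraction removes differences from the set and updates all `40` sums. -/
noncomputable def stateOf (D : Finset Pt) : ℕ := ∑ d ∈ D, entryCode (cd d)

theorem tab_sub (x y : Pt) : tab pairTable (Nat.pow 2 802) (165 + cd x - cd y) =
    entryCode (cd (x - y)) + entryCode (cd (y - x)) := by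
  have h := tab_check
  rw [force_eq, force_eq] at h
  have h1 := cd_lt x
  have h2 := Nat.eq_of_beq_eq_true (allUpTo_spec h (165 + cd x - cd y) (by omega))
  rw [h2, ← cd_pt, pt_sub]
  have h3 : norm (Nat.sub 165 (cd (x - y))) = cd (y - x) := by
    have := pt_sub 0 (x - y)
    rw [cd_zero, zero_sub, neg_sub, Nat.add_zero] at this
    rw [← this, cd_pt]; rfl
  rw [h3]; rfl

theorem codeAt_index (d : Pt) : codeAt (3 * d.2.val + d.1.val) = cd d := by
  have h1 : d.1.val < 3 := ZMod.val_lt _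
  have : ∀ i, codeAt i = 6 * (i / 3) + i % 3 := fun _ => rfl
  rw [this]; unfold cd; omega

theorem fullState_eq : fullState = stateOf (univ.erase 0) := by
  unfold fullState stateOf
  rw [sumUpTo_eq]
  have hcode : ∀ i, codeAt i = 6 * (i / 3) + i % 3 := fun _ => rfl
  have hpt : ∀ i < 81, cd (pt (codeAt i)) = codeAt i := by
    intro i hi
    rw [cd_pt]
    have : norm (codeAt i) = 6 * ((codeAt i % 162) / 6) + codeAt i % 3 := rfl
    rw [this, hcode]; omega
  have hpos : ∀ d : Pt, d ≠ 0 → 3 * d.2.val + d.1.val ≠ 0 := by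
    intro d hd h
    apply hd
    have : cd d = cd 0 := by rw [cd_zero]; unfold cd; omega
    exact cd_injective this
  refine sum_bij' (fun i _ => pt (codeAt (i + 1))) (fun d _ => 3 * d.2.val + d.1.val - 1)
    ?_ ?_ ?_ ?_ ?_
  · intro i hi
    have hi := mem_range.1 hi
    refine mem_erase.2 ⟨fun h => ?_, mem_univ _⟩
    have h1 := hpt (i + 1) (by omega)
    rw [h, cd_zero, hcode] at h1
    omega
  · intro d hd
    have h1 : d.1.val < 3 := ZMod.val_lt _
    have h2 : d.2.val < 27 := ZMod.val_lt _
    have := hpos d (mem_erase.1 hd).1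
    exact mem_range.2 (by omega)
  · intro i hi
    have hi := mem_range.1 hi
    have h1 := hpt (i + 1) (by omega)
    generalize pt (codeAt (i + 1)) = p at h1 ⊢
    have h3 : p.1.val < 3 := ZMod.val_lt _
    rw [hcode] at h1
    unfold cd at h1
    omega
  · intro d hd
    have := hpos d (mem_erase.1 hd).1
    rw [show 3 * d.2.val + d.1.val - 1 + 1 = 3 * d.2.val + d.1.val by omega,
      codeAt_index, pt_cd]
  · intro i hi
    have hi := mem_range.1 hi
    rw [hpt (i + 1) (by omega)]

/-! ### Packed sums -/

theorem pack_lt (f : ℕ → ℕ) (hf : ∀ k, f k < 2 ^ 16) (n : ℕ) :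
    ∑ k ∈ range n, f k * 2 ^ (16 * k) < 2 ^ (16 * n) := by
  induction n with
  | zero => simp
  | succ n ih =>
    rw [sum_range_succ]
    have h1 : f n * 2 ^ (16 * n) ≤ (2 ^ 16 - 1) * 2 ^ (16 * n) :=
      Nat.mul_le_mul_right _ (by have := hf n; omega)
    have h2 : 2 ^ (16 * (n + 1)) = 2 ^ 16 * 2 ^ (16 * n) := by ring
    rw [h2]
    omega

theorem pack_and (n : ℕ) : ∀ (f : ℕ → ℕ) (m : ℕ), (∀ k, 2 ^ 15 ≤ f k ∧ f k < 2 ^ 16) →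
    (2 ^ (16 * n) * m + ∑ k ∈ range n, f k * 2 ^ (16 * k)) &&&
      (∑ k ∈ range n, 2 ^ 15 * 2 ^ (16 * k)) = ∑ k ∈ range n, 2 ^ 15 * 2 ^ (16 * k) := by
  induction n with
  | zero => intro f m _; simp
  | succ n ih =>
    intro f m hf
    have e : ∀ g : ℕ → ℕ, ∑ k ∈ range (n + 1), g k * 2 ^ (16 * k) =
        2 ^ 16 * (∑ k ∈ range n, g (k + 1) * 2 ^ (16 * k)) + g 0 := by
      intro g
      have h1 : ∀ k, g (k + 1) * 2 ^ (16 * (k + 1)) = 2 ^ 16 * (g (k + 1) * 2 ^ (16 * k)) := by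
        intro k
        rw [mul_add, mul_one, pow_add]; ring
      rw [sum_range_succ', mul_sum, mul_zero, pow_zero, mul_one]
      simp only [h1]
    have e' : 2 ^ (16 * (n + 1)) * m + ∑ k ∈ range (n + 1), f k * 2 ^ (16 * k) =
        2 ^ 16 * (2 ^ (16 * n) * m + ∑ k ∈ range n, f (k + 1) * 2 ^ (16 * k)) + f 0 := by
      rw [e f, mul_add 16, mul_one, pow_add]; ring
    have hi := ih (fun k => f (k + 1)) m (fun k => hf (k + 1))
    rw [e', e (fun _ => 2 ^ 15)]
    refine Nat.eq_of_testBit_eq fun i => ?_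
    rw [Nat.testBit_and, Nat.testBit_two_pow_mul_add _ (hf 0).2,
      Nat.testBit_two_pow_mul_add _ (show 2 ^ 15 < 2 ^ 16 by norm_num)]
    split_ifs with h
    · rw [Nat.testBit_two_pow]
      by_cases h15 : 15 = i
      · subst h15
        have : (f 0).testBit 15 = true := by
          rw [Nat.testBit_eq_decide_div_mod_eq]
          have := hf 0
          have h2 : f 0 / 2 ^ 15 = 1 := by omega
          rw [h2]; rfl
        rw [this]; rfl
      · simp [h15]
    · rw [← Nat.testBit_and]
      exact congrArg (fun z => Nat.testBit z (i - 16)) hi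

theorem autoCorr_lt (r : ℕ) : autoCorr r < 512 := Nat.mod_lt _ (by norm_num)

/-- The sum over `D` of the values of `autoCorr` at the images under the `k`-th homomorphism. -/
def corrSum (D : Finset Pt) (k : ℕ) : ℕ := ∑ d ∈ D, autoCorr (charVal k (cd d))

theorem corrSum_lt (D : Finset Pt) (k : ℕ) : corrSum D k < 2 ^ 16 := by
  have h1 : corrSum D k ≤ ∑ d ∈ D, 511 :=
    sum_le_sum fun d _ => by have := autoCorr_lt (charVal k (cd d)); omega
  have h2 : #D ≤ 81 := card_le_univ D
  rw [sum_const, smul_eq_mul] at h1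
  omega

theorem stateOf_eq (D : Finset Pt) :
    stateOf D = 2 ^ 640 * maskOf D + ∑ k ∈ range 40, corrSum D k * 2 ^ (16 * k) := by
  have h1 : ∀ d : Pt, entryCode (cd d) = 2 ^ 640 * 2 ^ cd d +
      ∑ k ∈ range 40, autoCorr (charVal k (cd d)) * 2 ^ (16 * k) := by
    intro d
    have e : entryCode (cd d) = 1 <<< (640 + cd d) + weight (cd d) := rfl
    have e2 : ∀ k, Nat.shiftLeft (autoCorr (charVal k (cd d))) (Nat.mul 16 k) =
        autoCorr (charVal k (cd d)) * 2 ^ (16 * k) := fun k => Nat.shiftLeft_eq _ _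
    rw [e, weight, sumUpTo_eq, Nat.shiftLeft_eq, one_mul, pow_add]
    simp only [e2]
  unfold stateOf maskOf corrSum
  simp only [h1]
  rw [sum_add_distrib, mul_sum, sum_comm]
  simp only [sum_mul]

set_option exponentiation.threshold 1000 in
theorem stateOf_shiftRight (D : Finset Pt) : Nat.shiftRight (stateOf D) 640 = maskOf D := by
  have h := pack_lt (corrSum D) (corrSum_lt D) 40
  have e : Nat.shiftRight (stateOf D) 640 = stateOf D >>> 640 := rfl
  rw [e, Nat.shiftRight_eq_div_pow, stateOf_eq, Nat.mul_add_div (Nat.two_pow_pos _),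
    Nat.div_eq_of_lt h, add_zero]

theorem feasible_of_le {D : Finset Pt} {n : ℕ} (hn : n ≤ 3)
    (h : ∀ k, 1950 * n ≤ corrSum D k) (hc : #D ≤ 60) :
    feasible unitFields n (stateOf D) = true := by
  have hU : unitFields = ∑ k ∈ range 40, 2 ^ (16 * k) := by
    unfold unitFields
    rw [sumUpTo_eq]
    refine sum_congr rfl fun k _ => ?_
    have : Nat.shiftLeft 1 (Nat.mul 16 k) = 1 <<< (16 * k) := rfl
    rw [this, Nat.shiftLeft_eq, one_mul]
  have hW : Nat.shiftLeft unitFields 15 = ∑ k ∈ range 40, 2 ^ 15 * 2 ^ (16 * k) := by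
    have : Nat.shiftLeft unitFields 15 = unitFields <<< 15 := rfl
    rw [this, Nat.shiftLeft_eq, hU, sum_mul]
    exact sum_congr rfl fun k _ => mul_comm _ _
  have hup : ∀ k, corrSum D k ≤ 511 * 60 := by
    intro k
    have h1 : corrSum D k ≤ ∑ d ∈ D, 511 :=
      sum_le_sum fun d _ => by have := autoCorr_lt (charVal k (cd d)); omega
    rw [sum_const, smul_eq_mul] at h1
    omega
  have hsub : Nat.sub (∑ k ∈ range 40, 2 ^ 15 * 2 ^ (16 * k)) (Nat.mul (Nat.mul 1950 n) unitFields)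
      = ∑ k ∈ range 40, (2 ^ 15 - 1950 * n) * 2 ^ (16 * k) := by
    have e : Nat.sub (∑ k ∈ range 40, 2 ^ 15 * 2 ^ (16 * k)) (Nat.mul (Nat.mul 1950 n) unitFields)
      = (∑ k ∈ range 40, 2 ^ 15 * 2 ^ (16 * k)) - 1950 * n * unitFields := rfl
    rw [e, hU, ← mul_sum, ← mul_sum, Nat.sub_mul]
  have hsum : Nat.add (stateOf D) (∑ k ∈ range 40, (2 ^ 15 - 1950 * n) * 2 ^ (16 * k)) =
      2 ^ (16 * 40) * maskOf D +
        ∑ k ∈ range 40, (corrSum D k + (2 ^ 15 - 1950 * n)) * 2 ^ (16 * k) := by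
    have e : Nat.add (stateOf D) (∑ k ∈ range 40, (2 ^ 15 - 1950 * n) * 2 ^ (16 * k)) =
      stateOf D + ∑ k ∈ range 40, (2 ^ 15 - 1950 * n) * 2 ^ (16 * k) := rfl
    rw [e, stateOf_eq, add_assoc, ← sum_add_distrib]
    simp only [add_mul]
  unfold feasible
  rw [force_eq, hW, hsub, hsum]
  have hp := pack_and 40 (fun k => corrSum D k + (2 ^ 15 - 1950 * n)) (maskOf D) (fun k => by
    have := h k
    have := hup k
    constructor <;> omega)
  have e2 : ∀ a b c : ℕ, a &&& b = c → Nat.beq (Nat.land a b) c = true := by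
    rintro a b c rfl
    exact Nat.beq_refl _
  exact e2 _ _ _ hp

/-! ### Decompositions of a set of differences into blocks -/

/-- `C` is a translate of `B` or of `-B`. -/
def SignTranslate (B C : Finset Pt) : Prop :=
  ∃ g : Pt, C = translate g B ∨ C = translate g (B.image fun x => -x)

theorem mem_translate {g x : Pt} {B : Finset Pt} : x ∈ translate g B ↔ x - g ∈ B := by
  unfold translate
  rw [mem_image]
  constructor
  · rintro ⟨b, hb, rfl⟩; simpa using hb
  · intro h; exact ⟨_, h, by abel⟩

theorem mem_image_neg {x : Pt} {B : Finset Pt} : x ∈ B.image (fun x => -x) ↔ -x ∈ B := by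
  rw [mem_image]
  constructor
  · rintro ⟨b, hb, rfl⟩; simpa using hb
  · intro h; exact ⟨_, h, by abel⟩

theorem signTranslate_iff {B C : Finset Pt} : SignTranslate B C ↔
    ∃ g, (∀ x, x ∈ C ↔ x - g ∈ B) ∨ ∀ x, x ∈ C ↔ g - x ∈ B := by
  unfold SignTranslate
  refine exists_congr fun g => or_congr ?_ ?_
  · rw [Finset.ext_iff]; simp only [mem_translate]
  · rw [Finset.ext_iff]; simp only [mem_translate, mem_image_neg, neg_sub]

theorem SignTranslate.refl (B : Finset Pt) : SignTranslate B B :=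
  signTranslate_iff.2 ⟨0, Or.inl fun x => by simp⟩

theorem SignTranslate.symm {B C : Finset Pt} (h : SignTranslate B C) : SignTranslate C B := by
  rw [signTranslate_iff] at *
  obtain ⟨g, h | h⟩ := h
  · exact ⟨-g, Or.inl fun x => by rw [h]; simp⟩
  · exact ⟨g, Or.inr fun x => by rw [h]; simp⟩

theorem SignTranslate.trans {A B C : Finset Pt} (h : SignTranslate A B) (h' : SignTranslate B C) :
    SignTranslate A C := by
  rw [signTranslate_iff] at *
  obtain ⟨g, h | h⟩ := h <;> obtain ⟨g', h' | h'⟩ := h'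
  · exact ⟨g' + g, Or.inl fun x => by rw [h', h, sub_sub]⟩
  · exact ⟨g' - g, Or.inr fun x => by rw [h', h]; congr! 1; abel⟩
  · exact ⟨g + g', Or.inr fun x => by rw [h', h]; congr! 1; abel⟩
  · exact ⟨g' - g, Or.inl fun x => by rw [h', h]; congr! 1; abel⟩

theorem SignTranslate.image {B C : Finset Pt} (α : Pt ≃+ Pt) (h : SignTranslate B C) :
    SignTranslate (B.image α) (C.image α) := by
  rw [signTranslate_iff] at *
  have hm : ∀ (A : Finset Pt) x, x ∈ A.image α ↔ α.symm x ∈ A := by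
    intro A x
    rw [mem_image]
    constructor
    · rintro ⟨b, hb, rfl⟩; simpa using hb
    · intro h; exact ⟨_, h, by simp⟩
  obtain ⟨g, h | h⟩ := h
  · exact ⟨α g, Or.inl fun x => by rw [hm, hm, h, map_sub]; simp⟩
  · exact ⟨α g, Or.inr fun x => by rw [hm, hm, h, map_sub]; simp⟩

theorem diffCount_eq_of_equiv {A B : Finset Pt} {d d' : Pt} (e : Pt ≃ Pt)
    (he : ∀ x, x ∈ B ↔ e x ∈ A) (hd : ∀ x y, x - y = d ↔ e x - e y = d') :
    diffCount B d = diffCount A d' := by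
  unfold diffCount
  refine card_bij' (fun p _ => (e p.1, e p.2)) (fun p _ => (e.symm p.1, e.symm p.2)) ?_ ?_ ?_ ?_
  · intro p hp
    rw [mem_filter, mem_product] at *
    exact ⟨⟨(he _).1 hp.1.1, (he _).1 hp.1.2⟩, (hd _ _).1 hp.2⟩
  · intro p hp
    rw [mem_filter, mem_product] at *
    refine ⟨⟨(he _).2 ?_, (he _).2 ?_⟩, (hd _ _).2 ?_⟩
    · simpa using hp.1.1
    · simpa using hp.1.2
    · simpa using hp.2
  · intro p _; simp
  · intro p _; simp

theorem diffCount_neg (B : Finset Pt) (d : Pt) : diffCount B (-d) = diffCount B d := by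
  unfold diffCount
  refine card_bij' (fun p _ => (p.2, p.1)) (fun p _ => (p.2, p.1)) ?_ ?_ ?_ ?_
  · intro p hp
    rw [mem_filter, mem_product] at *
    exact ⟨⟨hp.1.2, hp.1.1⟩, by rw [← neg_sub, hp.2, neg_neg]⟩
  · intro p hp
    rw [mem_filter, mem_product] at *
    exact ⟨⟨hp.1.2, hp.1.1⟩, by rw [← neg_sub, hp.2]⟩
  · intro p _; rfl
  · intro p _; rfl

theorem SignTranslate.diffCount_eq {B C : Finset Pt} (h : SignTranslate B C) (d : Pt) :
    diffCount C d = diffCount B d := by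
  rw [signTranslate_iff] at h
  obtain ⟨g, h | h⟩ := h
  · exact diffCount_eq_of_equiv (Equiv.subRight g) h (fun x y => by simp)
  · rw [← diffCount_neg B d]
    refine diffCount_eq_of_equiv (Equiv.subLeft g) h (fun x y => ?_)
    simp only [Equiv.subLeft_apply, sub_sub_sub_cancel_left]
    rw [← neg_sub x y, neg_inj]

theorem SignTranslate.card_eq {B C : Finset Pt} (h : SignTranslate B C) : #C = #B := by
  obtain ⟨g, rfl | rfl⟩ := h
  · exact card_image_of_injective _ (add_right_injective g)
  · rw [translate, card_image_of_injective _ (add_right_injective g),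
      card_image_of_injective _ neg_injective]

/-- The blocks of `F` have five points each, and each element of `D` occurs exactly once among
their differences, other nonzero elements do not occur. -/
structure Decomposes (F : Multiset (Finset Pt)) (D : Finset Pt) : Prop where
  card_block : ∀ B ∈ F, #B = 5
  zero_notMem : (0 : Pt) ∉ D
  sum_eq : ∀ d : Pt, d ≠ 0 → (F.map (fun B => diffCount B d)).sum = if d ∈ D then 1 else 0

theorem sum_map_sum_comm {ι κ : Type*} (F : Multiset ι) (s : Finset κ) (f : ι → κ → ℤ) :
    (F.map fun B => ∑ d ∈ s, f B d).sum = ∑ d ∈ s, (F.map fun B => f B d).sum := by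
  induction F using Multiset.induction_on with
  | empty => simp
  | cons a F ih => simp [ih, sum_add_distrib]

theorem sum_sub_eq (B : Finset Pt) (φ : Pt → ℤ) :
    ∑ p ∈ B ×ˢ B, φ (p.1 - p.2) = ∑ d, (diffCount B d : ℤ) * φ d := by
  rw [← sum_fiberwise (B ×ˢ B) (fun p => p.1 - p.2)]
  refine sum_congr rfl fun d _ => ?_
  rw [sum_congr rfl (g := fun _ => φ d) (fun p hp => by rw [(mem_filter.1 hp).2]), sum_const,
    nsmul_eq_mul]
  rfl

theorem diffCount_zero (B : Finset Pt) : diffCount B 0 = #B := by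
  unfold diffCount
  refine card_bij' (fun p _ => p.1) (fun x _ => (x, x)) ?_ ?_ ?_ ?_
  · intro p hp; rw [mem_filter, mem_product] at hp; exact hp.1.1
  · intro p hp; rw [mem_filter, mem_product]; exact ⟨⟨hp, hp⟩, sub_self _⟩
  · intro p hp
    rw [mem_filter] at hp
    exact Prod.ext rfl (sub_eq_zero.1 hp.2)
  · intro p _; rfl

/-- Summing a function over all differences of the blocks: the differences that are zero contribute
`5` for each block. -/
theorem Decomposes.sum_add {F : Multiset (Finset Pt)} {D : Finset Pt} (h : Decomposes F D)
    (φ : Pt → ℤ) : ∑ d ∈ D, φ d + 5 * (Multiset.card F) * φ 0 =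
      (F.map fun B => ∑ p ∈ B ×ˢ B, φ (p.1 - p.2)).sum := by
  simp only [sum_sub_eq]
  rw [sum_map_sum_comm, ← add_sum_erase univ _ (mem_univ 0), add_comm]
  have hs : ∀ d, (F.map fun B => (diffCount B d : ℤ) * φ d).sum =
      ((F.map fun B => diffCount B d).sum : ℤ) * φ d := by
    intro d
    rw [Multiset.sum_map_mul_right, Nat.cast_multiset_sum, Multiset.map_map]; rfl
  simp only [hs]
  congr 1
  · have : F.map (fun B => diffCount B 0) = F.map fun _ => 5 :=
      Multiset.map_congr rfl fun B hB => by rw [diffCount_zero, h.card_block B hB]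
    rw [this, Multiset.map_const', Multiset.sum_replicate, smul_eq_mul]
    push_cast; ring
  · have h1 : ∑ d ∈ D, φ d = ∑ d ∈ univ.erase 0, if d ∈ D then φ d else 0 := by
      rw [← sum_filter]
      refine sum_congr ?_ fun _ _ => rfl
      ext d
      simp only [mem_filter, mem_erase, mem_univ, and_true]
      exact ⟨fun hd => ⟨fun h0 => h.zero_notMem (h0 ▸ hd), hd⟩, fun hd => hd.2⟩
    rw [h1]
    refine sum_congr rfl fun d hd => ?_
    rw [h.sum_eq d (mem_erase.1 hd).1]
    split_ifs <;> simp

theorem Decomposes.card_eq {F : Multiset (Finset Pt)} {D : Finset Pt} (h : Decomposes F D) :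
    #D = 20 * Multiset.card F := by
  have h1 := h.sum_add (fun _ => 1)
  have h2 : (F.map fun B => ∑ p ∈ B ×ˢ B, (1 : ℤ)) = F.map fun _ => 25 :=
    Multiset.map_congr rfl fun B hB => by
      rw [sum_const, card_product, h.card_block B hB]; rfl
  rw [h2, Multiset.map_const', Multiset.sum_replicate] at h1
  simp only [sum_const, nsmul_eq_mul, mul_one] at h1
  omega

/-! ### The spectral inequality -/

/-- `3 * cos (2 * π * r / 27)`, rounded to an integer. -/
def cosApprox (r : ZMod 27) : ℤ :=
  [3, 3, 3, 2, 2, 1, 1, 0, -1, -1, -2, -3, -3, -3, -3, -3, -3, -2, -2, -1, 0, 1, 1, 2, 2, 3,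
    3].getD r.val 0

theorem autoCorr_eq (r : ℕ) : (autoCorr r : ℤ) =
    131 + ∑ s : ZMod 27, cosApprox s * cosApprox (s + (r : ZMod 27)) := by
  have h : ∀ x : ZMod 27, (autoCorr x.val : ℤ) =
      131 + ∑ s : ZMod 27, cosApprox s * cosApprox (s + x) := by decide +kernel
  have h1 : autoCorr (r : ZMod 27).val = autoCorr r := by
    have e : ∀ a, autoCorr a = (autoCorr (a % 27)) := by
      intro a
      have : Nat.mod (a % 27) 27 = Nat.mod a 27 := Nat.mod_mod a 27
      unfold autoCorr
      rw [this]
    rw [ZMod.val_natCast, ← e]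
  rw [← h1]
  exact h _

theorem charVal_sub (k : ℕ) (x y : Pt) : (charVal k (cd (x - y)) : ZMod 27) =
    (charVal k (cd x) : ZMod 27) - (charVal k (cd y) : ZMod 27) := by
  have hc : ∀ x : Pt, (charVal k (cd x) : ZMod 27) =
      bif Nat.blt k 13 then ((k : ZMod 27) + 1) * x.2
      else 9 * (x.1.val : ZMod 27) + ((k - 13 : ℕ) : ZMod 27) * x.2 := by
    intro x
    have h1 : x.1.val < 3 := ZMod.val_lt _
    have a1 : Nat.mod (cd x) 6 = x.1.val := by
      have : Nat.mod (cd x) 6 = cd x % 6 := rfl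
      rw [this]; unfold cd; omega
    have a2 : Nat.div (cd x) 6 = x.2.val := by
      have : Nat.div (cd x) 6 = cd x / 6 := rfl
      rw [this]; unfold cd; omega
    unfold charVal
    rw [a1, a2]
    cases Nat.blt k 13 with
    | true =>
      have e : Nat.mul (Nat.add k 1) x.2.val = (k + 1) * x.2.val := rfl
      simp only [cond_true, e]
      push_cast
      simp
    | false =>
      have e : Nat.add (Nat.mul 9 x.1.val) (Nat.mul (Nat.sub k 13) x.2.val) =
        9 * x.1.val + (k - 13) * x.2.val := rfl
      simp only [cond_false, e]
      push_cast
      simp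
  have h3 : ∀ a b : ZMod 3, (9 * ((a - b).val : ZMod 27)) =
      9 * (a.val : ZMod 27) - 9 * (b.val : ZMod 27) := by decide +kernel
  rw [hc, hc, hc]
  cases Nat.blt k 13 with
  | true => simp only [cond_true, Prod.snd_sub]; ring
  | false => simp only [cond_false, Prod.snd_sub, Prod.fst_sub, h3]; ring

/-- The autocorrelation of `cosApprox` is positive semidefinite, so that its sum over all
differences of a block, including zero, is a sum of squares. A family of `n` blocks has `20 * n`
nonzero differences and `5 * n` zero ones, the value at zero is `134`, and `autoCorr` is shifted by
`131`; the bound is `20 * 131 - 5 * 134 = 1950` for each block. -/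
theorem Decomposes.le_corrSum {F : Multiset (Finset Pt)} {D : Finset Pt} (h : Decomposes F D)
    (k : ℕ) : 1950 * Multiset.card F ≤ corrSum D k := by
  set g : ZMod 27 → ℤ := fun x => ∑ s : ZMod 27, cosApprox s * cosApprox (s + x) with hg
  set χ : Pt → ZMod 27 := fun x => (charVal k (cd x) : ZMod 27) with hχ
  have hsum := h.sum_add (fun d => g (χ d))
  have hnonneg : 0 ≤ (F.map fun B => ∑ p ∈ B ×ˢ B, g (χ (p.1 - p.2))).sum := by
    refine Multiset.sum_nonneg fun z hz => ?_
    obtain ⟨B, _, rfl⟩ := Multiset.mem_map.1 hz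
    have : ∑ p ∈ B ×ˢ B, g (χ (p.1 - p.2)) =
        ∑ s : ZMod 27, (∑ x ∈ B, cosApprox (s + χ x)) ^ 2 := by
      have h1 : ∀ x y : Pt, g (χ (x - y)) =
          ∑ s : ZMod 27, cosApprox (s + χ x) * cosApprox (s + χ y) := by
        intro x y
        have hχs : χ (x - y) = χ x - χ y := charVal_sub k x y
        rw [hχs]
        refine (Fintype.sum_equiv (Equiv.addRight (χ y)) _ _ fun s => ?_).symm
        rw [Equiv.coe_addRight, add_add_sub_cancel, mul_comm]
      rw [sum_product, sum_congr rfl fun x _ => sum_congr rfl fun y _ => h1 x y]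
      simp only [sq, sum_mul_sum]
      rw [sum_comm (s := univ)]
      exact sum_congr rfl fun x _ => sum_comm
    rw [this]
    exact sum_nonneg fun s _ => sq_nonneg _
  have h0 : g (χ 0) = 134 := by
    have : χ 0 = 0 := by
      have := charVal_sub k 0 0
      rw [sub_self, sub_self] at this
      exact this
    rw [this]
    decide +kernel
  have h2 : (corrSum D k : ℤ) = 131 * #D + ∑ d ∈ D, g (χ d) := by
    unfold corrSum
    push_cast
    rw [sum_congr rfl fun d _ => autoCorr_eq (charVal k (cd d)), sum_add_distrib, sum_const,
      nsmul_eq_mul, mul_comm]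
  have h3 := h.card_eq
  rw [← hsum] at hnonneg
  simp only [h0] at hnonneg
  omega

/-! ### The search -/

/-- The number of elements of a bit set of points, modulo `63`: as `2 ^ 6` is `1` modulo `63`, it is
the sum of the residues of the parts with `u = 0`, `u = 1` and `u = 2`. -/
def count63 (x : ℕ) : ℕ :=
  Nat.mod (Nat.add (Nat.land x 0x1041041041041041041041041041041041041041)
    (Nat.add (Nat.land (Nat.shiftRight x 1) 0x1041041041041041041041041041041041041041)
      (Nat.land (Nat.shiftRight x 2) 0x1041041041041041041041041041041041041041))) 63

/-- Chooses an element `e` of the bit set `S` for which few elements `x` of `S` are such that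
`x - e` is in `S`, out of the elements with code below `54` or the lowest element. Candidates are
compared by `256` times this number (modulo `63`) plus their code. This only serves to keep the
search tree small: `search` verifies that the chosen element is in `S`, and is valid for any such
element. -/
noncomputable def pick (K S : ℕ) : ℕ :=
  force (ext S) fun E => Nat.land 255 (Nat.rec (fun _ _ best => best) (fun _ ih o x best => Bool.rec
    (force (Nat.add o (idx K (low x))) fun k => force (Nat.succ k) fun o' =>
      force (Nat.shiftRight x (Nat.sub o' o)) fun x' =>
      force (Nat.land S (Nat.shiftRight E (Nat.sub 165 k))) fun y =>
      force (Nat.add (Nat.shiftLeft (count63 y) 8) k)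
        fun key => Bool.rec (ih o' x' best) (ih o' x' key) (Nat.ble key best)) best
          (Nat.beq x 0)) 27
    0 (Nat.mod S 18014398509481984) (Nat.add 65536 (idx K (low S))))

/-- The step of the search that adds the last point `c` to `{0, e, a, b}`. Here `Z` is the state
without the differences in `{0, e, a, b}`, and `next` is the search for the other blocks. -/
noncomputable def addLast (T M U n : ℕ) (next : ℕ → List ℕ → Bool) (h : List ℕ)
    (e a b Z c _o _m : ℕ) :
    Bool :=
  force (Nat.add (Nat.add (tab T M (Nat.add 165 c)) (tab T M (Nat.sub (Nat.add 165 c) e)))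
    (Nat.add (tab T M (Nat.sub (Nat.add 165 c) a))
      (tab T M (Nat.sub (Nat.add 165 c) b)))) fun Y =>
  Bool.rec true (force (Nat.sub Z Y) fun Z' =>
    Bool.rec true (next Z' (e :: a :: b :: c :: h)) (feasible U n Z')) (Nat.ble Y Z)

/-- The step of the search that adds a point `b` to `{0, e, a}`. Here `Z` is the state without the
differences in `{0, e, a}`, with differences `E`, and `m` is the set of candidates that are left
for the last point, with offset `o`. -/
noncomputable def addFourth (T M K U n : ℕ) (next : ℕ → List ℕ → Bool) (h : List ℕ)
    (e a Z E b o m : ℕ) : Bool :=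
  force (Nat.land m (Nat.shiftRight E (Nat.sub (Nat.add 165 o) b))) fun C => Bool.rec (
    force (Nat.sub (Nat.sub (Nat.sub Z (tab T M (Nat.add 165 b)))
      (tab T M (Nat.sub (Nat.add 165 b) e))) (tab T M (Nat.sub (Nat.add 165 b) a))) fun Z' =>
    force (ext (Nat.shiftRight Z' 640)) fun E' =>
    loop K (addLast T M U n next h e a b Z') (fun _ _ x => x) 82 o
      (Nat.land C (Nat.land (Nat.land (Nat.shiftRight E' (Nat.add 165 o))
        (Nat.shiftRight E' (Nat.sub (Nat.add 165 o) e)))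
        (Nat.land (Nat.shiftRight E' (Nat.sub (Nat.add 165 o) a))
          (Nat.shiftRight E' (Nat.sub (Nat.add 165 o) b)))))) true (Nat.beq C 0)

/-- The step of the search that adds a point `a` to `{0, e}`. Here `Z` is the state without the
differences in `{0, e}`, with differences `E`, and `m` is the set of candidates that are left for
the other two points, with offset `o`. -/
noncomputable def addThird (T M K U n : ℕ) (next : ℕ → List ℕ → Bool) (h : List ℕ)
    (e Z E a o m : ℕ) : Bool :=
  force (Nat.land m (Nat.shiftRight E (Nat.sub (Nat.add 165 o) a))) fun C => Bool.rec (
    force (Nat.sub (Nat.sub Z (tab T M (Nat.add 165 a))) (tab T M (Nat.sub (Nat.add 165 a) e)))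
      fun Z' =>
    force (ext (Nat.shiftRight Z' 640)) fun E' =>
    force (Nat.land C (Nat.land (Nat.shiftRight E' (Nat.add 165 o))
      (Nat.land (Nat.shiftRight E' (Nat.sub (Nat.add 165 o) e))
        (Nat.shiftRight E' (Nat.sub (Nat.add 165 o) a))))) fun C' =>
    loop K (addFourth T M K U n next h e a Z' E') (fun _ _ x => x) 82 o C')
    true (Nat.beq C 0)

/-- Removes the code of `e - a` from the bit set `x` with offset `o`. -/
noncomputable def removeReflection (e a o x : ℕ) : ℕ :=
  force (Nat.shiftRight (Nat.shiftLeft 1 (norm (Nat.sub (Nat.add 165 e) a))) o)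
    fun q => Nat.xor (Nat.lor x q) q

/-- The search for all ways to write the set of differences with state `Z` as the set of differences
of `n` blocks, up to translation and negation of each block. The numbers `e`, `a`, `b`, `c` are
put in front of `h` for each block `{0, e, a, b, c}`, and `leaf` is tested in the end. -/
noncomputable def search (T M K U : ℕ) (leaf : List ℕ → Bool) (n : ℕ) : ℕ → List ℕ → Bool :=
  Nat.rec (fun Z h => Bool.rec true (leaf h) (Nat.beq Z 0))
   (fun n next Z h =>
     force (Nat.shiftRight Z 640) fun S => force (pick K S) fun e => Bool.rec false (
     force (Nat.sub Z (tab T M (Nat.add 165 e))) fun Z' =>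
     force (ext (Nat.shiftRight Z' 640)) fun E =>
     loop K (addThird T M K U n next h e Z' E)
       (removeReflection e) 82 0
       (Nat.land (Nat.shiftRight Z' 640) (Nat.shiftRight E (Nat.sub 165 e))))
     (Nat.beq 1 (Nat.land 1 (Nat.shiftRight S e)))) n

/-- The search for the families with a block `{0, 54, 6, b, c}`. -/
noncomputable def start (T M K U Z0 : ℕ) (leaf : List ℕ → Bool) (b c : ℕ) : Bool :=
  force (Nat.sub (Nat.sub (Nat.sub (Nat.sub (Nat.sub (Nat.sub (Nat.sub (Nat.sub (Nat.sub (Nat.sub Z0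
    (tab T M 219)) (tab T M 171)) (tab T M 117)) (tab T M (Nat.add 165 b)))
    (tab T M (Nat.sub (Nat.add 165 b) 54))) (tab T M (Nat.sub (Nat.add 165 b) 6)))
    (tab T M (Nat.add 165 c))) (tab T M (Nat.sub (Nat.add 165 c) 54)))
    (tab T M (Nat.sub (Nat.add 165 c) 6))) (tab T M (Nat.sub (Nat.add 165 c) b))) fun Z =>
  Bool.rec true (search T M K U leaf 3 Z (54 :: 6 :: b :: c :: [])) (feasible U 3 Z)

/-- The families that the search finds, as lists of the codes other than `0`. -/
def solutions : List (List ℕ) := [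
    [26, 61, 102, 116, 7, 19, 32, 103, 24, 42, 92, 122, 54, 6, 1, 37],
    [13, 44, 66, 102, 26, 42, 85, 97, 38, 49, 128, 133, 54, 6, 7, 24],
    [8, 26, 61, 128, 20, 30, 44, 133, 19, 31, 74, 96, 54, 6, 7, 90],
    [8, 26, 60, 127, 14, 31, 96, 120, 19, 32, 44, 132, 54, 6, 7, 90],
    [14, 43, 79, 121, 24, 49, 109, 139, 8, 12, 103, 104, 54, 6, 19, 37],
    [13, 42, 98, 134, 50, 62, 122, 146, 30, 7, 25, 104, 54, 6, 20, 55],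
    [7, 38, 60, 72, 14, 55, 84, 85, 20, 36, 62, 86, 54, 6, 49, 67],
    [7, 19, 44, 91, 36, 60, 62, 92, 20, 55, 86, 97, 54, 6, 49, 67],
    [32, 79, 102, 103, 20, 31, 127, 140, 19, 7, 37, 104, 54, 6, 49, 90],
    [19, 7, 24, 128, 18, 49, 60, 96, 30, 43, 98, 133, 54, 6, 79, 80],
    [20, 8, 24, 127, 18, 50, 60, 96, 30, 44, 97, 134, 54, 6, 79, 80]]

/-- The search for the families with a block `{0, 54, 6, b, c}`, for all `(b, c)` in a list. -/
noncomputable def run (l : List (ℕ × ℕ)) : Bool :=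
  force pairTable fun T => force (Nat.pow 2 802) fun M => force logTable fun K =>
  force unitFields fun U => force fullState fun Z0 =>
  List.rec true (fun p _ ih => Bool.rec false ih
    (start T M K U Z0 (fun h => decide (h ∈ solutions)) p.1 p.2)) l

/-! ### Correctness of the search -/

/-- The properties of the tables that the correctness of the search depends on. The tables are kept
as variables, since the elaborator would evaluate the closed terms. -/
structure IsTables (T M K U : ℕ) : Prop where
  tab_sub : ∀ x y : Pt, tab T M (165 + cd x - cd y) =
    entryCode (cd (x - y)) + entryCode (cd (y - x))
  log : K = logTable
  unit : U = unitFields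

theorem isTables : IsTables pairTable (Nat.pow 2 802) logTable unitFields :=
  ⟨tab_sub, rfl, rfl⟩

/-- The elements of `D` that are not differences of elements of `S`. -/
def removeDiffs (D S : Finset Pt) : Finset Pt := D \ S.offDiag.image (fun p => p.1 - p.2)

section Block

variable {B : Finset Pt} {F : Multiset (Finset Pt)} {D : Finset Pt}

theorem Decomposes.diffCount_le_one (hF : Decomposes (B ::ₘ F) D) {d : Pt} (hd : d ≠ 0) :
    diffCount B d ≤ 1 := by
  have h := hF.sum_eq d hd
  rw [Multiset.map_cons, Multiset.sum_cons] at h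
  split_ifs at h <;> omega

/-- The differences of a block are distinct. -/
theorem Decomposes.sub_injOn (hF : Decomposes (B ::ₘ F) D) {x y z w : Pt} (hx : x ∈ B)
    (hy : y ∈ B) (hz : z ∈ B) (hw : w ∈ B) (hxy : x ≠ y) (h : x - y = z - w) :
    x = z ∧ y = w := by
  have h1 := hF.diffCount_le_one (sub_ne_zero.2 hxy)
  have h2 := card_le_one.1 h1 (x, y) (mem_filter.2 ⟨mem_product.2 ⟨hx, hy⟩, rfl⟩) (z, w)
    (mem_filter.2 ⟨mem_product.2 ⟨hz, hw⟩, h.symm⟩)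
  exact ⟨congrArg Prod.fst h2, congrArg Prod.snd h2⟩

theorem Decomposes.sub_mem (hF : Decomposes (B ::ₘ F) D) {x y : Pt} (hx : x ∈ B)
    (hy : y ∈ B) (hxy : x ≠ y) : x - y ∈ D := by
  have h := hF.sum_eq _ (sub_ne_zero.2 hxy)
  rw [Multiset.map_cons, Multiset.sum_cons] at h
  have h1 : 0 < diffCount B (x - y) :=
    card_pos.2 ⟨(x, y), mem_filter.2 ⟨mem_product.2 ⟨hx, hy⟩, rfl⟩⟩
  by_contra hn
  rw [if_neg hn] at h
  omega

theorem Decomposes.sub_mem_removeDiffs (hF : Decomposes (B ::ₘ F) D) {S : Finset Pt} (hS : S ⊆ B)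
    {x y : Pt} (hx : x ∈ B) (hy : y ∈ B) (hxy : x ≠ y) (hn : ¬ (x ∈ S ∧ y ∈ S)) :
    x - y ∈ removeDiffs D S := by
  refine mem_sdiff.2 ⟨hF.sub_mem hx hy hxy, fun h => hn ?_⟩
  obtain ⟨⟨z, w⟩, hp, he⟩ := mem_image.1 h
  obtain ⟨hz, hw, _⟩ := mem_offDiag.1 hp
  obtain ⟨rfl, rfl⟩ := hF.sub_injOn hx hy (hS hz) (hS hw) hxy he.symm
  exact ⟨hz, hw⟩

theorem Decomposes.stateOf_eq_add (hF : Decomposes (B ::ₘ F) D) {S : Finset Pt} (hS : S ⊆ B) :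
    stateOf D = stateOf (removeDiffs D S) + ∑ p ∈ S.offDiag, entryCode (cd (p.1 - p.2)) := by
  have hinj : Set.InjOn (fun p : Pt × Pt => p.1 - p.2) S.offDiag := by
    intro p hp q hq h
    obtain ⟨h1, h2, h3⟩ := mem_offDiag.1 hp
    obtain ⟨h4, h5, _⟩ := mem_offDiag.1 hq
    obtain ⟨h6, h7⟩ := hF.sub_injOn (hS h1) (hS h2) (hS h4) (hS h5) h3 h
    exact Prod.ext h6 h7
  have hsub : S.offDiag.image (fun p => p.1 - p.2) ⊆ D := by
    intro d hd
    obtain ⟨p, hp, rfl⟩ := mem_image.1 hd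
    obtain ⟨h1, h2, h3⟩ := mem_offDiag.1 hp
    exact hF.sub_mem (hS h1) (hS h2) h3
  unfold stateOf removeDiffs
  rw [← sum_sdiff hsub, sum_image hinj]

/-- Adding a point to `S` removes its differences with the points of `S` from the state. -/
theorem Decomposes.stateOf_removeDiffs {T M K U : ℕ} (hT : IsTables T M K U)
    (hF : Decomposes (B ::ₘ F) D) {S : Finset Pt} {z : Pt}
    (hS : insert z S ⊆ B) (hz : z ∉ S) : stateOf (removeDiffs D S) =
      stateOf (removeDiffs D (insert z S)) +
        ∑ s ∈ S, tab T M (165 + cd z - cd s) := by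
  have h1 := hF.stateOf_eq_add hS
  have h2 := hF.stateOf_eq_add ((subset_insert z S).trans hS)
  have h3 : ∑ p ∈ (insert z S).offDiag, entryCode (cd (p.1 - p.2)) =
      ∑ p ∈ S.offDiag, entryCode (cd (p.1 - p.2)) +
        ∑ s ∈ S, tab T M (165 + cd z - cd s) := by
    have hd1 : Disjoint S.offDiag ({z} ×ˢ S) := by
      rw [disjoint_left]
      rintro ⟨a, b⟩ ha hb
      rw [mem_product, mem_singleton] at hb
      exact hz (hb.1 ▸ (mem_offDiag.1 ha).1)
    have hd2 : Disjoint (S.offDiag ∪ {z} ×ˢ S) (S ×ˢ {z}) := by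
      rw [disjoint_left]
      rintro ⟨a, b⟩ ha hb
      rw [mem_product, mem_singleton] at hb
      rcases mem_union.1 ha with h | h
      · exact hz (hb.2 ▸ (mem_offDiag.1 h).2.1)
      · rw [mem_product, mem_singleton] at h
        exact hz (h.1 ▸ hb.1)
    rw [offDiag_insert, sum_union hd2, sum_union hd1, sum_product, sum_product_right,
      sum_singleton, sum_singleton, add_assoc, ← sum_add_distrib]
    · simp only [hT.tab_sub]
    · exact hz
  omega

theorem Decomposes.tail (hF : Decomposes (B ::ₘ F) D) : Decomposes F (removeDiffs D B) where
  card_block C hC := hF.card_block C (Multiset.mem_cons_of_mem hC)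
  zero_notMem h := hF.zero_notMem (mem_sdiff.1 h).1
  sum_eq d hd := by
    have h := hF.sum_eq d hd
    rw [Multiset.map_cons, Multiset.sum_cons] at h
    have h1 := hF.diffCount_le_one hd
    have hiff : diffCount B d ≠ 0 ↔ d ∈ B.offDiag.image (fun p => p.1 - p.2) := by
      rw [diffCount, card_ne_zero, mem_image]
      constructor
      · rintro ⟨p, hp⟩
        obtain ⟨h1, h2⟩ := mem_filter.1 hp
        obtain ⟨h3, h4⟩ := mem_product.1 h1
        exact ⟨p, mem_offDiag.2 ⟨h3, h4, fun h => hd (by rw [← h2, h, sub_self])⟩, h2⟩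
      · rintro ⟨p, hp, h2⟩
        obtain ⟨h3, h4, _⟩ := mem_offDiag.1 hp
        exact ⟨p, mem_filter.2 ⟨mem_product.2 ⟨h3, h4⟩, h2⟩⟩
    unfold removeDiffs
    simp only [mem_sdiff, ← hiff]
    by_cases hD : d ∈ D
    · by_cases h0 : diffCount B d = 0
      · simp only [hD, h0, ne_eq, not_true_eq_false, not_false_eq_true, and_self, if_true] at h ⊢
        omega
      · rw [if_pos hD] at h
        rw [if_neg (by simp [h0])]
        omega
    · rw [if_neg hD] at h
      rw [if_neg (by simp [hD])]
      omega

end Block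

theorem testBit_shift {D : Finset Pt} {x y : Pt} (h : x - y ∈ D) {o : ℕ} (ho : o ≤ cd x) :
    (Nat.shiftRight (ext (maskOf D)) (Nat.sub (Nat.add 165 o) (cd y))).testBit (cd x - o) =
      true := by
  have e : Nat.shiftRight (ext (maskOf D)) (Nat.sub (Nat.add 165 o) (cd y)) =
    ext (maskOf D) >>> (165 + o - cd y) := rfl
  have h1 := cd_lt x
  have h2 := cd_lt y
  have e2 : 165 + o - cd y + (cd x - o) = 165 + cd x - cd y := by omega
  rw [e, Nat.testBit_shiftRight, e2]
  exact testBit_ext (by omega) (by rw [pt_sub]; exact h)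

theorem testBit_shift_zero {D : Finset Pt} {x : Pt} (h : x ∈ D) {o : ℕ} (ho : o ≤ cd x) :
    (Nat.shiftRight (ext (maskOf D)) (Nat.add 165 o)).testBit (cd x - o) = true := by
  have := testBit_shift (y := 0) (by simpa using h) ho
  exact this

theorem testBit_land (a b i : ℕ) : (Nat.land a b).testBit i = (a.testBit i && b.testBit i) :=
  Nat.testBit_and a b i

theorem beq_zero_of_testBit {a i : ℕ} (h : a.testBit i = true) : Nat.beq a 0 = false := by
  cases hb : Nat.beq a 0 with
  | false => rfl
  | true => rw [Nat.eq_of_beq_eq_true hb, Nat.zero_testBit] at h; exact absurd h (by simp)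

section Steps

variable {B : Finset Pt} {F : Multiset (Finset Pt)} {D : Finset Pt} {n : ℕ}
  {T M K U : ℕ} {next : ℕ → List ℕ → Bool} {h : List ℕ} {e a b c : Pt}

theorem addLast_sound (hT : IsTables T M K U) (hF : Decomposes (B ::ₘ F) D)
    (hn : Multiset.card F = n) (hn2 : n ≤ 2)
    (hB : B = {c, b, a, e, 0}) (hnd : [c, b, a, e, 0].Nodup) (o m : ℕ)
    (hrun : addLast T M U n next h (cd e) (cd a) (cd b)
      (stateOf (removeDiffs D {b, a, e, 0})) (cd c) o m = true) :
    next (stateOf (removeDiffs D B)) (cd e :: cd a :: cd b :: cd c :: h) = true := by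
  simp only [List.nodup_cons, List.mem_cons, List.not_mem_nil, or_false, not_or] at hnd
  obtain ⟨⟨hcb, hca, hce, hc0⟩, ⟨hba, hbe, hb0⟩, ⟨hae, ha0⟩, he0, -⟩ := hnd
  have hst := hF.stateOf_removeDiffs hT (z := c) (S := {b, a, e, 0}) (by rw [hB]) (by simp [*])
  rw [sum_insert (by simp [*]), sum_insert (by simp [*]), sum_insert (by simp [*]),
    sum_singleton, cd_zero, Nat.sub_zero] at hst
  rw [← hB] at hst
  have hfeas : feasible U n (stateOf (removeDiffs D B)) = true := by
    have ht := hF.tail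
    have hc := ht.card_eq
    rw [hT.unit]
    exact feasible_of_le (by omega) (fun k => hn ▸ ht.le_corrSum k) (by omega)
  unfold addLast at hrun
  rw [force_eq, force_eq] at hrun
  set Y := Nat.add (Nat.add (tab T M (Nat.add 165 (cd c)))
    (tab T M (Nat.sub (Nat.add 165 (cd c)) (cd e))))
    (Nat.add (tab T M (Nat.sub (Nat.add 165 (cd c)) (cd a)))
      (tab T M (Nat.sub (Nat.add 165 (cd c)) (cd b)))) with hY
  have hY' : Y = tab T M (165 + cd c) +
      tab T M (165 + cd c - cd e) +
      (tab T M (165 + cd c - cd a) +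
      tab T M (165 + cd c - cd b)) := rfl
  clear_value Y
  have hst' : stateOf (removeDiffs D {b, a, e, 0}) = stateOf (removeDiffs D B) + Y := by omega
  have hle : Nat.ble Y (stateOf (removeDiffs D {b, a, e, 0})) = true := by
    rw [Nat.ble_eq]; omega
  have hsub : Nat.sub (stateOf (removeDiffs D {b, a, e, 0})) Y = stateOf (removeDiffs D B) := by
    have : ∀ p q r : ℕ, p = q + r → Nat.sub p r = q := fun p q r h =>
      (show p - r = q by omega)
    exact this _ _ _ hst'
  rw [hle, hsub, hfeas] at hrun
  exact hrun

theorem addFourth_sound (hT : IsTables T M K U) (hF : Decomposes (B ::ₘ F) D)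
    (hn : Multiset.card F = n) (hn2 : n ≤ 2)
    (hB : B = {c, b, a, e, 0}) (hnd : [c, b, a, e, 0].Nodup) {o m : ℕ} (ho : o ≤ cd c)
    (hm : m.testBit (cd c - o) = true)
    (hrun : addFourth T M K U n next h (cd e) (cd a)
      (stateOf (removeDiffs D {a, e, 0})) (ext (maskOf (removeDiffs D {a, e, 0}))) (cd b) o m =
        true) :
    next (stateOf (removeDiffs D B)) (cd e :: cd a :: cd b :: cd c :: h) = true := by
  have hnd' := hnd
  simp only [List.nodup_cons, List.mem_cons, List.not_mem_nil, or_false, not_or] at hnd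
  obtain ⟨⟨hcb, hca, hce, hc0⟩, ⟨hba, hbe, hb0⟩, ⟨hae, ha0⟩, he0, -⟩ := hnd
  have hst := hF.stateOf_removeDiffs hT (z := b) (S := {a, e, 0})
    (by rw [hB]; exact subset_insert _ _) (by simp [*])
  rw [sum_insert (by simp [*]), sum_insert (by simp [*]), sum_singleton, cd_zero,
    Nat.sub_zero] at hst
  have hcB : c ∈ B := by simp [hB]
  have hbB : b ∈ B := by simp [hB]
  have haB : a ∈ B := by simp [hB]
  have heB : e ∈ B := by simp [hB]
  have h0B : (0 : Pt) ∈ B := by simp [hB]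
  have hS3 : ({a, e, 0} : Finset Pt) ⊆ B := by
    rw [hB]; exact (subset_insert _ _).trans (subset_insert _ _)
  have hS4 : ({b, a, e, 0} : Finset Pt) ⊆ B := by rw [hB]; exact subset_insert _ _
  have hC := testBit_shift (hF.sub_mem_removeDiffs hS3 hcB hbB hcb (by simp [*])) ho
  obtain rfl := hT.log
  unfold addFourth at hrun
  rw [force_eq] at hrun
  set C := Nat.land m (Nat.shiftRight (ext (maskOf (removeDiffs D {a, e, 0})))
    (Nat.sub (Nat.add 165 o) (cd b))) with hCdef
  have hCbit : C.testBit (cd c - o) = true := by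
    rw [hCdef, testBit_land, hm, hC]; rfl
  clear_value C
  rw [beq_zero_of_testBit hCbit] at hrun
  simp only [force_eq] at hrun
  have hsub : Nat.sub (Nat.sub (Nat.sub (stateOf (removeDiffs D {a, e, 0}))
      (tab T M (Nat.add 165 (cd b))))
      (tab T M (Nat.sub (Nat.add 165 (cd b)) (cd e))))
      (tab T M (Nat.sub (Nat.add 165 (cd b)) (cd a))) =
      stateOf (removeDiffs D {b, a, e, 0}) := by
    have : ∀ p q r s t : ℕ, p = q + (r + (s + t)) → Nat.sub (Nat.sub (Nat.sub p t) s) r = q :=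
      fun p q r s t h => (show p - t - s - r = q by omega)
    exact this _ _ _ _ _ hst
  rw [hsub, stateOf_shiftRight] at hrun
  have hloop := fun ht => loop_spec (fun _ => True) (fun _ _ => False) {cd c}
    (fun _ _ _ _ _ _ _ h => h) (fun _ _ _ _ h => h) (fun _ _ _ _ _ => not_false)
    (singleton_nonempty _) 82 o _ (fun _ _ => trivial) ht hrun
  obtain ⟨k, hk, o', x', hrun', -⟩ := hloop <| by
    intro t ht
    rw [mem_singleton] at ht
    subst ht
    refine ⟨ho, (cd_lt c).trans (by norm_num), ?_⟩
    have h1 := testBit_shift (hF.sub_mem_removeDiffs hS4 hcB hbB hcb (by simp [*])) ho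
    have h2 := testBit_shift (hF.sub_mem_removeDiffs hS4 hcB haB hca (by simp [*])) ho
    have h3 := testBit_shift (hF.sub_mem_removeDiffs hS4 hcB heB hce (by simp [*])) ho
    have h4 := testBit_shift_zero (x := c) (D := removeDiffs D {b, a, e, 0})
      (by simpa using hF.sub_mem_removeDiffs hS4 hcB h0B hc0 (by simp [*])) ho
    simp only [testBit_land, hCbit, h1, h2, h3, h4, Bool.and_self]
  rw [mem_singleton] at hk
  rw [hk] at hrun'
  exact addLast_sound hT hF hn hn2 hB hnd' _ _ hrun'

theorem addThird_sound (hT : IsTables T M K U) (hF : Decomposes (B ::ₘ F) D)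
    (hn : Multiset.card F = n) (hn2 : n ≤ 2)
    (hB : B = {c, b, a, e, 0}) (hnd : [c, b, a, e, 0].Nodup) {o m : ℕ}
    (hob : o ≤ cd b) (hmb : m.testBit (cd b - o) = true)
    (hoc : o ≤ cd c) (hmc : m.testBit (cd c - o) = true)
    (hrun : addThird T M K U n next h (cd e)
      (stateOf (removeDiffs D {e, 0})) (ext (maskOf (removeDiffs D {e, 0}))) (cd a) o m = true) :
    next (stateOf (removeDiffs D B)) (cd e :: cd a :: cd b :: cd c :: h) = true ∨
    next (stateOf (removeDiffs D B)) (cd e :: cd a :: cd c :: cd b :: h) = true := by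
  have hnd' := hnd
  simp only [List.nodup_cons, List.mem_cons, List.not_mem_nil, or_false, not_or] at hnd
  obtain ⟨⟨hcb, hca, hce, hc0⟩, ⟨hba, hbe, hb0⟩, ⟨hae, ha0⟩, he0, -⟩ := hnd
  have hcB : c ∈ B := by simp [hB]
  have hbB : b ∈ B := by simp [hB]
  have haB : a ∈ B := by simp [hB]
  have heB : e ∈ B := by simp [hB]
  have h0B : (0 : Pt) ∈ B := by simp [hB]
  have hS2 : ({e, 0} : Finset Pt) ⊆ B := by
    intro x hx
    simp only [mem_insert, mem_singleton] at hx
    rcases hx with rfl | rfl <;> assumption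
  have hS3 : ({a, e, 0} : Finset Pt) ⊆ B := insert_subset haB hS2
  have hst := hF.stateOf_removeDiffs hT (z := a) (S := {e, 0}) hS3 (by simp [*])
  rw [sum_insert (by simp [*]), sum_singleton, cd_zero, Nat.sub_zero] at hst
  obtain rfl := hT.log
  unfold addThird at hrun
  rw [force_eq] at hrun
  set C := Nat.land m (Nat.shiftRight (ext (maskOf (removeDiffs D {e, 0})))
    (Nat.sub (Nat.add 165 o) (cd a))) with hCdef
  have hCb : C.testBit (cd b - o) = true := by
    rw [hCdef, testBit_land, hmb,
      testBit_shift (hF.sub_mem_removeDiffs hS2 hbB haB hba (by simp [*])) hob]; rfl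
  have hCc : C.testBit (cd c - o) = true := by
    rw [hCdef, testBit_land, hmc,
      testBit_shift (hF.sub_mem_removeDiffs hS2 hcB haB hca (by simp [*])) hoc]; rfl
  clear_value C
  rw [beq_zero_of_testBit hCb] at hrun
  simp only [force_eq] at hrun
  have hsub : Nat.sub (Nat.sub (stateOf (removeDiffs D {e, 0}))
      (tab T M (Nat.add 165 (cd a))))
      (tab T M (Nat.sub (Nat.add 165 (cd a)) (cd e))) =
      stateOf (removeDiffs D {a, e, 0}) := by
    have : ∀ p q r s : ℕ, p = q + (r + s) → Nat.sub (Nat.sub p s) r = q :=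
      fun p q r s h => (show p - s - r = q by omega)
    exact this _ _ _ _ hst
  rw [hsub, stateOf_shiftRight] at hrun
  have hloop := fun ht => loop_spec (fun _ => True) (fun _ _ => False)
    {cd b, cd c}
    (fun _ _ _ _ _ _ _ h => h) (fun _ _ _ _ h => h) (fun _ _ _ _ _ => not_false)
    (insert_nonempty _ _) 82 o _ (fun _ _ => trivial) ht hrun
  obtain ⟨k, hk, o', x', hrun', hrest⟩ := hloop <| by
    have key : ∀ x ∈ B, x ≠ a → x ≠ e → x ≠ 0 → o ≤ cd x → C.testBit (cd x - o) = true →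
        (C.land (((ext (maskOf (removeDiffs D {a, e, 0}))).shiftRight (Nat.add 165 o)).land
          (((ext (maskOf (removeDiffs D {a, e, 0}))).shiftRight
            (Nat.sub (Nat.add 165 o) (cd e))).land
          ((ext (maskOf (removeDiffs D {a, e, 0}))).shiftRight
            (Nat.sub (Nat.add 165 o) (cd a)))))).testBit (cd x - o) = true := by
      intro x hx hxa hxe hx0 hox hxC
      have h2 := testBit_shift (hF.sub_mem_removeDiffs hS3 hx haB hxa (by simp [*])) hox
      have h3 := testBit_shift (hF.sub_mem_removeDiffs hS3 hx heB hxe (by simp [*])) hox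
      have h4 := testBit_shift_zero (x := x) (D := removeDiffs D {a, e, 0})
        (by simpa using hF.sub_mem_removeDiffs hS3 hx h0B hx0 (by simp [*])) hox
      simp only [testBit_land, hxC, h2, h3, h4, Bool.and_self]
    intro t ht
    rw [mem_insert, mem_singleton] at ht
    rcases ht with rfl | rfl
    · exact ⟨hob, (cd_lt b).trans (by norm_num), key b hbB hba hbe hb0 hob hCb⟩
    · exact ⟨hoc, (cd_lt c).trans (by norm_num), key c hcB hca hce hc0 hoc hCc⟩
  rw [mem_insert, mem_singleton] at hk
  rcases hk with rfl | rfl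
  · obtain ⟨h1, -, h2⟩ := hrest (cd c) (by simp) (by simpa using hcb) not_false
    exact Or.inl (addFourth_sound hT hF hn hn2 hB hnd' h1 h2 hrun')
  · obtain ⟨h1, -, h2⟩ := hrest (cd b) (by simp) (by simpa using Ne.symm hcb) not_false
    refine Or.inr (addFourth_sound hT hF hn hn2 (hB.trans (insert_comm _ _ _)) ?_ h1 h2 hrun')
    exact (List.Perm.swap _ _ _).nodup_iff.1 hnd'

end Steps

/-! ### Completeness of the search -/

/-- The blocks that are described by a list of codes: each block consists of `0` and four more
points. -/
def famOf : List ℕ → Multiset (Finset Pt)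
  | e :: a :: b :: c :: h => {0, pt e, pt a, pt b, pt c} ::ₘ famOf h
  | _ => 0

theorem famOf_cons (e a b c : ℕ) (h : List ℕ) :
    famOf (e :: a :: b :: c :: h) = {0, pt e, pt a, pt b, pt c} ::ₘ famOf h := rfl

theorem Decomposes.replace {B B' : Finset Pt} {F : Multiset (Finset Pt)} {D : Finset Pt}
    (hF : Decomposes (B ::ₘ F) D) (h : SignTranslate B B') : Decomposes (B' ::ₘ F) D where
  card_block C hC := by
    rcases Multiset.mem_cons.1 hC with rfl | hC
    · rw [h.card_eq]; exact hF.card_block B (Multiset.mem_cons_self _ _)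
    · exact hF.card_block C (Multiset.mem_cons_of_mem hC)
  zero_notMem := hF.zero_notMem
  sum_eq d hd := by
    rw [← hF.sum_eq d hd, Multiset.map_cons, Multiset.map_cons, h.diffCount_eq]

/-- Each element of `D` is the difference of a point and zero in a translate of a block. -/
theorem Decomposes.exists_block {F : Multiset (Finset Pt)} {D : Finset Pt}
    (hF : Decomposes F D) {d : Pt} (hd : d ∈ D) : ∃ B B' F', F = B ::ₘ F' ∧ SignTranslate B B' ∧
      d ∈ B' ∧ (0 : Pt) ∈ B' := by
  have hd0 : d ≠ 0 := fun h0 => hF.zero_notMem (h0 ▸ hd)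
  have h := hF.sum_eq d hd0
  rw [if_pos hd] at h
  have hne : ∃ B ∈ F, diffCount B d ≠ 0 := by
    by_contra! hc
    rw [Multiset.map_congr rfl hc, Multiset.map_const', Multiset.sum_replicate] at h
    simp at h
  obtain ⟨B, hB, hBd⟩ := hne
  obtain ⟨F', rfl⟩ := Multiset.exists_cons_of_mem hB
  obtain ⟨⟨x, y⟩, hp⟩ := card_ne_zero.1 hBd
  obtain ⟨h1, h2⟩ := mem_filter.1 hp
  obtain ⟨hx, hy⟩ := mem_product.1 h1
  refine ⟨B, translate (-y) B, F', rfl, ⟨-y, Or.inl rfl⟩, ?_, ?_⟩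
  · rw [mem_translate, ← h2]; simpa using hx
  · rw [mem_translate]; simpa using hy

theorem exists_eq_of_card_eq_five {B : Finset Pt} (hB : #B = 5) {a e : Pt} (ha : a ∈ B)
    (he : e ∈ B) (h0 : (0 : Pt) ∈ B) (hae : a ≠ e) (ha0 : a ≠ 0) (he0 : e ≠ 0) :
    ∃ b c, B = {c, b, a, e, 0} ∧ [c, b, a, e, 0].Nodup := by
  have hsub : ({a, e, 0} : Finset Pt) ⊆ B := by
    intro x hx
    simp only [mem_insert, mem_singleton] at hx
    rcases hx with rfl | rfl | rfl <;> assumption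
  have h3 : #({a, e, 0} : Finset Pt) = 3 := by
    rw [card_insert_of_notMem (by simp [*]), card_insert_of_notMem (by simp [*]), card_singleton]
  have h2 : #(B \ {a, e, 0}) = 2 := by rw [card_sdiff_of_subset hsub, hB, h3]
  obtain ⟨c, b, hcb, heq⟩ := card_eq_two.1 h2
  have hc : c ∈ B \ {a, e, 0} := by rw [heq]; simp
  have hb : b ∈ B \ {a, e, 0} := by rw [heq]; simp
  simp only [mem_sdiff, mem_insert, mem_singleton, not_or] at hc hb
  refine ⟨b, c, ?_, ?_⟩
  · rw [← sdiff_union_of_subset hsub, heq]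
    ext x
    simp only [mem_union, mem_insert, mem_singleton]
    tauto
  · simp only [List.nodup_cons, List.mem_cons, List.not_mem_nil, or_false, not_or]
    tauto

theorem testBit_removeReflection (e a o x i : ℕ) : (removeReflection e a o x).testBit i =
    (x.testBit i && !decide (norm (Nat.sub (Nat.add 165 e) a) = o + i)) := by
  have h : removeReflection e a o x =
      (x ||| ((1 <<< norm (Nat.sub (Nat.add 165 e) a)) >>> o)) ^^^
        ((1 <<< norm (Nat.sub (Nat.add 165 e) a)) >>> o) := by
    unfold removeReflection; rw [force_eq]; rfl
  rw [h]
  simp only [Nat.testBit_xor, Nat.testBit_or, Nat.testBit_shiftRight, Nat.shiftLeft_eq, one_mul,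
    Nat.testBit_two_pow]
  cases x.testBit i <;> cases decide (norm (Nat.sub (Nat.add 165 e) a) = o + i) <;> rfl

theorem norm_sub (x y : Pt) : norm (Nat.sub (Nat.add 165 (cd x)) (cd y)) = cd (x - y) := by
  rw [← pt_sub, cd_pt]; rfl

theorem insert_reverse (e a b c : Pt) : ({0, e, a, b, c} : Finset Pt) = {c, b, a, e, 0} := by
  ext z; simp only [mem_insert, mem_singleton]; tauto

theorem search_succ (T M K U : ℕ) (leaf : List ℕ → Bool) (n Z : ℕ) (h : List ℕ) :
    search T M K U leaf (n + 1) Z h =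
      force (Nat.shiftRight Z 640) fun S => force (pick K S) fun e => Bool.rec false (
      force (Nat.sub Z (tab T M (Nat.add 165 e))) fun Z' =>
      force (ext (Nat.shiftRight Z' 640)) fun E =>
      loop K (addThird T M K U n (search T M K U leaf n) h e Z' E) (removeReflection e) 82 0
        (Nat.land (Nat.shiftRight Z' 640) (Nat.shiftRight E (Nat.sub 165 e))))
      (Nat.beq 1 (Nat.land 1 (Nat.shiftRight S e))) := rfl

/-- A successful search finds each family that decomposes the given set, up to translation and
negation of the blocks. Here `G` consists of the blocks that have been found before. -/
theorem search_sound {T M K U : ℕ} (hT : IsTables T M K U) (leaf : List ℕ → Bool) (n : ℕ)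
    (hn3 : n ≤ 3) :
    ∀ (D : Finset Pt) (h : List ℕ) (F G : Multiset (Finset Pt)), Decomposes F D →
      Multiset.card F = n → Multiset.Rel SignTranslate G (famOf h) →
      search T M K U leaf n (stateOf D) h = true →
      ∃ h', leaf h' = true ∧ Multiset.Rel SignTranslate (F + G) (famOf h') := by
  induction n with
  | zero =>
    intro D h F G hF hcard hG hrun
    have hD : D = ∅ := by
      rw [← card_eq_zero, hF.card_eq, hcard]
    have hF0 : F = 0 := Multiset.card_eq_zero.1 hcard
    rw [hD] at hrun
    refine ⟨h, hrun, ?_⟩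
    rwa [hF0, zero_add]
  | succ n ih =>
    intro D h F G hF hcard hG hrun
    rw [search_succ] at hrun
    simp only [force_eq] at hrun
    rw [stateOf_shiftRight] at hrun
    generalize pick K (maskOf D) = e at hrun
    cases hbit : Nat.beq 1 (Nat.land 1 (Nat.shiftRight (maskOf D) e)) with
    | false => rw [hbit] at hrun; exact absurd hrun (by simp)
    | true =>
    rw [hbit] at hrun
    obtain ⟨ε, hε, rfl⟩ : ∃ d ∈ D, cd d = e := by
      rw [← testBit_maskOf]
      have h1 : 1 = 1 &&& (maskOf D >>> e) := Nat.eq_of_beq_eq_true hbit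
      have h2 := congrArg (fun z => z.testBit 0) h1
      simpa using h2
    have hε0 : ε ≠ 0 := fun h0 => hF.zero_notMem (h0 ▸ hε)
    obtain ⟨B₀, B, F', rfl, hB₀, heB, h0B⟩ := hF.exists_block hε
    have hF1 := hF.replace hB₀
    have hcard' : Multiset.card F' = n := by
      rw [Multiset.card_cons] at hcard; omega
    have hB5 : #B = 5 := hF1.card_block B (Multiset.mem_cons_self _ _)
    have hS2 : ({ε, 0} : Finset Pt) ⊆ B := by
      intro x hx
      simp only [mem_insert, mem_singleton] at hx
      rcases hx with rfl | rfl <;> assumption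
    have hst : Nat.sub (stateOf D) (tab T M (Nat.add 165 (cd ε))) =
        stateOf (removeDiffs D {ε, 0}) := by
      have h1 := hF1.stateOf_removeDiffs hT (z := ε) (S := {0}) hS2 (by simpa using hε0)
      rw [sum_singleton, cd_zero, Nat.sub_zero] at h1
      have h2 : removeDiffs D {0} = D := by simp [removeDiffs]
      rw [h2] at h1
      have : ∀ p q r : ℕ, p = q + r → Nat.sub p r = q :=
        fun p q r h => (show p - r = q by omega)
      exact this _ _ _ h1
    rw [hst, stateOf_shiftRight] at hrun
    -- the targets are the other three points of the block and their reflections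
    set R : Finset Pt := (B.erase 0).erase ε with hR
    set T' : Finset Pt := R ∪ R.image (fun x => ε - x) with hT'
    have hTrefl : ∀ x, ε - x ∈ T' → x ∈ T' := by
      intro x hx
      rw [hT', mem_union, mem_image] at hx ⊢
      rcases hx with hx | ⟨y, hy, hyx⟩
      · exact Or.inr ⟨_, hx, by abel⟩
      · left
        have : y = x := by
          have := congrArg (fun z => ε - z) hyx
          simpa using this
        exact this ▸ hy
    have hRne : R.Nonempty := by
      rw [← card_pos, hR, card_erase_of_mem (mem_erase.2 ⟨hε0, heB⟩), card_erase_of_mem h0B, hB5]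
      norm_num
    have hxR : ∀ x ∈ R, x ≠ ε ∧ x ≠ 0 ∧ x ∈ B := by
      intro x hx
      rw [hR, mem_erase, mem_erase] at hx
      exact hx
    have hmemR : ∀ x ∈ T', x ∈ removeDiffs D {ε, 0} ∧ x - ε ∈ removeDiffs D {ε, 0} := by
      intro x hx
      rw [hT', mem_union, mem_image] at hx
      rcases hx with hx | ⟨y, hy, rfl⟩
      · obtain ⟨h1, h2, h3⟩ := hxR x hx
        refine ⟨?_, hF1.sub_mem_removeDiffs hS2 h3 heB h1 (by simp [*])⟩
        simpa using hF1.sub_mem_removeDiffs hS2 h3 h0B h2 (by simp [*])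
      · obtain ⟨h1, h2, h3⟩ := hxR y hy
        refine ⟨hF1.sub_mem_removeDiffs hS2 heB h3 (Ne.symm h1) (by simp [*]), ?_⟩
        have := hF1.sub_mem_removeDiffs hS2 h0B h3 (Ne.symm h2) (by simp [*])
        simpa using this
    obtain rfl := hT.log
    have hloop := fun ht => loop_spec (fun k => ∃ y : Pt, cd y = k)
      (fun k t => norm (Nat.sub (Nat.add 165 (cd ε)) k) = t) (T'.image cd)
      (fun k o x t ho _ hbad hx => by
        rw [testBit_removeReflection, hx, Bool.true_and, Bool.not_eq_true', decide_eq_false_iff_not]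
        intro h
        exact hbad (by omega))
      (fun k o x t hx => by
        rw [testBit_removeReflection, Bool.and_eq_true] at hx
        exact hx.1)
      (by
        rintro k ⟨y, rfl⟩ hk t ht hbad
        obtain ⟨z, hz, rfl⟩ := mem_image.1 ht
        rw [norm_sub, cd_inj] at hbad
        exact hk (mem_image_of_mem _ (hTrefl y (hbad ▸ hz))))
      ((hRne.mono subset_union_left).image _) 82 0 _
      (fun i hi => by
        rw [testBit_land, Bool.and_eq_true] at hi
        obtain ⟨d, _, hd⟩ := (testBit_maskOf _ _).1 hi.1
        exact ⟨d, by omega⟩) ht hrun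
    obtain ⟨k, hk, o', x', hrun', hrest⟩ := hloop <| by
      intro t ht
      obtain ⟨x, hx, rfl⟩ := mem_image.1 ht
      refine ⟨Nat.zero_le _, (cd_lt x).trans (by norm_num), ?_⟩
      obtain ⟨h1, h2⟩ := hmemR x hx
      have h3 := testBit_shift h2 (Nat.zero_le _)
      rw [testBit_land, Bool.and_eq_true]
      exact ⟨(testBit_maskOf_cd _ _).2 h1, h3⟩
    obtain ⟨A, hA, rfl⟩ := mem_image.1 hk
    -- up to a reflection, the block contains the point that has been chosen
    obtain ⟨B', hBB', hA', he', h0', hsub⟩ : ∃ B', SignTranslate B B' ∧ A ∈ B' ∧ ε ∈ B' ∧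
        (0 : Pt) ∈ B' ∧ ∀ x ∈ B', x ≠ ε → x ≠ 0 → x ∈ T' := by
      rw [hT', mem_union, mem_image] at hA
      rcases hA with hA | ⟨y, hy, rfl⟩
      · refine ⟨B, SignTranslate.refl B, (hxR A hA).2.2, heB, h0B, fun x hx h1 h2 => ?_⟩
        exact mem_union_left _ (mem_erase.2 ⟨h1, mem_erase.2 ⟨h2, hx⟩⟩)
      · have hm : ∀ x, x ∈ B.image (fun x => ε - x) ↔ ε - x ∈ B := by
          intro x
          rw [mem_image]
          constructor
          · rintro ⟨b, hb, rfl⟩; simpa using hb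
          · intro hx; exact ⟨_, hx, by abel⟩
        refine ⟨B.image (fun x => ε - x), signTranslate_iff.2 ⟨ε, Or.inr hm⟩,
          mem_image_of_mem _ (hxR y hy).2.2, (hm _).2 (by simpa using h0B),
          (hm _).2 (by simpa using heB), fun x hx h1 h2 => ?_⟩
        obtain ⟨b, hb, rfl⟩ := mem_image.1 hx
        refine mem_union_right _ (mem_image_of_mem _ (mem_erase.2 ⟨?_, mem_erase.2 ⟨?_, hb⟩⟩))
        · rintro rfl; exact h2 (sub_self _)
        · rintro rfl; exact h1 (sub_zero _)
    have hF2 := hF1.replace hBB'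
    have hA0 : A ≠ 0 := by
      rintro rfl
      exact hF2.zero_notMem (mem_sdiff.1 (hmemR _ hA).1).1
    have hAe : A ≠ ε := by
      rintro rfl
      refine hF2.zero_notMem (mem_sdiff.1 (?_ : (0 : Pt) ∈ removeDiffs D {A, 0})).1
      simpa using (hmemR _ hA).2
    obtain ⟨b, c, hB', hnd⟩ := exists_eq_of_card_eq_five
      (hF2.card_block B' (Multiset.mem_cons_self _ _)) hA' he' h0' hAe hA0 hε0
    have hnd' := hnd
    simp only [List.nodup_cons, List.mem_cons, List.not_mem_nil, or_false, not_or] at hnd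
    obtain ⟨⟨hcb, hca, hce, hc0⟩, ⟨hba, hbe, hb0⟩, ⟨hae, ha0⟩, he0, -⟩ := hnd
    have hleft : ∀ x ∈ B', x ≠ A → x ≠ ε → x ≠ 0 →
        o' ≤ cd x ∧ x'.testBit (cd x - o') = true := by
      intro x hx h1 h2 h3
      obtain ⟨h4, -, h5⟩ := hrest (cd x) (mem_image_of_mem _ (hsub x hx h2 h3)) (by simpa using h1)
        (by
          rw [norm_sub, cd_inj]
          intro h4
          have := hF2.sub_injOn he' hA' hx h0' (Ne.symm hAe) (by rw [h4, sub_zero])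
          exact hA0 this.2)
      exact ⟨h4, h5⟩
    have hb := hleft b (by simp [hB']) hba hbe hb0
    have hc := hleft c (by simp [hB']) hca hce hc0
    have hrel : ∀ x y : Pt, B' = {y, x, A, ε, 0} → Multiset.Rel SignTranslate (B₀ ::ₘ G)
        (famOf (cd ε :: cd A :: cd x :: cd y :: h)) := by
      intro x y hxy
      rw [famOf_cons, pt_cd, pt_cd, pt_cd, pt_cd]
      refine Multiset.Rel.cons ?_ hG
      rw [insert_reverse, ← hxy]
      exact hB₀.trans hBB'
    have hG' : (B₀ ::ₘ F') + G = F' + (B₀ ::ₘ G) := by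
      rw [Multiset.cons_add, Multiset.add_cons]
    rw [hG']
    rcases addThird_sound hT hF2 hcard'
      (by omega) hB' hnd' hb.1 hb.2 hc.1 hc.2 hrun' with hrun2 | hrun2
    · exact ih (by omega) _ _ F' (B₀ ::ₘ G) hF2.tail hcard' (hrel b c hB') hrun2
    · exact ih (by omega) _ _ F' (B₀ ::ₘ G) hF2.tail hcard'
        (hrel c b (hB'.trans (insert_comm _ _ _))) hrun2

/-! ### Codes of linear maps -/

/-- The map that takes `(1, 0)` to `v` and `(0, 1)` to `w`. -/
def linMap (v w x : Pt) : Pt := x.1.val • v + x.2.val • w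

/-- The code of the image under `linMap (pt v) (pt w)` of the point with code `r`. -/
def imgCode (v w r : ℕ) : ℕ :=
  Nat.add (Nat.mul 6 (Nat.mod (Nat.add (Nat.mul (Nat.div v 6) (Nat.mod r 6))
    (Nat.mul (Nat.div w 6) (Nat.div r 6))) 27))
    (Nat.mod (Nat.add (Nat.mul (Nat.mod v 6) (Nat.mod r 6))
      (Nat.mul (Nat.mod w 6) (Nat.div r 6))) 3)

/-- A condition for `linMap (pt v) (pt w)` to be an automorphism: `pt v` has the form `(s, 9 * j)`
with `s ≠ 0`, and the second component of `pt w` is not a multiple of three. -/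
def autCode (v w : ℕ) : Bool :=
  Bool.rec false (Bool.rec (Bool.rec true false (Nat.beq (Nat.mod (Nat.div w 6) 3) 0)) false
    (Nat.beq (Nat.mod v 3) 0)) (Nat.beq (Nat.mod (Nat.div v 6) 9) 0)

/-! ### The first block -/

/-- The code of `x` or of `(0, 9) - x`, where `r` is the code of `x`. -/
def reflCode (ρ : Bool) (r : ℕ) : ℕ := Bool.rec r (norm (Nat.sub 219 r)) ρ

/-- The bit set of the image of the block `{0, 54, 6, b, c}` under a reflection, if `ρ` is true, and
then a linear map. -/
def moveMask (ρ : Bool) (v w b c : ℕ) : ℕ :=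
  Nat.add (Nat.pow 2 (imgCode v w (reflCode ρ 0)))
    (Nat.add (Nat.pow 2 (imgCode v w (reflCode ρ 54)))
      (Nat.add (Nat.pow 2 (imgCode v w (reflCode ρ 6)))
        (Nat.add (Nat.pow 2 (imgCode v w (reflCode ρ b)))
          (Nat.pow 2 (imgCode v w (reflCode ρ c))))))

/-- The bit set of the points with codes `0`, `54` and `6`. -/
def baseMask : ℕ := 18014398509482049

/-- Whether the linear map is an automorphism that takes the block `{0, 54, 6, b, c}`, reflected if
`ρ` is true, to a block that contains `{0, 54, 6}` as well and has a smaller bit set. -/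
noncomputable def reduces (ρ : Bool) (b c v w : ℕ) : Bool :=
  Bool.rec false (force (moveMask ρ v w b c) fun m =>
    Bool.rec false (Nat.ble (Nat.succ m)
      (Nat.add baseMask (Nat.add (Nat.pow 2 b) (Nat.pow 2 c))))
      (Nat.beq (Nat.land m baseMask) baseMask)) (autCode v w)

/-- Looks for a reduction that takes the point with code `p` to `(0, 1)`. It is required that the
(reflected) point has the form `(u, t)` with `t` congruent to `1` modulo `3`, so that the
automorphism fixes `(0, 9)`. The image `pt v` of `(1, 0)` runs through the six elements
`(s, 9 * j)` with `s ≠ 0`, and then the image of `(0, 1)` is `(0, 1) - u • pt v` divided by `t`,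
where `t ^ 17` is the inverse of `t` modulo `27`. -/
noncomputable def reducesAt (b c : ℕ) (ρ : Bool) (p : ℕ) : Bool :=
  force (reflCode ρ p) fun q => Bool.rec false (
    force (Nat.mod (Nat.pow (Nat.div q 6) 17) 27) fun t =>
    List.any [1, 2, 55, 56, 109, 110] fun v => reduces ρ b c v
      (Nat.add (Nat.mul 6 (Nat.mod (Nat.mul t (Nat.add 1 (Nat.mul (Nat.mod q 6)
          (Nat.sub 27 (Nat.div v 6))))) 27))
        (Nat.mod (Nat.mul t (Nat.mul (Nat.mod q 6) (Nat.sub 3 (Nat.mod v 6)))) 3)))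
    (Nat.beq (Nat.mod (Nat.div q 6) 3) 1)

/-- Whether a list of codes has no duplicates and is disjoint from the bit set `m`. -/
noncomputable def distinct : List ℕ → ℕ → Bool :=
  List.rec (fun _ => true) fun r _ ih m =>
    Bool.rec (force (Nat.lor m (Nat.shiftLeft 1 r)) ih) false
      (Nat.beq (Nat.land (Nat.shiftRight m r) 1) 1)

/-- The codes of the differences of the elements of a list at two different positions. -/
def diffCodes : List ℕ → List ℕ :=
  List.rec [] fun r l ih => List.append (List.flatMap (fun s =>
    [norm (Nat.sub (Nat.add 165 r) s), norm (Nat.sub (Nat.add 165 s) r)]) l) ih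

/-- The pairs `(b, c)` for which families with the block `{0, 54, 6, b, c}` are searched for, in
groups. -/
def representatives : List (List (ℕ × ℕ)) := [
    [(1, 13), (1, 18), (1, 19), (1, 24), (1, 25), (1, 31), (1, 36)],
    [(1, 37), (1, 61), (1, 66), (1, 67), (1, 72), (1, 73), (1, 78)],
    [(1, 79), (1, 90), (1, 91), (1, 96), (1, 103), (1, 126), (1, 144)],
    [(2, 19), (2, 25), (2, 31), (2, 37), (2, 49), (7, 18), (7, 19)],
    [(7, 24), (7, 36), (7, 37), (7, 49), (7, 67), (7, 72), (7, 78)],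
    [(7, 90), (7, 96), (7, 103), (7, 126), (7, 144), (8, 25), (8, 61)],
    [(13, 14), (13, 18), (13, 24), (13, 25), (13, 31), (13, 36), (13, 37)],
    [(13, 42), (13, 43), (13, 66), (13, 72), (13, 73), (14, 31), (14, 37)],
    [(14, 61), (14, 67), (18, 19), (18, 25), (18, 31), (18, 37), (18, 43)],
    [(18, 49), (18, 78), (18, 96), (19, 20), (19, 24), (19, 31), (19, 36)],
    [(19, 37), (19, 43), (19, 49), (19, 55), (19, 61), (19, 66), (19, 72)],
    [(19, 78), (19, 90), (19, 91), (19, 96), (19, 126), (19, 144), (20, 25)],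
    [(20, 49), (20, 55), (20, 61), (20, 67), (20, 73), (24, 25), (24, 31)],
    [(24, 37), (24, 66), (24, 90), (25, 26), (25, 36), (25, 37), (25, 42)],
    [(25, 43), (25, 55), (25, 61), (25, 66), (25, 90), (25, 91), (26, 55)],
    [(26, 61), (31, 36), (31, 43), (31, 61), (31, 66), (31, 67), (31, 126)],
    [(32, 37), (36, 37), (36, 43), (36, 78), (36, 96), (37, 38), (37, 55)],
    [(37, 61), (37, 66), (37, 67), (37, 72), (37, 73), (37, 78), (37, 90)],
    [(37, 96), (37, 126), (37, 144), (38, 43), (38, 55), (38, 61), (38, 79)],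
    [(38, 91), (42, 72), (43, 61), (43, 66), (43, 67), (43, 72), (43, 73)],
    [(43, 78), (44, 61), (44, 73), (49, 61), (49, 66), (49, 67), (49, 72)],
    [(49, 73), (49, 78), (49, 79), (49, 85), (49, 90), (49, 91), (49, 96)],
    [(50, 67), (50, 73), (56, 67), (56, 73), (56, 79), (56, 91), (61, 62)],
    [(62, 79), (66, 90), (73, 74), (74, 85), (79, 80), (91, 92), (126, 138)]]

/-- Whether the block `{0, 54, 6, b, c}` has two equal differences, can be moved to a block with a
smaller bit set, or is one of the representatives. -/
noncomputable def firstBlockCheck (b c : ℕ) : Bool :=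
  Bool.rec true (Bool.rec (Bool.rec
    (representatives.any fun l => l.any fun p =>
      Bool.rec false (Nat.beq p.2 c) (Nat.beq p.1 b)) true
    (List.any [6, b, c] (reducesAt b c true))) true
    (List.any [6, b, c] (reducesAt b c false)))
    (distinct (diffCodes [0, 54, 6, b, c]) 0)

theorem firstBlockCheck_all : (allUpTo (fun i => force (codeAt i) fun b =>
    allUpTo (fun j => force (codeAt j) fun c => firstBlockCheck c b) i) 81) = true := by
  decide +kernel

/-! ### The automorphisms as linear maps -/

theorem mod_nsmul {M : Type*} [AddMonoid M] (v : M) (m n : ℕ) (h : m • v = 0) :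
    (n % m) • v = n • v := by
  conv_rhs => rw [← Nat.div_add_mod n m, add_nsmul, mul_nsmul, h]
  rw [nsmul_zero, zero_add]

theorem linMap_add {v : Pt} (hv : 3 • v = 0) (w x y : Pt) :
    linMap v w (x + y) = linMap v w x + linMap v w y := by
  have hw : 27 • w = 0 := by revert w; decide +kernel
  unfold linMap
  rw [Prod.fst_add, Prod.snd_add, ZMod.val_add, ZMod.val_add, mod_nsmul v 3 _ hv,
    mod_nsmul w 27 _ hw, add_nsmul, add_nsmul]
  abel

theorem linMap_eq_zero {v w x : Pt} (hv : 3 • v = 0) (hv1 : v.1 ≠ 0) (hw : w.2.val % 3 ≠ 0)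
    (h : linMap v w x = 0) : x = 0 := by
  obtain ⟨a, b⟩ := x
  obtain ⟨v1, v2⟩ := v
  obtain ⟨w1, w2⟩ := w
  simp only [linMap, Prod.smul_mk, Prod.mk_add_mk, Prod.mk_eq_zero] at h hv hv1 hw ⊢
  have hb9 : b.val % 9 = 0 := by
    have h1 : ∀ w b : ZMod 27, w.val % 3 ≠ 0 → 3 • (b.val • w) = 0 → b.val % 9 = 0 := by
      decide +kernel
    refine h1 w2 b hw ?_
    have h2 := congrArg (fun z => 3 • z) h.2
    simp only [nsmul_add, nsmul_zero] at h2
    rwa [← mul_nsmul, mul_comm, mul_nsmul, hv.2, nsmul_zero, zero_add] at h2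
  have ha : a = 0 := by
    have h1 : ∀ (w v a : ZMod 3) (b : ZMod 27), b.val % 9 = 0 → v ≠ 0 →
      a.val • v + b.val • w = 0 → a = 0 := by decide +kernel
    exact h1 w1 v1 a b hb9 hv1 h.1
  refine ⟨ha, ?_⟩
  have h1 : ∀ w b : ZMod 27, w.val % 3 ≠ 0 → b.val • w = 0 → b = 0 := by decide +kernel
  refine h1 w2 b hw ?_
  rw [ha] at h
  simpa using h.2

/-- The automorphism that takes `(1, 0)` to `v` and `(0, 1)` to `w`. -/
noncomputable def linAut (v w : Pt) (hv : 3 • v = 0) (hv1 : v.1 ≠ 0) (hw : w.2.val % 3 ≠ 0) :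
    Pt ≃+ Pt :=
  AddEquiv.ofBijective (AddMonoidHom.mk' (linMap v w) (linMap_add hv w)) <|
    Finite.injective_iff_bijective.1 <| (injective_iff_map_eq_zero _).2 fun _ h =>
      linMap_eq_zero hv hv1 hw h

@[simp] theorem linAut_apply (v w : Pt) (hv : 3 • v = 0) (hv1 : v.1 ≠ 0) (hw : w.2.val % 3 ≠ 0)
    (x : Pt) : linAut v w hv hv1 hw x = linMap v w x := rfl

theorem cd_linMap (v w : ℕ) (x : Pt) : cd (linMap (pt v) (pt w) x) = imgCode v w (cd x) := by
  have h1 : x.1.val < 3 := ZMod.val_lt _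
  have a1 : cd x % 6 = x.1.val := by unfold cd; omega
  have a2 : cd x / 6 = x.2.val := by unfold cd; omega
  have e : imgCode v w (cd x) = 6 * ((v / 6 * (cd x % 6) + w / 6 * (cd x / 6)) % 27) +
    (v % 6 * (cd x % 6) + w % 6 * (cd x / 6)) % 3 := rfl
  have b1 : (linMap (pt v) (pt w) x).1 = ((v % 6 * x.1.val + w % 6 * x.2.val : ℕ) : ZMod 3) := by
    simp only [linMap, pt, Prod.fst_add, Prod.smul_fst]
    simp only [nsmul_eq_mul]
    push_cast; ring
  have b2 : (linMap (pt v) (pt w) x).2 = ((v / 6 * x.1.val + w / 6 * x.2.val : ℕ) : ZMod 27) := by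
    simp only [linMap, pt, Prod.snd_add, Prod.smul_snd]
    simp only [nsmul_eq_mul]
    push_cast; ring
  rw [e, a1, a2, cd, b1, b2, ZMod.val_natCast, ZMod.val_natCast]

theorem exists_aut_of_autCode {v w : ℕ} (h : autCode v w = true) :
    ∃ α : Pt ≃+ Pt, ∀ x, cd (α x) = imgCode v w (cd x) := by
  unfold autCode at h
  have hb : ∀ {m n : ℕ}, Nat.beq m n = false → m ≠ n := fun h h' => by
    rw [h', Nat.beq_refl] at h; exact absurd h (by simp)
  cases h1 : Nat.beq (Nat.mod (Nat.div v 6) 9) 0 with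
  | false => rw [h1] at h; exact absurd h (by simp)
  | true =>
  cases h2 : Nat.beq (Nat.mod v 3) 0 with
  | true => rw [h1, h2] at h; exact absurd h (by simp)
  | false =>
  cases h3 : Nat.beq (Nat.mod (Nat.div w 6) 3) 0 with
  | true => rw [h1, h2, h3] at h; exact absurd h (by simp)
  | false =>
  have g1 : v / 6 % 9 = 0 := Nat.eq_of_beq_eq_true h1
  have g2 : v % 3 ≠ 0 := hb h2
  have g3 : w / 6 % 3 ≠ 0 := hb h3
  have hv : 3 • pt v = 0 := by
    have hx : (3 : ZMod 3) = 0 := rfl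
    unfold pt
    rw [Prod.smul_mk, Prod.mk_eq_zero]
    refine ⟨by rw [nsmul_eq_mul, Nat.cast_ofNat, hx, zero_mul], ?_⟩
    rw [nsmul_eq_mul, ← Nat.cast_mul, ZMod.natCast_eq_zero_iff]
    omega
  have hv1 : (pt v).1 ≠ 0 := by
    intro h0
    have : (pt v).1.val = v % 6 % 3 := ZMod.val_natCast 3 _
    rw [h0, ZMod.val_zero] at this
    omega
  have hw : (pt w).2.val % 3 ≠ 0 := by
    have : (pt w).2.val = w / 6 % 27 := ZMod.val_natCast 27 _
    omega
  exact ⟨linAut _ _ hv hv1 hw, fun x => cd_linMap v w x⟩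

/-! ### Families up to automorphisms, translation and negation -/

/-- The family arises from a family found by the search by an automorphism, up to translation and
negation of the blocks. -/
def Classified (F : Multiset (Finset Pt)) : Prop :=
  ∃ h ∈ solutions, ∃ α : Pt ≃+ Pt, Multiset.Rel SignTranslate (mapAut α F) (famOf h)

instance : IsTrans (Finset Pt) SignTranslate := ⟨fun _ _ _ => SignTranslate.trans⟩

theorem mapAut_mapAut (α β : Pt ≃+ Pt) (F : Multiset (Finset Pt)) :
    mapAut β (mapAut α F) = mapAut (α.trans β) F := by
  unfold mapAut
  rw [Multiset.map_map]
  refine Multiset.map_congr rfl fun B _ => ?_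
  rw [Function.comp_apply, image_image]
  rfl

theorem mapAut_refl (F : Multiset (Finset Pt)) : mapAut (AddEquiv.refl Pt) F = F := by
  unfold mapAut
  conv_rhs => rw [← Multiset.map_id F]
  refine Multiset.map_congr rfl fun B _ => ?_
  exact image_id

theorem rel_mapAut (α : Pt ≃+ Pt) {F G : Multiset (Finset Pt)}
    (h : Multiset.Rel SignTranslate F G) :
    Multiset.Rel SignTranslate (mapAut α F) (mapAut α G) := by
  unfold mapAut
  rw [Multiset.rel_map]
  exact h.mono fun _ _ _ _ h => h.image α

theorem Classified.of_rel {F G : Multiset (Finset Pt)} (h : Multiset.Rel SignTranslate F G)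
    (hG : Classified G) : Classified F := by
  obtain ⟨s, hs, α, hα⟩ := hG
  exact ⟨s, hs, α, Multiset.Rel.trans _ (rel_mapAut α h) hα⟩

theorem Classified.of_mapAut {F : Multiset (Finset Pt)} {α : Pt ≃+ Pt}
    (h : Classified (mapAut α F)) : Classified F := by
  obtain ⟨s, hs, β, hβ⟩ := h
  exact ⟨s, hs, α.trans β, by rwa [← mapAut_mapAut]⟩

theorem rel_refl (F : Multiset (Finset Pt)) : Multiset.Rel SignTranslate F F :=
  Multiset.rel_refl_of_refl_on fun B _ => SignTranslate.refl B

theorem mem_image_addEquiv (α : Pt ≃+ Pt) (A : Finset Pt) (x : Pt) :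
    x ∈ A.image α ↔ α.symm x ∈ A := by
  rw [mem_image]
  constructor
  · rintro ⟨b, hb, rfl⟩; simpa using hb
  · intro h; exact ⟨_, h, by simp⟩

theorem diffCount_image (α : Pt ≃+ Pt) (B : Finset Pt) (d : Pt) :
    diffCount (B.image α) d = diffCount B (α.symm d) := by
  refine diffCount_eq_of_equiv α.symm.toEquiv (fun x => mem_image_addEquiv α B x) fun x y => ?_
  have : α.symm.toEquiv x - α.symm.toEquiv y = α.symm (x - y) := (map_sub α.symm x y).symm
  rw [this, EmbeddingLike.apply_eq_iff_eq]

theorem Decomposes.mapAut {F : Multiset (Finset Pt)} (hF : Decomposes F (univ.erase 0))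
    (α : Pt ≃+ Pt) : Decomposes (mapAut α F) (univ.erase 0) where
  card_block C hC := by
    obtain ⟨B, hB, rfl⟩ := Multiset.mem_map.1 hC
    rw [card_image_of_injective _ α.injective]; exact hF.card_block B hB
  zero_notMem := hF.zero_notMem
  sum_eq d hd := by
    have hd' : α.symm d ≠ 0 := by simpa using hd
    have h := hF.sum_eq _ hd'
    unfold DiffFamily.mapAut
    rw [Multiset.map_map]
    simp only [Function.comp_apply, diffCount_image]
    rw [h]
    simp [hd, hd']

theorem isDifferenceFamily_iff {F : Multiset (Finset Pt)} :
    IsDifferenceFamily 5 1 F ↔ Decomposes F (univ.erase 0) := by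
  have hst : ∀ B : Finset Pt, #B = 5 → stabCard B = 1 := by
    intro B hB
    unfold stabCard
    rw [card_eq_one]
    refine ⟨0, ?_⟩
    ext g
    simp only [mem_filter, mem_univ, true_and, mem_singleton]
    constructor
    · intro h
      have h1 : ∑ x ∈ translate g B, x = ∑ x ∈ B, (g + x) :=
        sum_image (add_right_injective g).injOn
      rw [h, sum_add_distrib, sum_const, hB] at h1
      have h2 : 5 • g = 0 := by simpa using h1
      have h3 : ∀ g : Pt, 5 • g = 0 → g = 0 := by decide +kernel
      exact h3 g h2
    · rintro rfl
      simp [translate]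
  have hp : (∀ B ∈ F, #B = 5) → ∀ d, (F.map fun B => partialDiffCount B d) =
      F.map fun B => diffCount B d := by
    intro h d
    refine Multiset.map_congr rfl fun B hB => ?_
    rw [partialDiffCount, hst B (h B hB), Nat.div_one]
  constructor
  · rintro ⟨h1, h2⟩
    refine ⟨h1, by simp, fun d hd => ?_⟩
    rw [← hp h1, h2 d hd, if_pos (by simp [hd])]
  · intro h
    refine ⟨h.card_block, fun d hd => ?_⟩
    rw [hp h.card_block, h.sum_eq d hd, if_pos (by simp [hd])]

/-! ### Reduction to finitely many first blocks -/

theorem cd_pt54 : cd (pt 54) = 54 := by decide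
theorem cd_pt6 : cd (pt 6) = 6 := by decide

theorem start_sound {T M K U : ℕ} (hT : IsTables T M K U) (leaf : List ℕ → Bool)
    {B : Finset Pt} {F : Multiset (Finset Pt)} (hF : Decomposes (B ::ₘ F) (univ.erase 0))
    {b c : Pt} (hB : B = {c, b, pt 6, pt 54, 0}) (hnd : [c, b, pt 6, pt 54, 0].Nodup)
    (hrun : start T M K U fullState leaf (cd b) (cd c) = true) :
    ∃ h', leaf h' = true ∧ Multiset.Rel SignTranslate (B ::ₘ F) (famOf h') := by
  have hcard : Multiset.card F = 3 := by
    have h1 := hF.card_eq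
    have h2 : #(univ.erase (0 : Pt)) = 80 := by
      rw [card_erase_of_mem (mem_univ _), card_univ]; rfl
    rw [h2, Multiset.card_cons] at h1
    omega
  simp only [List.nodup_cons, List.mem_cons, List.not_mem_nil, or_false, not_or] at hnd
  obtain ⟨⟨hcb, hca, hce, hc0⟩, ⟨hba, hbe, hb0⟩, ⟨hae, ha0⟩, he0, -⟩ := hnd
  have hS4 : ({b, pt 6, pt 54, 0} : Finset Pt) ⊆ B := by rw [hB]; exact subset_insert _ _
  have hS3 : ({pt 6, pt 54, 0} : Finset Pt) ⊆ B := (subset_insert _ _).trans hS4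
  have hS2 : ({pt 54, 0} : Finset Pt) ⊆ B := (subset_insert _ _).trans hS3
  have h1 := hF.stateOf_removeDiffs hT (z := pt 54) (S := {0}) hS2 (by simp [*])
  have h2 := hF.stateOf_removeDiffs hT (z := pt 6) (S := {pt 54, 0}) hS3 (by simp [*])
  have h3 := hF.stateOf_removeDiffs hT (z := b) (S := {pt 6, pt 54, 0}) hS4 (by simp [*])
  have h4 := hF.stateOf_removeDiffs hT (z := c) (S := {b, pt 6, pt 54, 0}) (by rw [hB])
    (by simp [*])
  have h0 : removeDiffs (univ.erase 0) {0} = univ.erase 0 := by simp [removeDiffs]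
  rw [h0] at h1
  rw [sum_singleton, cd_zero, Nat.sub_zero, cd_pt54] at h1
  rw [sum_insert (by simp [*]), sum_singleton, cd_zero, Nat.sub_zero, cd_pt54, cd_pt6] at h2
  rw [sum_insert (by simp [*]), sum_insert (by simp [*]), sum_singleton, cd_zero, Nat.sub_zero,
    cd_pt54, cd_pt6] at h3
  rw [sum_insert (by simp [*]), sum_insert (by simp [*]), sum_insert (by simp [*]), sum_singleton,
    cd_zero, Nat.sub_zero, cd_pt54, cd_pt6, ← hB] at h4
  have hfeas : feasible U 3 (stateOf (removeDiffs (univ.erase 0) B)) = true := by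
    have ht := hF.tail
    have hc := ht.card_eq
    rw [hT.unit]
    refine feasible_of_le le_rfl (fun k => ?_) (by omega)
    have := ht.le_corrSum k
    rwa [hcard] at this
  unfold start at hrun
  rw [force_eq, fullState_eq] at hrun
  have hsub : ∀ z t1 t2 t3 t4 t5 t6 t7 t8 t9 t10 z' z1 z2 z3 : ℕ, z = z1 + t1 →
      z1 = z2 + (t3 + t2) → z2 = z3 + (t6 + (t5 + t4)) → z3 = z' + (t10 + (t9 + (t8 + t7))) →
      Nat.sub (Nat.sub (Nat.sub (Nat.sub (Nat.sub (Nat.sub (Nat.sub (Nat.sub (Nat.sub (Nat.sub z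
        t1) t2) t3) t4) t5) t6) t7) t8) t9) t10 = z' := by
    intro z t1 t2 t3 t4 t5 t6 t7 t8 t9 t10 z' z1 z2 z3 g1 g2 g3 g4
    show z - t1 - t2 - t3 - t4 - t5 - t6 - t7 - t8 - t9 - t10 = z'
    omega
  have hsearch : ∀ Z, Z = stateOf (removeDiffs (univ.erase 0) B) →
      Bool.rec true (search T M K U leaf 3 Z [54, 6, cd b, cd c]) (feasible U 3 Z) = true →
      search T M K U leaf 3 (stateOf (removeDiffs (univ.erase 0) B)) [54, 6, cd b, cd c] =
        true := by
    rintro Z rfl h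
    rwa [hfeas] at h
  obtain ⟨h', hl, hrel⟩ := search_sound hT leaf 3 le_rfl _ _ F {B} hF.tail hcard (by
    rw [famOf_cons, insert_reverse, pt_cd, pt_cd, ← hB]
    exact rel_refl _)
    (hsearch _ (hsub _ _ _ _ _ _ _ _ _ _ _ _ _ _ _ h1 h2 h3 h4) hrun)
  refine ⟨h', hl, ?_⟩
  rwa [add_comm, Multiset.singleton_add] at hrel

/-! ### The runs of the search -/

/-- This and the following evaluations treat the lists in `representatives` one by one. -/
theorem run_1_13 : run [(1, 13), (1, 18), (1, 19), (1, 24), (1, 25), (1, 31), (1, 36)] = true := by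
  decide +kernel

theorem run_1_37 : run [(1, 37), (1, 61), (1, 66), (1, 67), (1, 72), (1, 73), (1, 78)] = true := by
  decide +kernel

theorem run_1_79 : run [(1, 79), (1, 90), (1, 91), (1, 96), (1, 103), (1, 126), (1, 144)] =
    true := by
  decide +kernel

theorem run_2_19 : run [(2, 19), (2, 25), (2, 31), (2, 37), (2, 49), (7, 18), (7, 19)] = true := by
  decide +kernel

theorem run_7_24 : run [(7, 24), (7, 36), (7, 37), (7, 49), (7, 67), (7, 72), (7, 78)] = true := by
  decide +kernel

theorem run_7_90 : run [(7, 90), (7, 96), (7, 103), (7, 126), (7, 144), (8, 25), (8, 61)] =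
    true := by
  decide +kernel

theorem run_13_14 : run [(13, 14), (13, 18), (13, 24), (13, 25), (13, 31), (13, 36), (13, 37)] =
    true := by
  decide +kernel

theorem run_13_42 : run [(13, 42), (13, 43), (13, 66), (13, 72), (13, 73), (14, 31), (14, 37)] =
    true := by
  decide +kernel

theorem run_14_61 : run [(14, 61), (14, 67), (18, 19), (18, 25), (18, 31), (18, 37), (18, 43)] =
    true := by
  decide +kernel

theorem run_18_49 : run [(18, 49), (18, 78), (18, 96), (19, 20), (19, 24), (19, 31), (19, 36)] =
    true := by
  decide +kernel

theorem run_19_37 : run [(19, 37), (19, 43), (19, 49), (19, 55), (19, 61), (19, 66), (19, 72)] =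
    true := by
  decide +kernel

theorem run_19_78 : run [(19, 78), (19, 90), (19, 91), (19, 96), (19, 126), (19, 144), (20, 25)] =
    true := by
  decide +kernel

theorem run_20_49 : run [(20, 49), (20, 55), (20, 61), (20, 67), (20, 73), (24, 25), (24, 31)] =
    true := by
  decide +kernel

theorem run_24_37 : run [(24, 37), (24, 66), (24, 90), (25, 26), (25, 36), (25, 37), (25, 42)] =
    true := by
  decide +kernel

theorem run_25_43 : run [(25, 43), (25, 55), (25, 61), (25, 66), (25, 90), (25, 91), (26, 55)] =
    true := by
  decide +kernel

theorem run_26_61 : run [(26, 61), (31, 36), (31, 43), (31, 61), (31, 66), (31, 67), (31, 126)] =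
    true := by
  decide +kernel

theorem run_32_37 : run [(32, 37), (36, 37), (36, 43), (36, 78), (36, 96), (37, 38), (37, 55)] =
    true := by
  decide +kernel

theorem run_37_61 : run [(37, 61), (37, 66), (37, 67), (37, 72), (37, 73), (37, 78), (37, 90)] =
    true := by
  decide +kernel

theorem run_37_96 : run [(37, 96), (37, 126), (37, 144), (38, 43), (38, 55), (38, 61), (38, 79)] =
    true := by
  decide +kernel

theorem run_38_91 : run [(38, 91), (42, 72), (43, 61), (43, 66), (43, 67), (43, 72), (43, 73)] =
    true := by
  decide +kernel

theorem run_43_78 : run [(43, 78), (44, 61), (44, 73), (49, 61), (49, 66), (49, 67), (49, 72)] =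
    true := by
  decide +kernel

theorem run_49_73 : run [(49, 73), (49, 78), (49, 79), (49, 85), (49, 90), (49, 91), (49, 96)] =
    true := by
  decide +kernel

theorem run_50_67 : run [(50, 67), (50, 73), (56, 67), (56, 73), (56, 79), (56, 91), (61, 62)] =
    true := by
  decide +kernel

theorem run_62_79 : run [(62, 79), (66, 90), (73, 74), (74, 85), (79, 80), (91, 92), (126, 138)] =
    true := by
  decide +kernel

theorem run_representatives : ∀ l ∈ representatives, run l = true := by
  unfold representatives
  simp only [List.forall_mem_cons, List.not_mem_nil, false_implies, implies_true, and_true]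
  exact ⟨run_1_13, run_1_37, run_1_79, run_2_19, run_7_24, run_7_90, run_13_14, run_13_42,
    run_14_61, run_18_49, run_19_37, run_19_78, run_20_49, run_24_37, run_25_43, run_26_61,
    run_32_37, run_37_61, run_37_96, run_38_91, run_43_78, run_49_73, run_50_67, run_62_79⟩

/-! ### Every difference family is found -/

theorem forall_of_rec {α : Type*} {p : α → Bool} {l : List α}
    (h : List.rec true (fun a _ ih => Bool.rec false ih (p a)) l = true) : ∀ a ∈ l, p a = true := by
  induction l with
  | nil => simp
  | cons a l ih =>
    have e : List.rec (motive := fun _ => Bool) true (fun a _ ih => Bool.rec false ih (p a))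
      (a :: l) =
      Bool.rec false (List.rec true (fun a _ ih => Bool.rec false ih (p a)) l) (p a) := rfl
    rw [e] at h
    cases hp : p a with
    | false => rw [hp] at h; exact absurd h (by simp)
    | true =>
      rw [hp] at h
      exact List.forall_mem_cons.2 ⟨hp, ih h⟩

theorem run_spec {l : List (ℕ × ℕ)} (h : run l = true) : ∀ p ∈ l, start pairTable (Nat.pow 2 802)
    logTable unitFields fullState (fun h => decide (h ∈ solutions)) p.1 p.2 = true := by
  unfold run at h
  rw [force_eq, force_eq, force_eq, force_eq, force_eq] at h
  exact forall_of_rec h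

theorem distinct_of_nodup (l : List ℕ) : ∀ m : ℕ, l.Nodup → (∀ r ∈ l, m.testBit r = false) →
    distinct l m = true := by
  induction l with
  | nil => intro m _ _; rfl
  | cons r l ih =>
    intro m hnd hm
    have e : distinct (r :: l) m = Bool.rec (force (Nat.lor m (Nat.shiftLeft 1 r)) (distinct l))
      false (Nat.beq (Nat.land (Nat.shiftRight m r) 1) 1) := rfl
    have hb : Nat.beq (Nat.land (Nat.shiftRight m r) 1) 1 = false := by
      have h1 := hm r List.mem_cons_self
      cases hc : Nat.beq (Nat.land (Nat.shiftRight m r) 1) 1 with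
      | false => rfl
      | true =>
        have h2 : (m >>> r) &&& 1 = 1 := Nat.eq_of_beq_eq_true hc
        rw [Nat.testBit, Nat.land_comm, h2] at h1
        exact absurd h1 (by decide)
    rw [e, hb, force_eq]
    rw [List.nodup_cons] at hnd
    refine ih _ hnd.2 fun s hs => ?_
    have e2 : Nat.lor m (Nat.shiftLeft 1 r) = m ||| 1 <<< r := rfl
    rw [e2, Nat.testBit_or, hm s (List.mem_cons_of_mem _ hs), Nat.shiftLeft_eq, one_mul,
      Nat.testBit_two_pow, Bool.false_or, decide_eq_false_iff_not]
    rintro rfl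
    exact hnd.1 hs

theorem nodup_diffCodes {B : Finset Pt} (hB : ∀ x ∈ B, ∀ y ∈ B, ∀ z ∈ B, ∀ w ∈ B, x ≠ y →
    x - y = z - w → x = z ∧ y = w) (l : List Pt) (hl : l.Nodup) (hlB : ∀ x ∈ l, x ∈ B) :
    (diffCodes (l.map cd)).Nodup ∧
      ∀ r ∈ diffCodes (l.map cd), ∃ x ∈ l, ∃ y ∈ l, x ≠ y ∧ r = cd (x - y) := by
  induction l with
  | nil => exact ⟨List.nodup_nil, fun r hr => absurd hr List.not_mem_nil⟩
  | cons x l ih =>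
    rw [List.nodup_cons] at hl
    obtain ⟨hx, hlB⟩ := List.forall_mem_cons.1 hlB
    obtain ⟨ih1, ih2⟩ := ih hl.2 hlB
    have e : diffCodes ((x :: l).map cd) =
        l.flatMap (fun y => [cd (x - y), cd (y - x)]) ++ diffCodes (l.map cd) := by
      have : diffCodes ((x :: l).map cd) = (l.map cd).flatMap (fun s =>
        [norm (Nat.sub (Nat.add 165 (cd x)) s), norm (Nat.sub (Nat.add 165 s) (cd x))]) ++
          diffCodes (l.map cd) := rfl
      rw [this, List.flatMap_map]
      simp only [norm_sub]
    have hne : ∀ y ∈ l, x ≠ y := fun y hy h => hl.1 (h ▸ hy)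
    rw [e]
    refine ⟨List.nodup_append.2 ⟨List.nodup_flatMap.2 ⟨fun y hy => ?_, ?_⟩, ih1, ?_⟩, ?_⟩
    · simp only [List.nodup_cons, List.mem_singleton, cd_inj, List.not_mem_nil, not_false_eq_true,
        List.nodup_nil, and_true]
      exact fun h => hne y hy (hB x hx y (hlB y hy) y (hlB y hy) x hx (hne y hy) h).1
    · refine hl.2.imp_of_mem fun {y z} hy hz hyz => ?_
      intro r hr1 hr2
      simp only [List.mem_cons, List.not_mem_nil, or_false] at hr1 hr2
      have hyB := hlB y hy
      have hzB := hlB z hz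
      have hxy := hne y hy
      have hxz := hne z hz
      rcases hr1 with h1 | h1 <;> rcases hr2 with h2 | h2 <;>
        rw [h1, cd_inj] at h2
      · exact hyz (hB x hx y hyB x hx z hzB hxy h2).2
      · exact hxz (hB x hx y hyB z hzB x hx hxy h2).1
      · exact hxz (hB y hyB x hx x hx z hzB hxy.symm h2).2
      · exact hyz (hB y hyB x hx z hzB x hx hxy.symm h2).1
    · intro r hr s hs hrs
      obtain ⟨y, hy, hr⟩ := List.mem_flatMap.1 hr
      obtain ⟨z, hz, w, hw, hzw, h2⟩ := ih2 s hs
      simp only [List.mem_cons, List.not_mem_nil, or_false] at hr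
      have hyB := hlB y hy
      have hzB := hlB z hz
      have hwB := hlB w hw
      have hxy := hne y hy
      rcases hr with h1 | h1 <;> rw [← hrs, h1, cd_inj] at h2
      · exact hne z hz (hB x hx y hyB z hzB w hwB hxy h2).1
      · exact hne w hw (hB y hyB x hx z hzB w hwB hxy.symm h2).2
    · intro r hr
      rcases List.mem_append.1 hr with hr | hr
      · obtain ⟨y, hy, hr⟩ := List.mem_flatMap.1 hr
        simp only [List.mem_cons, List.not_mem_nil, or_false] at hr
        rcases hr with h1 | h1
        · exact ⟨x, List.mem_cons_self, y, List.mem_cons_of_mem _ hy, hne y hy, h1⟩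
        · exact ⟨y, List.mem_cons_of_mem _ hy, x, List.mem_cons_self, (hne y hy).symm, h1⟩
      · obtain ⟨z, hz, w, hw, h⟩ := ih2 r hr
        exact ⟨z, List.mem_cons_of_mem _ hz, w, List.mem_cons_of_mem _ hw, h⟩

theorem cd_reflect (ρ : Bool) (x : Pt) : reflCode ρ (cd x) = cd (bif ρ then pt 54 - x else x) := by
  cases ρ with
  | false => rfl
  | true =>
    have h := norm_sub (pt 54) x
    rw [cd_pt54] at h
    exact h

/-- A move to a block with a smaller bit set. -/
theorem exists_of_reduces {ρ : Bool} {b c : Pt} {v w : ℕ} (hbc : [c, b, pt 6, pt 54, 0].Nodup)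
    (h : reduces ρ (cd b) (cd c) v w = true) :
    ∃ α : Pt ≃+ Pt, ∃ C : Finset Pt, SignTranslate {c, b, pt 6, pt 54, 0} C ∧
      0 ∈ C.image α ∧ pt 54 ∈ C.image α ∧ pt 6 ∈ C.image α ∧
      maskOf (C.image α) < maskOf {c, b, pt 6, pt 54, 0} := by
  unfold reduces at h
  cases hv : autCode v w with
  | false => rw [hv] at h; exact absurd h (by simp)
  | true =>
  rw [hv, force_eq] at h
  obtain ⟨α, hα⟩ := exists_aut_of_autCode hv
  set f : Pt → Pt := fun x => bif ρ then pt 54 - x else x with hf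
  have hfi : Function.Injective f := by
    intro x y hxy
    cases ρ with
    | false => exact hxy
    | true => exact sub_right_injective hxy
  have hmask : ∀ C : Finset Pt, maskOf ((C.image f).image α) =
      ∑ x ∈ C, 2 ^ imgCode v w (reflCode ρ (cd x)) := by
    intro C
    unfold maskOf
    rw [sum_image α.injective.injOn, sum_image hfi.injOn]
    refine sum_congr rfl fun x _ => ?_
    rw [hα, cd_reflect]
  set B : Finset Pt := {c, b, pt 6, pt 54, 0} with hB
  have hnd := hbc
  simp only [List.nodup_cons, List.mem_cons, List.not_mem_nil, or_false, not_or] at hnd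
  obtain ⟨⟨hcb, hca, hce, hc0⟩, ⟨hba, hbe, hb0⟩, ⟨hae, ha0⟩, he0, -⟩ := hnd
  have hsum : ∀ g : ℕ → ℕ, ∑ x ∈ B, g (cd x) =
      g 0 + (g 54 + (g 6 + (g (cd b) + g (cd c)))) := by
    intro g
    rw [hB, sum_insert (by simp [*]), sum_insert (by simp [*]), sum_insert (by simp [*]),
      sum_insert (by simp [*]), sum_singleton, cd_zero, cd_pt54, cd_pt6]
    ring
  have hm1 : maskOf ((B.image f).image α) = moveMask ρ v w (cd b) (cd c) := by
    rw [hmask, hsum fun r => 2 ^ imgCode v w (reflCode ρ r)]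
    rfl
  have hm2 : maskOf B = Nat.add baseMask (Nat.add (Nat.pow 2 (cd b)) (Nat.pow 2 (cd c))) := by
    have e : Nat.add baseMask (Nat.add (Nat.pow 2 (cd b)) (Nat.pow 2 (cd c))) =
      baseMask + (2 ^ cd b + 2 ^ cd c) := rfl
    have e2 : baseMask = 2 ^ 0 + 2 ^ 54 + 2 ^ 6 := by decide
    rw [maskOf, hsum fun r => 2 ^ r, e, e2]
    ring
  rw [← hm1, ← hm2] at h
  cases hl : Nat.beq (Nat.land (maskOf ((B.image f).image α)) baseMask) baseMask with
  | false => rw [hl] at h; exact absurd h (by simp)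
  | true =>
  cases hlt : Nat.ble (Nat.succ (maskOf ((B.image f).image α))) (maskOf B) with
  | false => rw [hl, hlt] at h; exact absurd h (by simp)
  | true =>
  have hl' : maskOf ((B.image f).image α) &&& baseMask = baseMask := Nat.eq_of_beq_eq_true hl
  have hbit : ∀ x : Pt, baseMask.testBit (cd x) = true → x ∈ (B.image f).image α := by
    intro x hx
    rw [← hl', Nat.testBit_and, Bool.and_eq_true] at hx
    exact (testBit_maskOf_cd _ _).1 hx.1
  refine ⟨α, B.image f, ?_, hbit _ ?_, hbit _ ?_, hbit _ ?_, Nat.le_of_ble_eq_true hlt⟩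
  · rw [signTranslate_iff]
    cases ρ with
    | false => exact ⟨0, Or.inl fun x => by simp [hf]⟩
    | true =>
      refine ⟨pt 54, Or.inr fun x => ?_⟩
      rw [mem_image]
      constructor
      · rintro ⟨y, hy, rfl⟩; simpa [hf] using hy
      · intro hx; exact ⟨_, hx, by simp [hf]⟩
  · rw [cd_zero]; decide
  · rw [cd_pt54]; decide
  · rw [cd_pt6]; decide

/-- A first block that contains `0`, `(0, 9)` and `(0, 1)` is handled by the search, or can be moved
to a block with a smaller bit set. -/
theorem classified_or_exists {F : Multiset (Finset Pt)} {b c : Pt}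
    (hnd : [c, b, pt 6, pt 54, 0].Nodup) (hbc : cd b < cd c)
    (hF : Decomposes ({c, b, pt 6, pt 54, 0} ::ₘ F) (univ.erase 0)) :
    Classified ({c, b, pt 6, pt 54, 0} ::ₘ F) ∨
    ∃ α : Pt ≃+ Pt, ∃ C : Finset Pt, SignTranslate {c, b, pt 6, pt 54, 0} C ∧
      0 ∈ C.image α ∧ pt 54 ∈ C.image α ∧ pt 6 ∈ C.image α ∧
      maskOf (C.image α) < maskOf {c, b, pt 6, pt 54, 0} := by
  have hcheck : firstBlockCheck (cd b) (cd c) = true := by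
    have h1 : b.1.val < 3 := ZMod.val_lt _
    have h2 : c.1.val < 3 := ZMod.val_lt _
    have h3 : c.2.val < 27 := ZMod.val_lt _
    have h4 := allUpTo_spec firstBlockCheck_all (3 * c.2.val + c.1.val) (by omega)
    rw [codeAt_index, force_eq] at h4
    have h5 := allUpTo_spec h4 (3 * b.2.val + b.1.val) (by unfold cd at hbc; omega)
    rwa [codeAt_index, force_eq] at h5
  have hdist : distinct (diffCodes [0, 54, 6, cd b, cd c]) 0 = true := by
    have hl : [0, 54, 6, cd b, cd c] = [0, pt 54, pt 6, b, c].map cd := by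
      simp [cd_pt54, cd_pt6]
    rw [hl]
    refine distinct_of_nodup _ _ (nodup_diffCodes (B := {c, b, pt 6, pt 54, 0})
      (fun x hx y hy z hz w hw hxy h => hF.sub_injOn hx hy hz hw hxy h) _
      (List.nodup_reverse.1 (by simpa using hnd)) ?_).1 (by simp)
    intro x hx
    simp only [List.mem_cons, List.not_mem_nil, or_false] at hx
    simp only [mem_insert, mem_singleton]
    tauto
  have hred : ∀ ρ, List.any [6, cd b, cd c] (reducesAt (cd b) (cd c) ρ) = true →
      ∃ v w, reduces ρ (cd b) (cd c) v w = true := by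
    intro ρ h
    obtain ⟨p, -, hp⟩ := List.any_eq_true.1 h
    unfold reducesAt at hp
    rw [force_eq] at hp
    cases hq : Nat.beq (Nat.mod (Nat.div (reflCode ρ p) 6) 3) 1 with
    | false => rw [hq] at hp; exact absurd hp (by simp)
    | true =>
      rw [hq, force_eq] at hp
      obtain ⟨v, -, hv⟩ := List.any_eq_true.1 hp
      exact ⟨_, _, hv⟩
  unfold firstBlockCheck at hcheck
  rw [hdist] at hcheck
  cases h1 : List.any [6, cd b, cd c] (reducesAt (cd b) (cd c) false) with
  | true =>
    obtain ⟨v, w, h⟩ := hred _ h1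
    exact Or.inr (exists_of_reduces hnd h)
  | false =>
  cases h2 : List.any [6, cd b, cd c] (reducesAt (cd b) (cd c) true) with
  | true =>
    obtain ⟨v, w, h⟩ := hred _ h2
    exact Or.inr (exists_of_reduces hnd h)
  | false =>
  rw [h1, h2] at hcheck
  obtain ⟨l, hl, hp⟩ := List.any_eq_true.1 hcheck
  obtain ⟨p, hp, hpe⟩ := List.any_eq_true.1 hp
  left
  cases h3 : Nat.beq p.1 (cd b) with
  | false => rw [h3] at hpe; exact absurd hpe (by simp)
  | true =>
  rw [h3] at hpe
  have h4 := run_spec (run_representatives l hl) p hp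
  rw [Nat.eq_of_beq_eq_true h3, Nat.eq_of_beq_eq_true hpe] at h4
  obtain ⟨h', hmem, hrel⟩ := start_sound isTables _ hF rfl hnd h4
  refine ⟨h', of_decide_eq_true hmem, AddEquiv.refl _, ?_⟩
  rwa [mapAut_refl]

/-- By induction on the bit set of the block that contains `0`, `(0, 9)` and `(0, 1)`: it decreases
under the moves of `classified_or_exists`. -/
theorem classified_of_mem (m : ℕ) : ∀ (B : Finset Pt) (F : Multiset (Finset Pt)), maskOf B = m →
    0 ∈ B → pt 54 ∈ B → pt 6 ∈ B → Decomposes (B ::ₘ F) (univ.erase 0) → Classified (B ::ₘ F) := by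
  induction m using Nat.strong_induction_on with
  | _ m ih =>
  intro B F hm h0 h54 h6 hF
  obtain ⟨b, c, hB, hnd⟩ := exists_eq_of_card_eq_five
    (hF.card_block B (Multiset.mem_cons_self _ _)) h6 h54 h0 (by decide) (by decide) (by decide)
  obtain ⟨b, c, hB, hnd, hbc⟩ : ∃ b c, B = {c, b, pt 6, pt 54, 0} ∧
      [c, b, pt 6, pt 54, 0].Nodup ∧ cd b < cd c := by
    rcases lt_trichotomy (cd b) (cd c) with h | h | h
    · exact ⟨b, c, hB, hnd, h⟩
    · rw [cd_inj] at h
      subst h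
      simp at hnd
    · refine ⟨c, b, by rw [hB, insert_comm], ?_, h⟩
      exact (List.Perm.swap _ _ _).nodup_iff.1 hnd
  subst hB
  rcases classified_or_exists hnd hbc hF with h | ⟨α, C, hC, g0, g54, g6, hlt⟩
  · exact h
  · have hF' := (hF.replace hC).mapAut α
    have h := ih _ (hm ▸ hlt) (C.image α) (mapAut α F) rfl g0 g54 g6
      (by rw [mapAut, Multiset.map_cons] at hF'; exact hF')
    have h2 : Classified (mapAut α (C ::ₘ F)) := by
      rw [mapAut, Multiset.map_cons]; exact h
    exact Classified.of_rel (Multiset.Rel.cons hC (rel_refl F)) h2.of_mapAut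

/-- A block of a difference family has a point whose second component is not a multiple of three.
Otherwise its `20` differences are among the `26` nonzero elements whose second component is a
multiple of three, and the other blocks have at most `6` such differences. This contradicts the
spectral inequality for the homomorphism to `ℤ/27` with `(u, t) ↦ 9 * t`. -/
theorem exists_mod_three_ne_zero {B : Finset Pt} {F : Multiset (Finset Pt)}
    (hF : Decomposes (B ::ₘ F) (univ.erase 0)) :
    ∃ x ∈ B, x.2.val % 3 ≠ 0 := by
  by_contra! hB
  have hcard : Multiset.card F = 3 := by
    have h1 := hF.card_eq
    have h2 : #(univ.erase (0 : Pt)) = 80 := by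
      rw [card_erase_of_mem (mem_univ _), card_univ]; rfl
    rw [h2, Multiset.card_cons] at h1
    omega
  have ht := hF.tail
  have hc := ht.card_eq
  have h := ht.le_corrSum 8
  rw [hcard] at h hc
  set D := removeDiffs (univ.erase 0) B with hD
  set H : Finset Pt := univ.filter fun x => x.2.val % 3 = 0 with hH
  have hBH : B.offDiag.image (fun p => p.1 - p.2) ⊆ H.erase 0 := by
    intro d hd
    obtain ⟨⟨x, y⟩, hp, rfl⟩ := mem_image.1 hd
    obtain ⟨hx, hy, hxy⟩ := mem_offDiag.1 hp
    refine mem_erase.2 ⟨sub_ne_zero.2 hxy, mem_filter.2 ⟨mem_univ _, ?_⟩⟩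
    have h1 := hB x hx
    have h2 := hB y hy
    have h3 : ∀ s t : ZMod 27, s.val % 3 = 0 → t.val % 3 = 0 → (s - t).val % 3 = 0 := by
      decide +kernel
    exact h3 _ _ h1 h2
  have hDcard : #(D.filter fun x => x.2.val % 3 = 0) ≤ 6 := by
    have h1 : D.filter (fun x => x.2.val % 3 = 0) =
        H.erase 0 \ B.offDiag.image (fun p => p.1 - p.2) := by
      ext x
      rw [mem_filter, mem_sdiff, mem_erase, hD, removeDiffs, mem_sdiff, mem_erase, hH, mem_filter]
      simp only [mem_univ, and_true, true_and]
      tauto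
    have h2 : #(H.erase 0) = 26 := by
      rw [hH]; decide +kernel
    have h3 : #(B.offDiag.image fun p => p.1 - p.2) = 20 := by
      rw [card_image_of_injOn, offDiag_card, hF.card_block B (Multiset.mem_cons_self _ _)]
      intro p hp q hq h
      obtain ⟨h1, h2, h3⟩ := mem_offDiag.1 hp
      obtain ⟨h4, h5, _⟩ := mem_offDiag.1 hq
      obtain ⟨h6, h7⟩ := hF.sub_injOn h1 h2 h4 h5 h3 h
      exact Prod.ext h6 h7
    rw [h1, card_sdiff_of_subset hBH, h2, h3]
  have hle : ∀ x : Pt, autoCorr (charVal 8 (cd x)) ≤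
      64 + if x.2.val % 3 = 0 then 201 else 0 := by decide +kernel
  have hsum : corrSum D 8 ≤ ∑ x ∈ D, (64 + if x.2.val % 3 = 0 then 201 else 0) :=
    sum_le_sum fun x _ => hle x
  rw [sum_add_distrib, sum_const, ← sum_filter, sum_const, smul_eq_mul, smul_eq_mul, hc] at hsum
  omega

/-- The block with the difference `(0, 9)` is translated so that it contains `0` and `(0, 9)`. It
has a point whose second component is `1` modulo `3`, possibly after the reflection that exchanges
`0` and `(0, 9)`, and an automorphism that fixes `(0, 9)` takes this point to `(0, 1)`. -/
theorem classified_of_decomposes {F : Multiset (Finset Pt)}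
    (hF : Decomposes F (univ.erase 0)) : Classified F := by
  have hmem : pt 54 ∈ univ.erase (0 : Pt) := by decide
  obtain ⟨B₀, B, F', rfl, hB, h54, h0⟩ := hF.exists_block hmem
  refine Classified.of_rel (Multiset.Rel.cons hB (rel_refl F')) ?_
  replace hF := hF.replace hB
  clear hB B₀ hmem
  obtain ⟨B', x, hB', h54', h0', hx, hx1⟩ : ∃ B' x, SignTranslate B B' ∧ pt 54 ∈ B' ∧ 0 ∈ B' ∧
      x ∈ B' ∧ x.2.val % 3 = 1 := by
    obtain ⟨x, hx, hx3⟩ := exists_mod_three_ne_zero hF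
    rcases (by omega : x.2.val % 3 = 1 ∨ x.2.val % 3 = 2) with h | h
    · exact ⟨B, x, SignTranslate.refl B, h54, h0, hx, h⟩
    · refine ⟨B.image fun y => pt 54 - y, pt 54 - x, signTranslate_iff.2
      ⟨pt 54, Or.inr fun y => ?_⟩,
        mem_image.2 ⟨0, h0, sub_zero _⟩, mem_image.2 ⟨pt 54, h54, sub_self _⟩,
        mem_image_of_mem _ hx, ?_⟩
      · rw [mem_image]
        constructor
        · rintro ⟨z, hz, rfl⟩; simpa using hz
        · intro hy; exact ⟨_, hy, by simp⟩
      · have h3 : ∀ t : ZMod 27, t.val % 3 = 2 → ((pt 54).2 - t).val % 3 = 1 := by decide +kernel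
        exact h3 _ h
  refine Classified.of_rel (Multiset.Rel.cons hB' (rel_refl F')) ?_
  replace hF := hF.replace hB'
  have hv : 3 • ((1, 0) : Pt) = 0 := by decide
  set β := linAut (1, 0) x hv (by decide) (by omega) with hβ
  have hb6 : β.symm x = pt 6 := by
    rw [AddEquiv.symm_apply_eq, hβ, linAut_apply]
    have : ((pt 6).1.val, (pt 6).2.val) = (0, 1) := by decide
    rw [Prod.mk.injEq] at this
    rw [linMap, this.1, this.2]; simp
  have hb54 : β.symm (pt 54) = pt 54 := by
    rw [AddEquiv.symm_apply_eq, hβ, linAut_apply]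
    have : ∀ x : Pt, x.2.val % 3 = 1 → pt 54 = linMap (1, 0) x (pt 54) := by decide +kernel
    exact this x hx1
  have hF2 := hF.mapAut β.symm
  refine Classified.of_mapAut (α := β.symm) ?_
  rw [mapAut, Multiset.map_cons] at hF2 ⊢
  exact classified_of_mem _ _ _ rfl (mem_image.2 ⟨0, h0', map_zero _⟩)
    (mem_image.2 ⟨_, h54', hb54⟩) (mem_image.2 ⟨_, hx, hb6⟩) hF2

/-! ### Families in the table -/

/-- The lists of codes of the base blocks of the `i`-th family of the table. -/
def codes (i : Fin 72) : List (List ℕ) :=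
  (entry i).blocks.map fun l => l.map fun p => Nat.add (Nat.mul 6 p.2) p.1

/-- The block with the given list of codes. -/
def blockOf (l : List ℕ) : Finset Pt := (l.map pt).toFinset

/-- Whether a list of codes is that of five distinct points, the first of which is `0`. -/
def IsBlockCode (l : List ℕ) : Prop :=
  l.length = 5 ∧ l.head? = some 0 ∧ l.Nodup ∧ ∀ r ∈ l, r < 162 ∧ r % 6 < 3

instance (l : List ℕ) : Decidable (IsBlockCode l) := by unfold IsBlockCode; infer_instance

theorem isBlockCode_codes : ∀ i, ∀ l ∈ codes i, IsBlockCode l := by decide +kernel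

theorem length_codes : ∀ i, (codes i).length = 4 := by decide +kernel

theorem cd_pt_of_mod {r : ℕ} (h : r < 162) (h' : r % 6 < 3) : cd (pt r) = r := by
  rw [cd_pt]
  have : norm r = 6 * ((r % 162) / 6) + r % 3 := rfl
  omega

/-- A list of codes comes from a list of points. -/
theorem IsBlockCode.exists_points {l : List ℕ} (h : IsBlockCode l) : ∃ P : List Pt,
    l = P.map cd ∧ blockOf l = P.toFinset ∧ P.Nodup ∧ P.length = 5 ∧ (0 : Pt) ∈ P := by
  obtain ⟨h5, h0, hnd, hr⟩ := h
  have e : l = (l.map pt).map cd := by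
    rw [List.map_map]
    conv_lhs => rw [← List.map_id l]
    exact List.map_congr_left fun r hl => (cd_pt_of_mod (hr r hl).1 (hr r hl).2).symm
  refine ⟨l.map pt, e, rfl, ?_, by rw [List.length_map, h5], ?_⟩
  · rw [e] at hnd
    exact hnd.of_map _
  · refine List.mem_map.2 ⟨0, List.mem_of_mem_head? (by rw [h0]; rfl), rfl⟩

theorem listed_eq (i : Fin 72) : listed i = ((codes i).map blockOf : List _) := by
  have h : ∀ i, ∀ l ∈ (entry i).blocks, ∀ p ∈ l, p.1 < 6 := by decide +kernel
  unfold listed codes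
  rw [List.map_map]
  congr 1
  refine List.map_congr_left fun l hl => ?_
  rw [Function.comp_apply, blockOf, List.map_map]
  congr 1
  refine List.map_congr_left fun p hp => ?_
  have hlt := h i l hl p hp
  have e : Nat.add (Nat.mul 6 p.2) p.1 = 6 * p.2 + p.1 := rfl
  rw [Function.comp_apply, pt, e]
  congr 2
  · omega
  · omega

/-! ### Comparison of families -/

/-- Evaluates the elements of a list before it goes on with `k`. -/
noncomputable def forceList {α : Type} (l : List ℕ) : (List ℕ → α) → α :=
  List.rec (fun k => k []) (fun a _ ih k => force a fun a' => ih fun l' => k (a' :: l')) l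

@[simp] theorem forceList_eq {α : Type} (l : List ℕ) (k : List ℕ → α) : forceList l k = k l := by
  induction l generalizing k with
  | nil => rfl
  | cons a l ih =>
    have e : forceList (a :: l) k = force a fun a' => forceList l fun l' => k (a' :: l') := rfl
    rw [e, force_eq, ih]

/-- Evaluates the lists in a list before it goes on with `k`. -/
noncomputable def forceLists {α : Type} (L : List (List ℕ)) : (List (List ℕ) → α) → α :=
  List.rec (fun k => k []) (fun l _ ih k => forceList l fun l' => ih fun L' => k (l' :: L')) L

@[simp] theorem forceLists_eq {α : Type} (L : List (List ℕ)) (k : List (List ℕ) → α) :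
    forceLists L k = k L := by
  induction L generalizing k with
  | nil => rfl
  | cons l L ih =>
    have e : forceLists (l :: L) k = forceList l fun l' => forceLists L fun L' => k (l' :: L') :=
      rfl
    rw [e, forceList_eq, ih]

/-- The bit set of the translate by `-y` of the block with the list of codes `l`, where `y` is the
point with code `s`. -/
noncomputable def maskAt (s : ℕ) (l : List ℕ) : ℕ :=
  List.rec 0 (fun r _ ih => Nat.lor ih (Nat.shiftLeft 1 (norm (Nat.sub (Nat.add 165 r) s)))) l

theorem testBit_maskAt (s i : ℕ) (l : List ℕ) : (maskAt s l).testBit i = true ↔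
    ∃ r ∈ l, norm (Nat.sub (Nat.add 165 r) s) = i := by
  induction l with
  | nil => simp [maskAt]
  | cons r l ih =>
    have e : maskAt s (r :: l) = maskAt s l ||| 1 <<< norm (Nat.sub (Nat.add 165 r) s) := rfl
    rw [e, Nat.testBit_or, Bool.or_eq_true, ih, Nat.shiftLeft_eq, one_mul, Nat.testBit_two_pow,
      decide_eq_true_eq, List.exists_mem_cons_iff, or_comm]

theorem maskAt_eq (y : Pt) (P : List Pt) :
    maskAt (cd y) (P.map cd) = maskOf (translate (-y) P.toFinset) := by
  refine Nat.eq_of_testBit_eq fun i => Bool.eq_iff_iff.2 ?_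
  rw [testBit_maskAt, testBit_maskOf]
  constructor
  · rintro ⟨r, hr, rfl⟩
    obtain ⟨x, hx, rfl⟩ := List.mem_map.1 hr
    refine ⟨x - y, ?_, (norm_sub x y).symm⟩
    rw [mem_translate, sub_neg_eq_add, sub_add_cancel, List.mem_toFinset]
    exact hx
  · rintro ⟨d, hd, rfl⟩
    rw [mem_translate, sub_neg_eq_add, List.mem_toFinset] at hd
    refine ⟨_, List.mem_map_of_mem hd, ?_⟩
    rw [norm_sub, add_sub_cancel_right]

/-- The minimum of the bit sets of the translates by `-y` of the block `l`, for `y = s` and for the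
elements `y` of `l'`. -/
noncomputable def minMask (l : List ℕ) (s : ℕ) (l' : List ℕ) : ℕ :=
  List.rec (maskAt s l) (fun y _ ih => force (maskAt y l) fun m => force ih fun m' =>
    Bool.rec m' m (Nat.ble m m')) l'

theorem exists_minMask (l : List ℕ) (s : ℕ) (l' : List ℕ) :
    ∃ y ∈ s :: l', minMask l s l' = maskAt y l := by
  induction l' with
  | nil => exact ⟨s, by simp, rfl⟩
  | cons y l' ih =>
    have e : minMask l s (y :: l') = force (maskAt y l) fun m => force (minMask l s l') fun m' =>
      Bool.rec m' m (Nat.ble m m') := rfl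
    rw [e, force_eq, force_eq]
    cases Nat.ble (maskAt y l) (minMask l s l') with
    | false =>
      obtain ⟨z, hz, h⟩ := ih
      exact ⟨z, by rw [List.mem_cons] at hz ⊢; exact hz.imp id (List.mem_cons_of_mem _), h⟩
    | true => exact ⟨y, by simp, rfl⟩

/-- A number that determines a block, given by codes, up to translation. -/
noncomputable def blockKey (l : List ℕ) : ℕ := forceList l fun l => minMask l l.headI l.tail

theorem exists_translate_of_blockKey {P Q : List Pt} (hP : P ≠ []) (hQ : Q ≠ [])
    (h : blockKey (P.map cd) = blockKey (Q.map cd)) : ∃ g, Q.toFinset = translate g P.toFinset := by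
  have hkey : ∀ P : List Pt, P ≠ [] →
      ∃ y, blockKey (P.map cd) = maskOf (translate (-y) P.toFinset) := by
    intro P hP
    obtain ⟨y, hy, he⟩ := exists_minMask (P.map cd) (P.map cd).headI (P.map cd).tail
    obtain ⟨x, rfl⟩ : ∃ x, cd x = y := by
      obtain ⟨z, P, rfl⟩ := List.exists_cons_of_ne_nil hP
      obtain ⟨x, -, hx⟩ := List.mem_map.1 (show y ∈ (z :: P).map cd from hy)
      exact ⟨x, hx⟩
    exact ⟨x, by rw [blockKey, forceList_eq, he, maskAt_eq]⟩
  obtain ⟨x, hx⟩ := hkey P hP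
  obtain ⟨y, hy⟩ := hkey Q hQ
  rw [hx, hy] at h
  have h := maskOf_injective h
  refine ⟨y - x, ?_⟩
  ext z
  have h1 := Finset.ext_iff.1 h (z - y)
  rw [mem_translate, mem_translate, sub_neg_eq_add, sub_neg_eq_add, sub_add_cancel] at h1
  rw [← h1, mem_translate]
  congr! 1
  abel

theorem TranslationEquiv.symm {F F' : Multiset (Finset Pt)} (h : TranslationEquiv F F') :
    TranslationEquiv F' F := by
  unfold TranslationEquiv at *
  rw [← Multiset.rel_flip]
  refine h.mono fun B _ C _ ⟨g, hg⟩ => ⟨-g, ?_⟩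
  ext x
  rw [mem_translate, hg, mem_translate]
  simp

theorem TranslationEquiv.trans {F F' F'' : Multiset (Finset Pt)} (h : TranslationEquiv F F')
    (h' : TranslationEquiv F' F'') : TranslationEquiv F F'' := by
  have : IsTrans (Finset Pt) fun B C => ∃ g : Pt, C = translate g B := by
    refine ⟨?_⟩
    rintro A _ _ ⟨g, rfl⟩ ⟨g', rfl⟩
    refine ⟨g + g', ?_⟩
    ext x
    rw [mem_translate, mem_translate, mem_translate]
    congr! 1
    abel
  exact Multiset.Rel.trans _ h h'

theorem TranslationEquiv.mapAut {F F' : Multiset (Finset Pt)} (h : TranslationEquiv F F')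
    (α : Pt ≃+ Pt) : TranslationEquiv (mapAut α F) (mapAut α F') := by
  unfold TranslationEquiv DiffFamily.mapAut at *
  rw [Multiset.rel_map]
  refine h.mono fun B _ C _ ⟨g, hg⟩ => ⟨α g, ?_⟩
  ext x
  rw [mem_translate, mem_image_addEquiv, mem_image_addEquiv, hg, mem_translate, map_sub,
    AddEquiv.symm_apply_apply]

theorem translationEquiv_of_perm {L L' : List (List Pt)} (hL : ∀ P ∈ L, P ≠ [])
    (hL' : ∀ P ∈ L', P ≠ []) (h : (L.map fun P => blockKey (P.map cd)).Perm
      (L'.map fun P => blockKey (P.map cd))) :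
    TranslationEquiv ((L.map List.toFinset : List (Finset Pt)) : Multiset (Finset Pt))
      (L'.map List.toFinset : List (Finset Pt)) := by
  have h1 : Multiset.Rel (fun P Q : List Pt => blockKey (P.map cd) = blockKey (Q.map cd))
      (L : Multiset (List Pt)) (L' : Multiset (List Pt)) := by
    have h2 := Multiset.rel_eq.2 (Multiset.coe_eq_coe.2 h)
    rwa [← Multiset.map_coe, ← Multiset.map_coe, Multiset.rel_map] at h2
  unfold TranslationEquiv
  rw [← Multiset.map_coe, ← Multiset.map_coe, Multiset.rel_map]
  exact h1.mono fun P hP Q hQ h => exists_translate_of_blockKey (hL P hP) (hL' Q hQ) h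

/-! ### Families found by the search are in the table -/

/-- The code of `-x` or of `x`, where `r` is the code of `x`. -/
def signCode (s : Bool) (r : ℕ) : ℕ := Bool.rec r (norm (Nat.sub 165 r)) s

theorem signCode_cd (s : Bool) (x : Pt) : signCode s (cd x) = cd (bif s then -x else x) := by
  cases s with
  | false => rfl
  | true =>
    have h := norm_sub 0 x
    rw [zero_sub] at h
    exact h

/-- For the families in `solutions`, with all choices of signs, their indices in the table, and the
codes of the images of `(1, 0)` and `(0, 1)` under an automorphism that takes the family in the
table to the given one. -/
def matching : List (List (ℕ × ℕ × ℕ)) := [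
    [(59, 110, 139), (57, 110, 139), (63, 110, 139), (61, 110, 139), (58, 110, 139),
     (56, 110, 139), (62, 110, 139), (60, 110, 139), (60, 55, 26), (62, 55, 26),
     (56, 55, 26), (58, 55, 26), (61, 55, 26), (63, 55, 26), (57, 55, 26),
     (59, 55, 26)],
    [(68, 1, 6), (67, 2, 156), (69, 1, 6), (66, 2, 156), (64, 1, 6),
     (71, 2, 156), (65, 1, 6), (70, 2, 156), (70, 1, 6), (65, 2, 156),
     (71, 1, 6), (64, 2, 156), (66, 1, 6), (69, 2, 156), (67, 1, 6),
     (68, 2, 156)],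
    [(42, 1, 78), (46, 2, 84), (44, 2, 79), (41, 2, 84), (43, 1, 78),
     (45, 1, 86), (47, 1, 78), (40, 2, 84), (40, 1, 78), (47, 2, 84),
     (45, 2, 79), (43, 2, 84), (41, 1, 78), (44, 1, 86), (46, 1, 78),
     (42, 2, 84)],
    [(44, 1, 78), (41, 1, 86), (47, 2, 79), (40, 1, 86), (42, 2, 79),
     (46, 1, 86), (43, 2, 79), (45, 2, 84), (45, 1, 78), (43, 1, 86),
     (46, 2, 79), (42, 1, 86), (40, 2, 79), (47, 1, 86), (41, 2, 79),
     (44, 2, 84)],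
    [(34, 110, 97), (35, 110, 97), (38, 110, 97), (39, 110, 97), (32, 110, 97),
     (33, 110, 97), (36, 110, 97), (37, 110, 97), (37, 55, 68), (36, 55, 68),
     (33, 55, 68), (32, 55, 68), (39, 55, 68), (38, 55, 68), (35, 55, 68),
     (34, 55, 68)],
    [(29, 109, 67), (28, 109, 67), (31, 109, 67), (30, 109, 67), (25, 109, 67),
     (24, 109, 67), (27, 109, 67), (26, 109, 67), (26, 56, 98), (27, 56, 98),
     (24, 56, 98), (25, 56, 98), (30, 56, 98), (31, 56, 98), (28, 56, 98),
     (29, 56, 98)],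
    [(21, 55, 116), (14, 110, 49), (20, 55, 116), (15, 110, 49), (23, 55, 116),
     (12, 110, 49), (22, 55, 116), (13, 110, 49), (13, 55, 116), (22, 110, 49),
     (12, 55, 116), (23, 110, 49), (15, 55, 116), (20, 110, 49), (14, 55, 116),
     (21, 110, 49)],
    [(18, 55, 116), (9, 110, 49), (10, 55, 116), (17, 110, 49), (16, 55, 116),
     (11, 110, 49), (8, 55, 116), (19, 110, 49), (19, 55, 116), (8, 110, 49),
     (11, 55, 116), (16, 110, 49), (17, 55, 116), (10, 110, 49), (9, 55, 116),
     (18, 110, 49)],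
    [(53, 55, 78), (50, 110, 84), (49, 55, 78), (54, 110, 84), (55, 55, 78),
     (48, 110, 84), (51, 55, 78), (52, 110, 84), (52, 55, 78), (51, 110, 84),
     (48, 55, 78), (55, 110, 84), (54, 55, 78), (49, 110, 84), (50, 55, 78),
     (53, 110, 84)],
    [(1, 55, 60), (3, 55, 60), (0, 55, 60), (2, 55, 60), (6, 110, 102),
     (4, 110, 102), (7, 110, 102), (5, 110, 102), (5, 55, 60), (7, 55, 60),
     (4, 55, 60), (6, 55, 60), (2, 110, 102), (0, 110, 102), (3, 110, 102),
     (1, 110, 102)],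
    [(1, 56, 60), (3, 56, 60), (0, 56, 60), (2, 56, 60), (6, 109, 102),
     (4, 109, 102), (7, 109, 102), (5, 109, 102), (5, 56, 60), (7, 56, 60),
     (4, 56, 60), (6, 56, 60), (2, 109, 102), (0, 109, 102), (3, 109, 102),
     (1, 109, 102)]]

/-- Whether `v` and `w` give an automorphism that, for `t = (i, v, w)`, takes the `i`-th family of
the table to the blocks in `L`, up to translation. -/
noncomputable def familyMatches (L : List (List ℕ)) (t : ℕ × ℕ × ℕ) : Bool :=
  Bool.rec false (List.isPerm ((codes (Fin.ofNat 72 t.1)).map fun l =>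
    blockKey (l.map (imgCode t.2.1 t.2.2))) (L.map blockKey)) (autCode t.2.1 t.2.2)

/-- The blocks of a family found by the search, with signs. -/
def signedCodes : List Bool → List ℕ → List (List ℕ)
  | s :: σ, e :: a :: b :: c :: h => [0, e, a, b, c].map (signCode s) :: signedCodes σ h
  | _, _ => []

/-- The columns of `matching` correspond to the sixteen choices of signs in lexicographic order. -/
theorem matching_spec : ∀ p ∈ solutions.zip matching, ∀ q ∈ [
    [false, false, false, false], [false, false, false, true], [false, false, true, false],
    [false, false, true, true], [false, true, false, false], [false, true, false, true],
    [false, true, true, false], [false, true, true, true], [true, false, false, false],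
    [true, false, false, true], [true, false, true, false], [true, false, true, true],
    [true, true, false, false], [true, true, false, true], [true, true, true, false],
    [true, true, true, true]].zip p.2, familyMatches (signedCodes q.1 p.1) q.2 = true := by
  decide +kernel

theorem mapAut_listed {v w : ℕ} {α : Pt ≃+ Pt} (hα : ∀ x, cd (α x) = imgCode v w (cd x))
    (i : Fin 72) : ∃ L : List (List Pt), mapAut α (listed i) = (L.map List.toFinset : List _) ∧
      (codes i).map (fun l => l.map (imgCode v w)) = L.map (fun P => P.map cd) ∧
      ∀ P ∈ L, P ≠ [] := by
  refine ⟨(codes i).map fun l => (l.map pt).map α, ?_, ?_, ?_⟩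
  · rw [listed_eq, mapAut, Multiset.map_coe, List.map_map, List.map_map]
    refine congrArg _ (List.map_congr_left fun l _ => ?_)
    ext x
    simp [blockOf]
  · rw [List.map_map]
    refine List.map_congr_left fun l hl => ?_
    rw [Function.comp_apply, List.map_map, List.map_map]
    refine List.map_congr_left fun r hr => ?_
    have h := (isBlockCode_codes i l hl).2.2.2 r hr
    rw [Function.comp_apply, Function.comp_apply, hα, cd_pt_of_mod h.1 h.2]
  · intro P hP
    obtain ⟨l, hl, rfl⟩ := List.mem_map.1 hP
    have h := (isBlockCode_codes i l hl).1
    intro h0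
    rw [List.map_map, List.map_eq_nil_iff] at h0
    rw [h0] at h
    exact absurd h (by simp)

theorem multiplierEquiv_of_familyMatches {L : List (List Pt)} (hL : ∀ P ∈ L, P ≠ [])
    {t : ℕ × ℕ × ℕ} (h : familyMatches (L.map fun P => P.map cd) t = true) :
    ∃ i, MultiplierEquiv (listed i) (L.map List.toFinset : List (Finset Pt)) := by
  unfold familyMatches at h
  cases ha : autCode t.2.1 t.2.2 with
  | false => rw [ha] at h; exact absurd h (by simp)
  | true =>
  rw [ha] at h
  obtain ⟨α, hα⟩ := exists_aut_of_autCode ha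
  refine ⟨Fin.ofNat 72 t.1, α, ?_⟩
  obtain ⟨L', h1, h2, h3⟩ := mapAut_listed hα (Fin.ofNat 72 t.1)
  rw [h1]
  refine translationEquiv_of_perm h3 hL ?_
  have h4 := List.isPerm_iff.1 h
  have h5 : (codes (Fin.ofNat 72 t.1)).map (fun l => blockKey (l.map (imgCode t.2.1 t.2.2))) =
      L'.map fun P => blockKey (P.map cd) := by
    have := congrArg (List.map blockKey) h2
    rw [List.map_map, List.map_map] at this
    exact this
  rw [h5, List.map_map] at h4
  exact h4

/-- The points of the blocks of a family found by the search, with signs. -/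
def signedPoints : List Bool → List ℕ → List (List Pt)
  | s :: σ, e :: a :: b :: c :: h =>
    [0, pt e, pt a, pt b, pt c].map (fun x => bif s then -x else x) :: signedPoints σ h
  | _, _ => []

theorem signedCodes_eq : ∀ (σ : List Bool) (h : List ℕ), (∀ r ∈ h, r < 162 ∧ r % 6 < 3) →
    signedCodes σ h = (signedPoints σ h).map fun P => P.map cd
  | s :: σ, e :: a :: b :: c :: h => by
    intro hr
    simp only [List.forall_mem_cons] at hr
    obtain ⟨he, ha, hb, hc, hh⟩ := hr
    rw [signedCodes, signedPoints, List.map_cons, signedCodes_eq σ h hh]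
    congr 1
    simp only [List.map_cons, List.map_nil, ← signCode_cd, cd_zero, cd_pt_of_mod he.1 he.2,
      cd_pt_of_mod ha.1 ha.2, cd_pt_of_mod hb.1 hb.2, cd_pt_of_mod hc.1 hc.2]
  | [], _ => fun _ => by simp [signedCodes, signedPoints]
  | _ :: _, [] => fun _ => by simp [signedCodes, signedPoints]
  | _ :: _, [_] => fun _ => by simp [signedCodes, signedPoints]
  | _ :: _, [_, _] => fun _ => by simp [signedCodes, signedPoints]
  | _ :: _, [_, _, _] => fun _ => by simp [signedCodes, signedPoints]

theorem signedPoints_ne_nil : ∀ (σ : List Bool) (h : List ℕ), ∀ P ∈ signedPoints σ h, P ≠ []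
  | s :: σ, e :: a :: b :: c :: h => by
    rw [signedPoints, List.forall_mem_cons]
    exact ⟨by simp, signedPoints_ne_nil σ h⟩
  | [], _ => by simp [signedPoints]
  | _ :: _, [] => by simp [signedPoints]
  | _ :: _, [_] => by simp [signedPoints]
  | _ :: _, [_, _] => by simp [signedPoints]
  | _ :: _, [_, _, _] => by simp [signedPoints]

/-- The blocks of a family that agrees with `famOf h` up to translation and negation are, up to
translation, those of `famOf h` with suitable signs. -/
theorem exists_signs : ∀ (h : List ℕ) (n : ℕ) (F : Multiset (Finset Pt)), h.length = 4 * n →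
    Multiset.Rel SignTranslate F (famOf h) → ∃ σ : List Bool, σ.length = n ∧
      TranslationEquiv ((signedPoints σ h).map List.toFinset : List (Finset Pt)) F
  | e :: a :: b :: c :: h, n => by
    intro F hn hF
    obtain ⟨n, rfl⟩ : ∃ m, n = m + 1 := ⟨n - 1, by simp only [List.length_cons] at hn; omega⟩
    rw [famOf_cons, Multiset.rel_cons_right] at hF
    obtain ⟨B, F', hB, hF', rfl⟩ := hF
    obtain ⟨σ, hσ, h1⟩ := exists_signs h n F' (by simp only [List.length_cons] at hn; omega) hF'
    obtain ⟨s, hs⟩ : ∃ s : Bool, ∃ g, B = translate g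
        ([0, pt e, pt a, pt b, pt c].map (fun x => bif s then -x else x)).toFinset := by
      obtain ⟨g, hg⟩ := hB.symm
      rcases hg with hg | hg
      · refine ⟨false, g, ?_⟩
        rw [hg]
        congr 1
        ext x; simp
      · refine ⟨true, g, ?_⟩
        rw [hg]
        congr 1
        ext x; simp
    refine ⟨s :: σ, by rw [List.length_cons, hσ], ?_⟩
    rw [signedPoints, List.map_cons, ← Multiset.cons_coe]
    exact Multiset.Rel.cons hs h1
  | [], n => by
    intro F hn hF
    refine ⟨[], by simp at hn; simp [hn], ?_⟩
    have : F = 0 := Multiset.rel_zero_right.1 hF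
    rw [this, signedPoints]
    · exact Multiset.Rel.zero
    · simp
  | [_], n => by intro F hn; simp at hn; omega
  | [_, _], n => by intro F hn; simp at hn; omega
  | [_, _, _], n => by intro F hn; simp at hn; omega

/-- Families found by the search are equivalent up to multipliers to families in the table. -/
theorem Classified.exists_multiplierEquiv {F : Multiset (Finset Pt)} (hF : Classified F) :
    ∃ i, MultiplierEquiv (listed i) F := by
  obtain ⟨h, hh, α, hα⟩ := hF
  have hlen : ∀ h ∈ solutions, h.length = 4 * 4 := by decide
  have hmod : ∀ h ∈ solutions, ∀ r ∈ h, r < 162 ∧ r % 6 < 3 := by decide +kernel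
  obtain ⟨σ, hσ, hT⟩ := exists_signs h 4 _ (hlen h hh) hα
  obtain ⟨t, ht⟩ : ∃ t, familyMatches (signedCodes σ h) t = true := by
    obtain ⟨p, hp, rfl⟩ : ∃ p ∈ solutions.zip matching, p.1 = h := by
      have e : (solutions.zip matching).map Prod.fst = solutions :=
        List.map_fst_zip (by decide)
      rw [← e] at hh
      exact List.mem_map.1 hh
    have h16 : ∀ p ∈ solutions.zip matching, 16 ≤ p.2.length := by decide +kernel
    have h1 := matching_spec p hp
    set S := [
      [false, false, false, false], [false, false, false, true], [false, false, true, false],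
      [false, false, true, true], [false, true, false, false], [false, true, false, true],
      [false, true, true, false], [false, true, true, true], [true, false, false, false],
      [true, false, false, true], [true, false, true, false], [true, false, true, true],
      [true, true, false, false], [true, true, false, true], [true, true, true, false],
      [true, true, true, true]] with hS
    have hmem : σ ∈ S := by
      obtain ⟨a, b, c, d, rfl⟩ : ∃ a b c d, σ = [a, b, c, d] := by
        match σ, hσ with
        | [a, b, c, d], _ => exact ⟨a, b, c, d, rfl⟩
      have hall : ∀ a b c d : Bool, [a, b, c, d] ∈ S := by rw [hS]; decide
      exact hall a b c d
    have e : (S.zip p.2).map Prod.fst = S := List.map_fst_zip (h16 p hp)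
    rw [← e] at hmem
    obtain ⟨q, hq, rfl⟩ := List.mem_map.1 hmem
    exact ⟨q.2, h1 q hq⟩
  rw [signedCodes_eq σ h (hmod h hh)] at ht
  obtain ⟨i, β, hβ⟩ := multiplierEquiv_of_familyMatches (signedPoints_ne_nil σ h) ht
  refine ⟨i, β.trans α.symm, ?_⟩
  have h2 := (hβ.trans hT).mapAut α.symm
  rw [mapAut_mapAut, mapAut_mapAut, AddEquiv.self_trans_symm, mapAut_refl] at h2
  exact h2

/-! ### The families in the table are difference families -/

/-- The bit set of the differences of the blocks in `L`. -/
noncomputable def coverMask (L : List (List ℕ)) : ℕ :=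
  List.rec 0 (fun l _ ih => List.rec ih (fun y _ m => Nat.lor m (maskAt y l)) l) L

theorem testBit_coverMask {L : List (List ℕ)} {i : ℕ} (h : (coverMask L).testBit i = true) :
    ∃ l ∈ L, ∃ y ∈ l, ∃ r ∈ l, norm (Nat.sub (Nat.add 165 r) y) = i := by
  induction L with
  | nil => simp [coverMask] at h
  | cons l L ih =>
    have key : ∀ (l' : List ℕ) (m : ℕ), (List.rec (motive := fun _ => ℕ) m
        (fun y _ m => Nat.lor m (maskAt y l)) l' : ℕ).testBit i = true → m.testBit i = true ∨
          ∃ y ∈ l', (maskAt y l).testBit i = true := by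
      intro l' m hl'
      induction l' with
      | nil => exact Or.inl hl'
      | cons y l' ih' =>
        have e : (List.rec (motive := fun _ => ℕ) m (fun y _ m => Nat.lor m (maskAt y l))
          (y :: l') : ℕ) =
          (List.rec (motive := fun _ => ℕ) m (fun y _ m => Nat.lor m (maskAt y l)) l' : ℕ) |||
            maskAt y l := rfl
        rw [e, Nat.testBit_or, Bool.or_eq_true] at hl'
        rcases hl' with h1 | h1
        · exact (ih' h1).imp id fun ⟨y, hy, h⟩ => ⟨y, List.mem_cons_of_mem _ hy, h⟩
        · exact Or.inr ⟨y, List.mem_cons_self, h1⟩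
    rcases key l _ h with h1 | ⟨y, hy, h1⟩
    · obtain ⟨l', hl', h2⟩ := ih h1
      exact ⟨l', List.mem_cons_of_mem _ hl', h2⟩
    · exact ⟨l, List.mem_cons_self, y, hy, (testBit_maskAt _ _ _).1 h1⟩

/-- Whether all points are differences of the blocks in `L`. -/
noncomputable def coverCheck (L : List (List ℕ)) : Bool :=
  forceLists L fun L => force (coverMask L) fun m =>
    allUpTo (fun k => Nat.beq (Nat.land 1 (Nat.shiftRight m (codeAt k))) 1) 81

theorem coverCheck_codes : ∀ i, coverCheck (codes i) = true := by decide +kernel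

theorem testBit_of_beq {m i : ℕ} (h : Nat.beq (Nat.land 1 (Nat.shiftRight m i)) 1 = true) :
    m.testBit i = true := by
  have h1 : 1 &&& (m >>> i) = 1 := Nat.eq_of_beq_eq_true h
  rw [Nat.testBit, h1]; rfl

theorem beq_of_testBit {m i : ℕ} (h : m.testBit i = true) :
    Nat.beq (Nat.land 1 (Nat.shiftRight m i)) 1 = true := by
  have h1 : 1 &&& (m >>> i) = 1 := by
    rw [Nat.testBit, bne_iff_ne, Nat.one_and_eq_mod_two] at h
    rw [Nat.one_and_eq_mod_two]; omega
  show Nat.beq (1 &&& (m >>> i)) 1 = true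
  rw [h1]; rfl

theorem card_blockOf {i : Fin 72} {l : List ℕ} (hl : l ∈ codes i) : #(blockOf l) = 5 := by
  obtain ⟨P, -, h, hnd, h5, -⟩ := (isBlockCode_codes i l hl).exists_points
  rw [h, List.toFinset_card_of_nodup hnd, h5]

theorem mem_listed {i : Fin 72} {B : Finset Pt} :
    B ∈ listed i ↔ ∃ l ∈ codes i, blockOf l = B := by
  rw [listed_eq, Multiset.mem_coe, List.mem_map]

/-- The four blocks have `80` differences at two different points, and every nonzero element occurs
among them. -/
theorem decomposes_listed (i : Fin 72) : Decomposes (listed i) (univ.erase 0) := by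
  have hcard : ∀ B ∈ listed i, #B = 5 := by
    intro B hB
    obtain ⟨l, hl, rfl⟩ := mem_listed.1 hB
    exact card_blockOf hl
  have hpos : ∀ d ∈ univ.erase (0 : Pt), 1 ≤ ((listed i).map fun B => diffCount B d).sum := by
    intro d _
    have hc := coverCheck_codes i
    unfold coverCheck at hc
    rw [forceLists_eq, force_eq] at hc
    have h1 : d.1.val < 3 := ZMod.val_lt _
    have h2 : d.2.val < 27 := ZMod.val_lt _
    have h3 := testBit_of_beq (allUpTo_spec hc (3 * d.2.val + d.1.val) (by omega))
    rw [codeAt_index] at h3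
    obtain ⟨l, hl, y, hy, r, hr, he⟩ := testBit_coverMask h3
    obtain ⟨P, rfl, hP, -, -, -⟩ := (isBlockCode_codes i l hl).exists_points
    obtain ⟨z, hz, rfl⟩ := List.mem_map.1 hy
    obtain ⟨x, hx, rfl⟩ := List.mem_map.1 hr
    rw [norm_sub, cd_inj] at he
    have hd : 1 ≤ diffCount (blockOf (P.map cd)) d := by
      refine card_pos.2 ⟨(x, z), mem_filter.2 ⟨mem_product.2 ⟨?_, ?_⟩, he⟩⟩
      · rw [hP]; exact List.mem_toFinset.2 hx
      · rw [hP]; exact List.mem_toFinset.2 hz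
    exact hd.trans (Multiset.le_sum_of_mem
      (Multiset.mem_map_of_mem (fun B => diffCount B d) (mem_listed.2 ⟨_, hl, rfl⟩)))
  have hsum : ∑ d ∈ univ.erase (0 : Pt), ((listed i).map fun B => diffCount B d).sum = 80 := by
    have h1 : ∀ B ∈ listed i, ∑ d ∈ univ.erase (0 : Pt), (diffCount B d : ℤ) = 20 := by
      intro B hB
      have h2 := sum_sub_eq B fun _ => 1
      rw [← add_sum_erase univ _ (mem_univ 0), diffCount_zero, sum_const, card_product,
        hcard B hB] at h2
      simp only [mul_one, nsmul_eq_mul] at h2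
      push_cast at h2
      linarith
    have h3 := sum_map_sum_comm (listed i) (univ.erase (0 : Pt)) fun B d => (diffCount B d : ℤ)
    rw [Multiset.map_congr rfl h1, Multiset.map_const', Multiset.sum_replicate, listed_eq,
      Multiset.coe_card, List.length_map, length_codes] at h3
    have h4 : ((∑ d ∈ univ.erase (0 : Pt), ((listed i).map fun B => diffCount B d).sum : ℕ) : ℤ) =
        80 := by
      rw [listed_eq]
      push_cast
      rw [← h3.symm.trans (by norm_num : 4 • (20 : ℤ) = 80)]
      refine sum_congr rfl fun d _ => ?_
      rw [Multiset.map_map]; rfl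
    exact_mod_cast h4
  refine ⟨hcard, notMem_erase _ _, fun d hd => ?_⟩
  have hd' : d ∈ univ.erase (0 : Pt) := mem_erase.2 ⟨hd, mem_univ _⟩
  rw [if_pos hd']
  have h80 : ∑ d ∈ univ.erase (0 : Pt), 1 = 80 := by
    rw [sum_const, card_erase_of_mem (mem_univ _), card_univ]; rfl
  exact ((sum_eq_sum_iff_of_le hpos).1 (h80.trans hsum.symm) d hd').symm

theorem card_pt : Fintype.card Pt = 81 := rfl

theorem mem_development {F : Multiset (Finset Pt)} {C : Finset Pt} :
    C ∈ development F ↔ ∃ B ∈ F, ∃ g, translate g B = C := by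
  simp [development]

/-- The development of a difference family is a Steiner system: a pair of points lies in the
translate of the block that has the difference of the two points. -/
theorem Decomposes.isSteinerSystem {F : Multiset (Finset Pt)} (hF : Decomposes F (univ.erase 0)) :
    IsSteinerSystem 2 5 81 (development F) := by
  refine ⟨card_pt, ?_, ?_⟩
  · intro C hC
    obtain ⟨B, hB, g, rfl⟩ := mem_development.1 hC
    rw [translate, card_image_of_injective _ (add_right_injective g), hF.card_block B hB]
  · intro T hT
    obtain ⟨a, b, hab, rfl⟩ := card_eq_two.1 hT
    have hd : a - b ≠ 0 := sub_ne_zero.2 hab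
    have hs := hF.sum_eq _ hd
    rw [if_pos (mem_erase.2 ⟨hd, mem_univ _⟩)] at hs
    obtain ⟨B, hB, hBd⟩ : ∃ B ∈ F, diffCount B (a - b) ≠ 0 := by
      by_contra! hc
      rw [Multiset.map_congr rfl hc, Multiset.map_const', Multiset.sum_replicate] at hs
      simp at hs
    obtain ⟨F', rfl⟩ := Multiset.exists_cons_of_mem hB
    rw [Multiset.map_cons, Multiset.sum_cons] at hs
    obtain ⟨⟨x, y⟩, hp⟩ := card_ne_zero.1 hBd
    have hp' := hp
    obtain ⟨h1, h2⟩ := mem_filter.1 hp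
    obtain ⟨hx, hy⟩ := mem_product.1 h1
    dsimp only at hx hy h2
    refine ⟨translate (a - x) B, ⟨mem_development.2 ⟨B, hB, _, rfl⟩, ?_⟩, ?_⟩
    · intro z hz
      rw [mem_insert, mem_singleton] at hz
      rw [mem_translate]
      rcases hz with rfl | rfl
      · simpa using hx
      · have : z - (a - x) = y := by rw [← sub_sub_self x y, h2]; abel
        rwa [this]
    · rintro _ ⟨hT', hT⟩
      obtain ⟨C, hC, g, rfl⟩ := mem_development.1 hT'
      have ha := mem_translate.1 (hT (mem_insert_self a {b}))
      have hb := mem_translate.1 (hT (mem_insert_of_mem (mem_singleton_self b)))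
      have hm : (a - g, b - g) ∈ {p ∈ C ×ˢ C | p.1 - p.2 = a - b} :=
        mem_filter.2 ⟨mem_product.2 ⟨ha, hb⟩, sub_sub_sub_cancel_right a b g⟩
      have hCd : diffCount C (a - b) ≠ 0 := card_ne_zero.2 ⟨_, hm⟩
      rcases Multiset.mem_cons.1 hC with rfl | hC'
      · have h3 := card_le_one.1 (by unfold diffCount at hs; omega) _ hp' _ hm
        have h4 : x = a - g := congrArg Prod.fst h3
        rw [h4, sub_sub_cancel]
      · exfalso
        have h3 : diffCount C (a - b) ≤ (F'.map fun B => diffCount B (a - b)).sum :=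
          Multiset.le_sum_of_mem (Multiset.mem_map_of_mem (fun B => diffCount B (a - b)) hC')
        omega

/-! ### The multipliers -/

/-- Whether the linear map given by `v` and `w` takes all blocks to translates of blocks. -/
noncomputable def imagesCheck (L : List (List ℕ)) (v w : ℕ) : Bool :=
  L.all fun l => force (maskAt 0 (l.map (imgCode v w))) fun m =>
    L.any fun C => C.any fun y => Nat.beq (maskAt y C) m

/-- Whether the identity is the only multiplier: a multiplier takes the first block to a translate
of a block `C` by `-y`, where `y` is in `C`, so that the image of `(0, 1)` is the difference of `y`
and a point `z` of `C`. The image of `(1, 0)` has order three. The points of the first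
block other than `0` and `(0, 1)` are tested before all blocks are. -/
noncomputable def multiplierCheck (L : List (List ℕ)) : Bool := forceLists L fun L =>
  L.all fun C => C.all fun y => force (maskAt y C) fun M => C.all fun z =>
    force (norm (Nat.sub (Nat.add 165 z) y)) fun w =>
    [0, 1, 2, 54, 55, 56, 108, 109, 110].all fun v =>
      Bool.rec (Bool.rec true (Bool.rec true false (imagesCheck L v w))
        ((L.headI.drop 2).all fun r =>
          Nat.beq (Nat.land 1 (Nat.shiftRight M (imgCode v w r))) 1)) true
        (Bool.rec false (Nat.beq w 6) (Nat.beq v 1))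

theorem multiplierCheck_codes : ∀ i, multiplierCheck (codes i) = true := by decide +kernel

theorem aut_eq_linMap (α : Pt ≃+ Pt) (x : Pt) : α x = linMap (α (1, 0)) (α (0, 1)) x := by
  have h : x = x.1.val • ((1, 0) : Pt) + x.2.val • ((0, 1) : Pt) := by
    ext <;> simp
  conv_lhs => rw [h]
  rw [map_add, map_nsmul, map_nsmul]
  rfl

theorem cd_aut (α : Pt ≃+ Pt) (x : Pt) :
    cd (α x) = imgCode (cd (α (1, 0))) (cd (α (0, 1))) (cd x) := by
  rw [aut_eq_linMap α x, ← cd_linMap, pt_cd, pt_cd]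

theorem maskAt_image (α : Pt ≃+ Pt) (P : List Pt) :
    maskAt 0 ((P.map cd).map (imgCode (cd (α (1, 0))) (cd (α (0, 1))))) =
      maskOf (P.toFinset.image α) := by
  have h1 : (P.map cd).map (imgCode (cd (α (1, 0))) (cd (α (0, 1)))) = (P.map α).map cd := by
    rw [List.map_map, List.map_map]
    exact List.map_congr_left fun x _ => (cd_aut α x).symm
  rw [h1, ← cd_zero, maskAt_eq]
  congr 1
  ext x
  rw [mem_translate]
  simp

theorem multiplier_eq_refl {i : Fin 72} {α : Pt ≃+ Pt}
    (h : TranslationEquiv (mapAut α (listed i)) (listed i)) : α = AddEquiv.refl Pt := by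
  -- the image of a block, which contains zero, is a translate of a block by one of its points
  have himg : ∀ l ∈ codes i, ∃ C ∈ codes i, ∃ y ∈ blockOf C,
      (blockOf l).image α = translate (-y) (blockOf C) := by
    intro l hl
    have hB : (blockOf l).image α ∈ mapAut α (listed i) :=
      Multiset.mem_map_of_mem _ (mem_listed.2 ⟨l, hl, rfl⟩)
    obtain ⟨C', hC', g, hg⟩ := Multiset.exists_mem_of_rel_of_mem h hB
    obtain ⟨C, hC, rfl⟩ := mem_listed.1 hC'
    obtain ⟨P, -, hP, -, -, h0⟩ := (isBlockCode_codes i l hl).exists_points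
    have h0' : (0 : Pt) ∈ (blockOf l).image α :=
      mem_image.2 ⟨0, by rw [hP]; exact List.mem_toFinset.2 h0, map_zero _⟩
    refine ⟨C, hC, g, ?_, ?_⟩
    · rw [hg, mem_translate, sub_self]; exact h0'
    · ext x
      rw [hg, mem_translate, mem_translate]; simp
  have hmask : ∀ l ∈ codes i, ∀ C ∈ codes i, ∀ y : Pt, (blockOf l).image α =
      translate (-y) (blockOf C) → maskAt 0 (l.map (imgCode (cd (α (1, 0))) (cd (α (0, 1))))) =
        maskAt (cd y) C := by
    intro l hl C hC y hy
    obtain ⟨P, rfl, hP, -⟩ := (isBlockCode_codes i l hl).exists_points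
    obtain ⟨Q, rfl, hQ, -⟩ := (isBlockCode_codes i C hC).exists_points
    rw [maskAt_image, maskAt_eq, ← hP, ← hQ, hy]
  have hmemcd : ∀ C ∈ codes i, ∀ y ∈ blockOf C, cd y ∈ C := by
    intro C hC y hy
    obtain ⟨Q, rfl, hQ, -⟩ := (isBlockCode_codes i C hC).exists_points
    rw [hQ, List.mem_toFinset] at hy
    exact List.mem_map_of_mem hy
  have hhead : ∀ i, (codes i).headI ∈ codes i ∧ 6 ∈ (codes i).headI := by decide +kernel
  obtain ⟨hl, h6⟩ := hhead i
  obtain ⟨C, hC, y, hy, hCy⟩ := himg _ hl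
  have hw : α (0, 1) + y ∈ blockOf C := by
    have h1 : (0, 1) ∈ blockOf (codes i).headI := by
      rw [blockOf, List.mem_toFinset]
      exact List.mem_map.2 ⟨6, h6, by decide⟩
    have h2 := mem_image_of_mem α h1
    rw [hCy, mem_translate] at h2
    rwa [sub_neg_eq_add] at h2
  have hc := multiplierCheck_codes i
  unfold multiplierCheck at hc
  rw [forceLists_eq, List.all_eq_true] at hc
  have h1 := List.all_eq_true.1 (hc C hC) (cd y) (hmemcd C hC y hy)
  rw [force_eq, List.all_eq_true] at h1
  have h2 := h1 _ (hmemcd C hC _ hw)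
  rw [norm_sub, add_sub_cancel_right, force_eq, List.all_eq_true] at h2
  have hv : ∀ v : Pt, 3 • v = 0 → cd v ∈ [0, 1, 2, 54, 55, 56, 108, 109, 110] := by decide +kernel
  have h3v : 3 • α (1, 0) = 0 := by
    rw [← map_nsmul]
    exact (map_eq_zero_iff α α.injective).2 (by decide)
  have h3 := h2 _ (hv (α (1, 0)) h3v)
  have himages : imagesCheck (codes i) (cd (α (1, 0))) (cd (α (0, 1))) = true := by
    unfold imagesCheck
    rw [List.all_eq_true]
    intro l hl
    obtain ⟨C, hC, y, hy, hCy⟩ := himg l hl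
    rw [force_eq, List.any_eq_true]
    refine ⟨C, hC, List.any_eq_true.2 ⟨cd y, hmemcd C hC y hy, ?_⟩⟩
    rw [hmask l hl C hC y hCy]
    exact Nat.beq_refl _
  have hsub : (((codes i).headI.drop 2).all fun r => Nat.beq (Nat.land 1 (Nat.shiftRight
      (maskAt (cd y) C) (imgCode (cd (α (1, 0))) (cd (α (0, 1))) r))) 1) = true := by
    rw [List.all_eq_true]
    intro r hr
    refine beq_of_testBit ?_
    rw [← hmask _ hl C hC y hCy, testBit_maskAt]
    refine ⟨_, List.mem_map_of_mem (List.mem_of_mem_drop hr), ?_⟩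
    obtain ⟨P, hP, -⟩ := (isBlockCode_codes i _ hl).exists_points
    have hr' := List.mem_of_mem_drop hr
    rw [hP] at hr'
    obtain ⟨x, -, rfl⟩ := List.mem_map.1 hr'
    rw [← cd_aut, ← cd_zero, norm_sub, sub_zero]
  rw [himages, hsub] at h3
  cases hb : Nat.beq (cd (α (1, 0))) 1 with
  | false => rw [hb] at h3; exact absurd h3 (by simp)
  | true =>
  cases hb' : Nat.beq (cd (α (0, 1))) 6 with
  | false => rw [hb, hb'] at h3; exact absurd h3 (by simp)
  | true =>
  have e1 : α (1, 0) = (1, 0) := cd_injective (Nat.eq_of_beq_eq_true hb)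
  have e2 : α (0, 1) = (0, 1) := cd_injective (Nat.eq_of_beq_eq_true hb')
  ext1 x
  rw [aut_eq_linMap, e1, e2]
  unfold linMap
  ext <;> simp

theorem multiplierCount_listed (i : Fin 72) : multiplierCount (listed i) = 1 := by
  unfold multiplierCount
  rw [Nat.card_eq_one_iff_unique]
  refine ⟨⟨fun α β => Subtype.ext ?_⟩, ⟨AddEquiv.refl Pt, ?_⟩⟩
  · rw [multiplier_eq_refl α.2, multiplier_eq_refl β.2]
  · rw [mapAut_refl]
    exact Multiset.rel_refl_of_refl_on fun B _ => ⟨0, by simp [translate]⟩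

/-! ### The hyperbolic frequency of a Steiner system -/

section Design

variable {V : Type*} [Fintype V] [DecidableEq V] {D : Finset (Finset V)} {v j : ℕ}

theorem mem_line {a b c : V} : c ∈ line D a b ↔ Collinear3 D a b c := by
  simp [line]

theorem Collinear3.rotate {V : Type*} {D : Finset (Finset V)} {a b c : V} (h : Collinear3 D a b c) :
    Collinear3 D b c a :=
  let ⟨B, hB, ha, hb, hc⟩ := h
  ⟨B, hB, hb, hc, ha⟩

theorem Collinear3.swap {V : Type*} {D : Finset (Finset V)} {a b c : V} (h : Collinear3 D a b c) :
    Collinear3 D b a c :=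
  let ⟨B, hB, ha, hb, hc⟩ := h
  ⟨B, hB, hb, ha, hc⟩

theorem IsSteinerSystem.exists_block (hD : IsSteinerSystem 2 5 v D) {a b : V} (hab : a ≠ b) :
    ∃ B ∈ D, a ∈ B ∧ b ∈ B := by
  obtain ⟨B, ⟨hB, h⟩, -⟩ := hD.2.2 {a, b} (card_pair hab)
  exact ⟨B, hB, h (by simp), h (by simp)⟩

theorem IsSteinerSystem.block_unique (hD : IsSteinerSystem 2 5 v D) {a b : V} (hab : a ≠ b)
    {B C : Finset V} (hB : B ∈ D) (hC : C ∈ D) (haB : a ∈ B) (hbB : b ∈ B) (haC : a ∈ C)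
    (hbC : b ∈ C) : B = C := by
  have hsub : ∀ {E : Finset V}, a ∈ E → b ∈ E → {a, b} ⊆ E := by
    intro E ha hb x hx
    rw [mem_insert, mem_singleton] at hx
    rcases hx with rfl | rfl <;> assumption
  exact (hD.2.2 {a, b} (card_pair hab)).unique ⟨hB, hsub haB hbB⟩ ⟨hC, hsub haC hbC⟩

theorem IsSteinerSystem.collinear3_iff (hD : IsSteinerSystem 2 5 v D) {a b c : V} (hab : a ≠ b)
    {B : Finset V} (hB : B ∈ D) (ha : a ∈ B) (hb : b ∈ B) : Collinear3 D a b c ↔ c ∈ B := by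
  constructor
  · rintro ⟨C, hC, haC, hbC, hcC⟩
    rwa [hD.block_unique hab hB hC ha hb haC hbC]
  · intro hc
    exact ⟨B, hB, ha, hb, hc⟩

theorem IsSteinerSystem.line_eq (hD : IsSteinerSystem 2 5 v D) {a b : V} (hab : a ≠ b)
    {B : Finset V} (hB : B ∈ D) (ha : a ∈ B) (hb : b ∈ B) : line D a b = B := by
  ext c
  rw [mem_line, hD.collinear3_iff hab hB ha hb]

/-- Whether `q = (o, x, y, p)` is one of the quadruples that the hyperbolic frequency at `j`
counts. -/
def IsHyperbolic (D : Finset (Finset V)) (j : ℕ) (o x y p : V) : Prop :=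
  ¬ Collinear3 D o x y ∧ p ∈ line D x y ∧ p ≠ x ∧ p ≠ y ∧ missCount D o x y p = j

instance (j : ℕ) (o x y p : V) : Decidable (IsHyperbolic D j o x y p) := by
  unfold IsHyperbolic; infer_instance

/-- The number of the quadruples counted by the hyperbolic frequency at `j` that start with `o` and
a point of the block `A`. -/
def flagFrequency (D : Finset (Finset V)) (o : V) (A : Finset V) (j : ℕ) : ℕ :=
  #{q : V × V × V | q.1 ∈ A ∧ IsHyperbolic D j o q.1 q.2.1 q.2.2}

theorem IsSteinerSystem.ne_of_not_collinear3 [Nontrivial V] (hD : IsSteinerSystem 2 5 v D)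
    {o x y : V}
    (h : ¬ Collinear3 D o x y) : o ≠ x ∧ o ≠ y ∧ x ≠ y := by
  have hD1 : ∀ a b : V, ∃ B ∈ D, a ∈ B ∧ b ∈ B := by
    intro a b
    by_cases hab : a = b
    · subst hab
      obtain ⟨c, hc⟩ := exists_ne a
      obtain ⟨B, hB, -, ha⟩ := hD.exists_block hc
      exact ⟨B, hB, ha, ha⟩
    · exact hD.exists_block hab
  refine ⟨?_, ?_, ?_⟩
  · rintro rfl
    obtain ⟨B, hB, h1, h2⟩ := hD1 o y
    exact h ⟨B, hB, h1, h1, h2⟩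
  · rintro rfl
    obtain ⟨B, hB, h1, h2⟩ := hD1 o x
    exact h ⟨B, hB, h1, h2, h1⟩
  · rintro rfl
    obtain ⟨B, hB, h1, h2⟩ := hD1 o x
    exact h ⟨B, hB, h1, h2, h2⟩

theorem IsSteinerSystem.hyperbolicFrequency_eq [Nontrivial V] (hD : IsSteinerSystem 2 5 v D) :
    hyperbolicFrequency D j = ∑ o, ∑ A ∈ D with o ∈ A, flagFrequency D o A j := by
  have h1 : hyperbolicFrequency D j =
      #{q : V × V × V × V | IsHyperbolic D j q.1 q.2.1 q.2.2.1 q.2.2.2} := rfl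
  rw [h1, card_eq_sum_card_fiberwise (f := Prod.fst) (t := univ) (fun _ _ => by simp)]
  refine sum_congr rfl fun o _ => ?_
  have h2 : #{q ∈ ({q : V × V × V × V | IsHyperbolic D j q.1 q.2.1 q.2.2.1 q.2.2.2} : Finset _) |
      q.1 = o} = #{q : V × V × V | IsHyperbolic D j o q.1 q.2.1 q.2.2} := by
    refine card_bij' (fun q _ => q.2) (fun q _ => (o, q)) ?_ ?_ ?_ ?_
    · intro q hq
      simp only [mem_filter, mem_univ, true_and] at hq ⊢
      obtain ⟨h, rfl⟩ := hq
      exact h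
    · intro q hq
      simp only [mem_filter, mem_univ, true_and] at hq ⊢
      exact ⟨hq, trivial⟩
    · rintro ⟨_, q⟩ hq
      simp only [mem_filter, mem_univ, true_and] at hq
      rw [hq.2]
    · intro q _; rfl
  rw [h2, card_eq_sum_card_fiberwise (f := fun q => line D o q.1) (t := {A ∈ D | o ∈ A})]
  · refine sum_congr rfl fun A hA => ?_
    obtain ⟨hA, hoA⟩ := mem_filter.1 hA
    unfold flagFrequency
    congr 1
    ext q
    simp only [mem_filter, mem_univ, true_and]
    constructor
    · rintro ⟨h, rfl⟩
      have hne := (hD.ne_of_not_collinear3 h.1).1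
      obtain ⟨B, hB, h3, h4⟩ := hD.exists_block hne
      rw [hD.line_eq hne hB h3 h4]
      exact ⟨h4, h⟩
    · rintro ⟨hx, h⟩
      exact ⟨h, hD.line_eq (hD.ne_of_not_collinear3 h.1).1 hA hoA hx⟩
  · intro q hq
    simp only [coe_filter, mem_univ, true_and, Set.mem_ofPred_eq] at hq ⊢
    have hne := (hD.ne_of_not_collinear3 hq.1).1
    obtain ⟨B, hB, h3, h4⟩ := hD.exists_block hne
    rw [hD.line_eq hne hB h3 h4]
    exact ⟨hB, h3⟩

/-- The number of points `u` other than `o` of the line `B` such that the line `pu` meets the line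
`A` in a point other than `o`, for points `p` outside `A` and `B`. -/
def meetCount (D : Finset (Finset V)) (o : V) (A B : Finset V) (p : V) : ℕ :=
  #{u ∈ B.erase o | ∃ a ∈ A.erase o, p ∈ line D a u ∧ p ≠ a ∧ p ≠ u}

/-- A point of a line that meets the lines `A` and `B` through `o` in points other than `o`. -/
theorem IsSteinerSystem.notMem_of_mem_line (hD : IsSteinerSystem 2 5 v D) {o : V} {A B : Finset V}
    (hA : A ∈ D) (hB : B ∈ D) (hoA : o ∈ A) (hoB : o ∈ B) (hAB : A ≠ B) {x y p : V}
    (hx : x ∈ A.erase o) (hy : y ∈ B.erase o) (hp : p ∈ line D x y) (hpx : p ≠ x) : p ∉ A := by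
  intro hpA
  obtain ⟨C, hC, hxC, hyC, hpC⟩ := mem_line.1 hp
  obtain ⟨hxo, hxA⟩ := mem_erase.1 hx
  obtain ⟨hyo, hyB⟩ := mem_erase.1 hy
  have hAC := hD.block_unique hpx.symm hA hC hxA hpA hxC hpC
  exact hAB (hD.block_unique hyo hA hB (hAC ▸ hyC) hoA hyB hoB)

theorem mem_line_comm {a b p : V} : p ∈ line D a b ↔ p ∈ line D b a := by
  rw [mem_line, mem_line]
  exact ⟨Collinear3.swap, Collinear3.swap⟩

/-- A point `u` of `oy` other than `o` either is counted by `meetCount` or has a line `pu` that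
misses `ox`, and `u = o` has the point `o` in common with `ox`. -/
theorem IsSteinerSystem.missCount_add_meetCount (hD : IsSteinerSystem 2 5 v D) {o : V}
    {A B : Finset V} (hA : A ∈ D) (hB : B ∈ D) (hoA : o ∈ A) (hoB : o ∈ B) (hAB : A ≠ B) {x y p : V}
    (hx : x ∈ A.erase o) (hy : y ∈ B.erase o) (hp : p ∈ line D x y) (hpx : p ≠ x) (hpy : p ≠ y) :
    meetCount D o A B p + missCount D o x y p = 4 := by
  have hpA := hD.notMem_of_mem_line hA hB hoA hoB hAB hx hy hp hpx
  have hpB := hD.notMem_of_mem_line hB hA hoB hoA hAB.symm hy hx (mem_line_comm.1 hp) hpy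
  obtain ⟨hxo, hxA⟩ := mem_erase.1 hx
  obtain ⟨hyo, hyB⟩ := mem_erase.1 hy
  have h1 : missCount D o x y p =
      #{u ∈ B.erase o | ¬ ∃ a ∈ A.erase o, p ∈ line D a u ∧ p ≠ a ∧ p ≠ u} := by
    unfold missCount
    rw [hD.line_eq hyo.symm hB hoB hyB, hD.line_eq hxo.symm hA hoA hxA]
    congr 1
    ext u
    rw [mem_filter, mem_filter, mem_erase]
    constructor
    · rintro ⟨hu, hd⟩
      rw [disjoint_left] at hd
      refine ⟨⟨?_, hu⟩, ?_⟩
      · rintro rfl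
        have hpo : p ≠ u := fun h => hpA (h ▸ hoA)
        obtain ⟨C, hC, h2, h3⟩ := hD.exists_block hpo
        exact hd (mem_line.2 ⟨C, hC, h2, h3, h3⟩) hoA
      · rintro ⟨a, ha, hpa, -, -⟩
        exact hd (mem_line.2 (mem_line.1 hpa).rotate.swap.rotate.swap.rotate.swap)
          (mem_erase.1 ha).2
    · rintro ⟨⟨huo, hu⟩, hn⟩
      refine ⟨hu, disjoint_left.2 fun w hw hwA => ?_⟩
      obtain ⟨C, hC, hpC, huC, hwC⟩ := mem_line.1 hw
      by_cases hwo : w = o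
      · subst hwo
        exact hpB (hD.block_unique huo hB hC hu hoB huC hwC ▸ hpC)
      · exact hn ⟨w, mem_erase.2 ⟨hwo, hwA⟩, mem_line.2 ⟨C, hC, hwC, huC, hpC⟩,
          fun h => hpA (h ▸ hwA), fun h => hpB (h ▸ hu)⟩
  rw [h1, meetCount, card_filter_add_card_filter_not, card_erase_of_mem hoB, hD.2.1 B hB]

/-- A quadruple `(o, x, y, p)` with `x` in `A` is determined by `p`, the line `B` through `o` and
`y`, and the point `y`; for given `p` and `B` the number of choices of `y` is `meetCount`. -/
theorem IsSteinerSystem.flagFrequency_eq [Nontrivial V] (hD : IsSteinerSystem 2 5 v D) {o : V}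
    {A : Finset V} (hA : A ∈ D) (hoA : o ∈ A) : flagFrequency D o A j =
      ∑ B ∈ D with o ∈ B ∧ B ≠ A, ∑ p with meetCount D o A B p + j = 4, meetCount D o A B p := by
  unfold flagFrequency
  rw [card_eq_sum_card_fiberwise (f := fun q => line D o q.2.1) (t := {B ∈ D | o ∈ B ∧ B ≠ A})]
  · refine sum_congr rfl fun B hB => ?_
    obtain ⟨hB, hoB, hBA⟩ := mem_filter.1 hB
    have hs : ∑ p with meetCount D o A B p + j = 4, meetCount D o A B p =
        #(({p | meetCount D o A B p + j = 4} : Finset V).sigma fun p =>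
          {u ∈ B.erase o | ∃ a ∈ A.erase o, p ∈ line D a u ∧ p ≠ a ∧ p ≠ u}) :=
      (card_sigma _ _).symm
    rw [hs]
    refine card_bij (fun q _ => ⟨q.2.2, q.2.1⟩) ?_ ?_ ?_
    · rintro ⟨x, y, p⟩ hq
      simp only [mem_filter, mem_univ, true_and] at hq
      obtain ⟨⟨hx, hc, hp, hpx, hpy, hm⟩, hl⟩ := hq
      obtain ⟨hox, hoy, -⟩ := hD.ne_of_not_collinear3 hc
      have hyB : y ∈ B := by
        obtain ⟨C, hC, h1, h2⟩ := hD.exists_block hoy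
        rw [hD.line_eq hoy hC h1 h2] at hl
        exact hl ▸ h2
      have hx' := mem_erase.2 ⟨hox.symm, hx⟩
      have hy' := mem_erase.2 ⟨hoy.symm, hyB⟩
      have h1 := hD.missCount_add_meetCount hA hB hoA hoB hBA.symm hx' hy' hp hpx hpy
      rw [hm] at h1
      rw [mem_sigma, mem_filter, mem_filter]
      exact ⟨⟨mem_univ _, h1⟩, hy', x, hx', hp, hpx, hpy⟩
    · rintro ⟨x, y, p⟩ hq ⟨x', y', p'⟩ hq' h
      simp only [mem_filter, mem_univ, true_and] at hq hq'
      simp only [Sigma.mk.injEq, heq_eq_eq] at h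
      obtain ⟨rfl, rfl⟩ := h
      obtain ⟨⟨hx, hc, hp, hpx, hpy, hm⟩, hl⟩ := hq
      obtain ⟨⟨hx', hc', hp', hpx', hpy', hm'⟩, hl'⟩ := hq'
      obtain ⟨hox, hoy, -⟩ := hD.ne_of_not_collinear3 hc
      congr 1
      by_contra hne
      obtain ⟨C, hC, h1, h2, h3⟩ := mem_line.1 hp
      obtain ⟨C', hC', h1', h2', h3'⟩ := mem_line.1 hp'
      have hCC := hD.block_unique hpy hC hC' h3 h2 h3' h2'
      subst hCC
      have hCA := hD.block_unique hne hC hA h1 h1' hx hx'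
      exact hc ⟨A, hA, hoA, hx, hCA ▸ h2⟩
    · rintro ⟨p, y⟩ hq
      rw [mem_sigma, mem_filter, mem_filter] at hq
      obtain ⟨⟨-, hm⟩, hy', x, hx', hp, hpx, hpy⟩ := hq
      obtain ⟨hxo, hx⟩ := mem_erase.1 hx'
      obtain ⟨hyo, hy⟩ := mem_erase.1 hy'
      refine ⟨(x, y, p), ?_, rfl⟩
      simp only [mem_filter, mem_univ, true_and]
      have h1 := hD.missCount_add_meetCount hA hB hoA hoB hBA.symm hx' hy' hp hpx hpy
      refine ⟨⟨hx, ?_, hp, hpx, hpy, ?_⟩, hD.line_eq hyo.symm hB hoB hy⟩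
      · rintro hc
        rw [hD.collinear3_iff hxo.symm hA hoA hx] at hc
        exact hBA (hD.block_unique hyo hB hA hy hoB hc hoA)
      · change meetCount D o A B p + j = 4 at hm
        change meetCount D o A B p + missCount D o x y p = 4 at h1
        omega
  · rintro ⟨x, y, p⟩ hq
    simp only [coe_filter, mem_univ, true_and, Set.mem_ofPred_eq] at hq ⊢
    obtain ⟨hx, hc, -⟩ := hq
    obtain ⟨hox, hoy, -⟩ := hD.ne_of_not_collinear3 hc
    obtain ⟨C, hC, h1, h2⟩ := hD.exists_block hoy
    rw [hD.line_eq hoy hC h1 h2]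
    refine ⟨hC, h1, ?_⟩
    rintro rfl
    exact hc ⟨C, hC, h1, hx, h2⟩

/-! ### Invariance under isomorphisms -/

variable {W : Type*} [Fintype W] [DecidableEq W]

theorem collinear3_image {V W : Type*} [DecidableEq W] (e : V ≃ W) (D : Finset (Finset V))
    (a b c : V) :
    Collinear3 (D.image fun B => B.image e) (e a) (e b) (e c) ↔ Collinear3 D a b c := by
  have hm : ∀ (B : Finset V) x, e x ∈ B.image e ↔ x ∈ B := fun B x => by simp
  constructor
  · rintro ⟨C, hC, h⟩
    obtain ⟨B, hB, rfl⟩ := mem_image.1 hC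
    rw [hm, hm, hm] at h
    exact ⟨B, hB, h⟩
  · rintro ⟨B, hB, h⟩
    exact ⟨_, mem_image_of_mem _ hB, by rwa [hm, hm, hm]⟩

theorem missCount_image (e : V ≃ W) (D : Finset (Finset V)) (o x y p : V) :
    missCount (D.image fun B => B.image e) (e o) (e x) (e y) (e p) = missCount D o x y p := by
  have hline : ∀ a b, line (D.image fun B => B.image e) (e a) (e b) = (line D a b).image e := by
    intro a b
    ext w
    obtain ⟨c, rfl⟩ := e.surjective w
    rw [mem_line, collinear3_image]
    simp [mem_line]
  unfold missCount
  symm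
  refine card_bij (fun u _ => e u) ?_ (fun _ _ _ _ h => e.injective h) ?_
  · intro u hu
    rw [mem_filter] at hu ⊢
    rw [hline, hline, hline, disjoint_image e.injective]
    exact ⟨mem_image_of_mem _ hu.1, hu.2⟩
  · intro w hw
    obtain ⟨u, rfl⟩ := e.surjective w
    rw [mem_filter, hline, hline, hline, disjoint_image e.injective] at hw
    refine ⟨u, mem_filter.2 ⟨?_, hw.2⟩, rfl⟩
    simpa using hw.1

theorem isHyperbolic_image (e : V ≃ W) (D : Finset (Finset V)) (o x y p : V) :
    IsHyperbolic (D.image fun B => B.image e) j (e o) (e x) (e y) (e p) ↔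
      IsHyperbolic D j o x y p := by
  unfold IsHyperbolic
  rw [collinear3_image, mem_line, collinear3_image, missCount_image, mem_line,
    e.injective.ne_iff, e.injective.ne_iff]

theorem flagFrequency_image (e : V ≃ W) (D : Finset (Finset V)) (o : V) (A : Finset V) :
    flagFrequency (D.image fun B => B.image e) (e o) (A.image e) j = flagFrequency D o A j := by
  unfold flagFrequency
  symm
  refine card_equiv (e.prodCongr (e.prodCongr e)) fun q => ?_
  simp only [mem_filter, mem_univ, true_and, Equiv.prodCongr_apply, Prod.map_fst, Prod.map_snd,
    isHyperbolic_image]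
  simp

theorem hyperbolicFrequency_image (e : V ≃ W) (D : Finset (Finset V)) :
    hyperbolicFrequency (D.image fun B => B.image e) j = hyperbolicFrequency D j := by
  symm
  refine card_equiv (e.prodCongr (e.prodCongr (e.prodCongr e))) fun q => ?_
  simp only [mem_filter, mem_univ, true_and, Equiv.prodCongr_apply, Prod.map_fst, Prod.map_snd]
  exact (isHyperbolic_image e D _ _ _ _).symm

end Design

/-! ### Computation of the hyperbolic frequencies -/

/-- The bit set of the points other than `0` and `z - y` of the translate by `-y` of the block `l`,
extended by `ext`. -/
noncomputable def thirdMask (l : List ℕ) (y z : ℕ) : ℕ :=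
  ext (maskAt y (l.filter fun p => Bool.rec (Bool.rec true false (Nat.beq p z)) false
    (Nat.beq p y)))

/-- For each difference `z - y` of two points of a block, the set `thirdMask`, in fields of `324`
bits. -/
noncomputable def lineTable (L : List (List ℕ)) : ℕ :=
  List.rec 0 (fun l _ ih => List.rec ih (fun y _ ih => List.rec ih (fun z _ ih =>
    Bool.rec (force (Nat.mul 324 (norm (Nat.sub (Nat.add 165 z) y))) fun o =>
      force (thirdMask l y z) fun e =>
      Nat.lor ih (Nat.lor (Nat.shiftLeft e o) (Nat.shiftLeft e (Nat.add o 972)))) ih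
      (Nat.beq z y)) l) l) L

/-- Looks up the number `r`, read as the code of a difference, in the table `T`, where
`M = 2 ^ 324`. -/
def lineTab (T M r : ℕ) : ℕ :=
  Nat.mod (Nat.shiftRight T (Nat.mul 324 (Nat.mod r 162))) M

/-- Whether the table `T` is correct. -/
noncomputable def tableCheck (T M : ℕ) (L : List (List ℕ)) : Bool :=
  L.all fun l => l.all fun y => l.all fun z =>
    Bool.rec (force (norm (Nat.sub (Nat.add 165 z) y)) fun d => force (thirdMask l y z) fun e =>
      Bool.rec false (Nat.beq (lineTab T M (Nat.add d 3)) e) (Nat.beq (lineTab T M d) e)) true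
      (Nat.beq z y)

/-- The bit set, on codes of points, of the points `p` other than `a` and `u` on a line `au`, where
`a` is in the list `A`. -/
noncomputable def meetMask (T M : ℕ) (A : List ℕ) (u : ℕ) : ℕ :=
  List.rec 0 (fun a _ ih => Nat.lor ih
    (Nat.shiftRight (lineTab T M (Nat.sub (Nat.add 165 u) a)) (Nat.sub 165 a))) A

/-- The numbers of points that are in one, two, three or four of the bit sets, multiplied by
one, two, three or four, in fields of `20` bits. The sets are added as binary numbers: `c` and `d`
are the carries of the first and of the second pair, and `s₀`, `s₁` and the intersection of `c` and
`d` are the three bits of the sum. -/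
noncomputable def histogram (m₁ m₂ m₃ m₄ : ℕ) : ℕ :=
  force (Nat.xor m₁ m₂) fun x => force (Nat.land m₁ m₂) fun c =>
  force (Nat.xor m₃ m₄) fun y => force (Nat.land m₃ m₄) fun d =>
  force (Nat.xor x y) fun s₀ => force (Nat.xor (Nat.xor c d) (Nat.land x y)) fun s₁ =>
  force (Nat.land s₀ s₁) fun s₃ =>
  Nat.add (count63 (Nat.xor s₀ s₃)) (Nat.add (Nat.mul 0x200000 (count63 (Nat.xor s₁ s₃)))
    (Nat.add (Nat.mul 0x30000000000 (count63 s₃))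
      (Nat.mul 0x4000000000000000 (count63 (Nat.land c d)))))

/-- The histogram of `meetCount` for the lines through `0` with the other points `A` and `B`. -/
noncomputable def pairHistogram (T M : ℕ) (A : List ℕ) : List ℕ → ℕ
  | [b₁, b₂, b₃, b₄] => force (meetMask T M A b₁) fun m₁ => force (meetMask T M A b₂) fun m₂ =>
    force (meetMask T M A b₃) fun m₃ => force (meetMask T M A b₄) fun m₄ => histogram m₁ m₂ m₃ m₄
  | _ => 0

/-- The sum of the values of `f` on a list. -/
noncomputable def listSum (f : List ℕ → ℕ) (S : List (List ℕ)) : ℕ :=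
  List.rec 0 (fun B _ ih => Nat.add ih (f B)) S

/-- The flag frequencies of the line through `0` with the other points `A`, in fields of `20` bits,
where `S` consists of all lines through `0`. The lines other than `A` are told from `A` by their
first points. -/
noncomputable def flagCode (T M : ℕ) (S : List (List ℕ)) (A : List ℕ) : ℕ :=
  listSum (fun B => Bool.rec (pairHistogram T M A B) 0 (Nat.beq A.headI B.headI)) S

/-- Pairs of a block and one of its points. -/
def pointed (L : List (List ℕ)) : List (List ℕ × ℕ) := L.flatMap fun l => l.map fun y => (l, y)

/-- The differences of the other points of a block and a given point. -/
def star (x : List ℕ × ℕ) : List ℕ :=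
  (x.1.filter fun z => !Nat.beq z x.2).map fun z => norm (Nat.sub (Nat.add 165 z) x.2)

/-- Goes on with the table and the list of lines through `0`, if the table is correct. -/
noncomputable def withLines (L : List (List ℕ)) (k : ℕ → ℕ → List (List ℕ) → Bool) : Bool :=
  forceLists L fun L => force (lineTable L) fun T => force (Nat.pow 2 324) fun M =>
  Bool.rec false (forceLists ((pointed L).map star) (k T M)) (tableCheck T M L)

/-- Compares the hyperbolic frequencies with the numbers in `f`. -/
noncomputable def frequencyCheck (L : List (List ℕ)) (f : List ℕ) : Bool :=
  withLines L fun T M S => force (listSum (flagCode T M S) S) fun g =>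
    allUpTo (fun j => Nat.beq (Nat.mul 81 (Nat.mod (Nat.shiftRight g (Nat.mul 20 (Nat.sub 3 j)))
      1048576)) (f.getD j 0)) 4

/-- Whether the lines through `0` are distinct. -/
noncomputable def linesCheck (L : List (List ℕ)) : Bool :=
  forceList ((pointed L).map fun x => maskAt x.2 x.1) fun m => decide m.Nodup

theorem linesCheck_codes : ∀ i, linesCheck (codes i) = true := by decide +kernel

/-! ### Bit counts -/

theorem land_sum_two_pow (A : Finset ℕ) (x : ℕ) :
    x &&& ∑ a ∈ A, 2 ^ a = ∑ a ∈ A with x.testBit a = true, 2 ^ a := by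
  refine Nat.eq_of_testBit_eq fun i => Bool.eq_iff_iff.2 ?_
  rw [Nat.testBit_and, Bool.and_eq_true, testBit_sum_two_pow, testBit_sum_two_pow, mem_filter,
    and_comm]

theorem land_mod63 (x : ℕ) : Nat.land x 0x1041041041041041041041041041041041041041 % 63 =
    #{t ∈ range 27 | x.testBit (6 * t) = true} % 63 := by
  have e : 0x1041041041041041041041041041041041041041 =
      ∑ a ∈ (range 27).image (6 * ·), 2 ^ a := by decide +kernel
  have h : Nat.land x 0x1041041041041041041041041041041041041041 =
      ∑ t ∈ range 27 with x.testBit (6 * t) = true, 2 ^ (6 * t) := by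
    have h1 := land_sum_two_pow ((range 27).image (6 * ·)) x
    rw [← e, filter_image, sum_image (fun a _ b _ h => Nat.eq_of_mul_eq_mul_left (by norm_num) h)]
      at h1
    exact h1
  rw [h, ← Nat.ModEq, ← ZMod.natCast_eq_natCast_iff]
  push_cast
  have h64 : (2 : ZMod 63) ^ 6 = 1 := by decide
  simp only [pow_mul, h64, one_pow, sum_const, nsmul_eq_mul, mul_one]

theorem count63_eq (x : ℕ) : count63 x = #{q : Pt | x.testBit (cd q) = true} % 63 := by
  have hshift : ∀ u, #{t ∈ range 27 | (Nat.shiftRight x u).testBit (6 * t) = true} =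
      #{t ∈ range 27 | x.testBit (6 * t + u) = true} := by
    intro u
    congr 1
    refine filter_congr fun t _ => ?_
    have e : Nat.shiftRight x u = x >>> u := rfl
    rw [e, Nat.testBit_shiftRight, add_comm]
  have hcard : #{q : Pt | x.testBit (cd q) = true} =
      #{t ∈ range 27 | x.testBit (6 * t) = true} +
      (#{t ∈ range 27 | x.testBit (6 * t + 1) = true} +
        #{t ∈ range 27 | x.testBit (6 * t + 2) = true}) := by
    have hu : ∀ u : ZMod 3, #{q ∈ ({q : Pt | x.testBit (cd q) = true} : Finset Pt) | q.1 = u} =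
        #{t ∈ range 27 | x.testBit (6 * t + u.val) = true} := by
      intro u
      refine card_bij' (fun q _ => q.2.val) (fun t _ => (u, (t : ZMod 27))) ?_ ?_ ?_ ?_
      · intro q hq
        simp only [mem_filter, mem_univ, true_and] at hq
        obtain ⟨hq, rfl⟩ := hq
        exact mem_filter.2 ⟨mem_range.2 (ZMod.val_lt _), hq⟩
      · intro t ht
        obtain ⟨ht, hx⟩ := mem_filter.1 ht
        simp only [mem_filter, mem_univ, true_and, and_true]
        rwa [cd, ZMod.val_cast_of_lt (mem_range.1 ht)]
      · rintro ⟨a, b⟩ hq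
        simp only [mem_filter, mem_univ, true_and] at hq
        rw [← hq.2]
        simp
      · intro t ht
        exact ZMod.val_cast_of_lt (mem_range.1 (mem_filter.1 ht).1)
    rw [card_eq_sum_card_fiberwise (f := Prod.fst) (t := univ) (fun _ _ => by simp)]
    simp only [hu]
    rw [show (univ : Finset (ZMod 3)) = {0, 1, 2} from rfl]
    rw [sum_insert (by decide), sum_insert (by decide), sum_singleton]
    rfl
  have h0 := land_mod63 x
  have h1 := land_mod63 (Nat.shiftRight x 1)
  have h2 := land_mod63 (Nat.shiftRight x 2)
  rw [hshift] at h1 h2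
  have e : count63 x = (Nat.land x 0x1041041041041041041041041041041041041041 +
    (Nat.land (Nat.shiftRight x 1) 0x1041041041041041041041041041041041041041 +
      Nat.land (Nat.shiftRight x 2) 0x1041041041041041041041041041041041041041)) % 63 := rfl
  rw [e, hcard]
  omega

/-- The bound `48` ensures that the counts modulo `63` are exact. -/
theorem histogram_eq {m₁ m₂ m₃ m₄ : ℕ} {N : Pt → ℕ}
    (hN : ∀ q, N q = (m₁.testBit (cd q)).toNat + (m₂.testBit (cd q)).toNat +
      (m₃.testBit (cd q)).toNat + (m₄.testBit (cd q)).toNat) (hle : ∑ q, N q ≤ 48) :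
    histogram m₁ m₂ m₃ m₄ = (∑ q with N q + 3 = 4, N q) + 2 ^ 20 * (∑ q with N q + 2 = 4, N q) +
      2 ^ 40 * (∑ q with N q + 1 = 4, N q) + 2 ^ 60 * ∑ q with N q + 0 = 4, N q := by
  have hcount : ∀ x k j, k + j = 4 → 0 < k → (∀ q, x.testBit (cd q) = true ↔ N q = k) →
      k * count63 x = ∑ q with N q + j = 4, N q := by
    intro x k j hkj hk hx
    have h1 : ∑ q with N q + j = 4, N q = k * #{q : Pt | x.testBit (cd q) = true} := by
      rw [sum_congr (s₂ := ({q : Pt | x.testBit (cd q) = true} : Finset Pt)) (g := fun _ => k)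
        ?_ ?_, sum_const, smul_eq_mul, mul_comm]
      · refine filter_congr fun q _ => ?_
        rw [hx]; omega
      · intro q hq
        exact (hx q).1 (mem_filter.1 hq).2
    have h2 : ∑ q with N q + j = 4, N q ≤ 48 :=
      (sum_le_sum_of_subset (filter_subset _ _)).trans hle
    have h3 : #{q : Pt | x.testBit (cd q) = true} ≤ 48 := by
      rw [h1] at h2
      exact (Nat.le_mul_of_pos_left _ hk).trans h2
    rw [count63_eq, Nat.mod_eq_of_lt (by omega), h1]
  set c := m₁ &&& m₂ with hc
  set x := m₁ ^^^ m₂ with hx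
  set d := m₃ &&& m₄ with hd
  set y := m₃ ^^^ m₄ with hy
  set s₀ := x ^^^ y with hs₀
  set s₁ := (c ^^^ d) ^^^ (x &&& y) with hs₁
  set s₃ := s₀ &&& s₁ with hs₃
  have e : histogram m₁ m₂ m₃ m₄ = count63 (s₀ ^^^ s₃) + (0x200000 * count63 (s₁ ^^^ s₃) +
      (0x30000000000 * count63 s₃ + 0x4000000000000000 * count63 (c &&& d))) := by
    unfold histogram
    simp only [force_eq]
    rfl
  have h1 := hcount (s₀ ^^^ s₃) 1 3 rfl one_pos fun q => by
    rw [hN q, hs₃, hs₁, hs₀, hx, hy, hc, hd]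
    simp only [Nat.testBit_xor, Nat.testBit_and]
    cases m₁.testBit (cd q) <;> cases m₂.testBit (cd q) <;> cases m₃.testBit (cd q) <;>
      cases m₄.testBit (cd q) <;> decide
  have h2 := hcount (s₁ ^^^ s₃) 2 2 rfl two_pos fun q => by
    rw [hN q, hs₃, hs₁, hs₀, hx, hy, hc, hd]
    simp only [Nat.testBit_xor, Nat.testBit_and]
    cases m₁.testBit (cd q) <;> cases m₂.testBit (cd q) <;> cases m₃.testBit (cd q) <;>
      cases m₄.testBit (cd q) <;> decide
  have h3 := hcount s₃ 3 1 rfl three_pos fun q => by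
    rw [hN q, hs₃, hs₁, hs₀, hx, hy, hc, hd]
    simp only [Nat.testBit_xor, Nat.testBit_and]
    cases m₁.testBit (cd q) <;> cases m₂.testBit (cd q) <;> cases m₃.testBit (cd q) <;>
      cases m₄.testBit (cd q) <;> decide
  have h4 := hcount (c &&& d) 4 0 rfl four_pos fun q => by
    rw [hN q, hc, hd]
    simp only [Nat.testBit_and]
    cases m₁.testBit (cd q) <;> cases m₂.testBit (cd q) <;> cases m₃.testBit (cd q) <;>
      cases m₄.testBit (cd q) <;> decide
  rw [e, ← h1, ← h2, ← h3, ← h4]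
  ring

/-! ### Lines through the origin -/

theorem testBit_ext_iff {D : Finset Pt} {r : ℕ} (hr : r < 324) :
    (ext (maskOf D)).testBit r = true ↔ pt r ∈ D := by
  refine ⟨fun h => ?_, testBit_ext hr⟩
  have e : ext (maskOf D) = (maskOf D ||| maskOf D <<< 3) |||
      (maskOf D ||| maskOf D <<< 3) <<< 162 := by
    unfold ext; rw [force_eq]; rfl
  rw [e] at h
  simp only [Nat.testBit_or, Nat.testBit_shiftLeft, Bool.or_eq_true, Bool.and_eq_true,
    decide_eq_true_eq, ge_iff_le, testBit_maskOf] at h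
  have key : ∀ d ∈ D, (cd d = r ∨ cd d + 3 = r ∨ cd d + 162 = r ∨ cd d + 165 = r) → pt r ∈ D := by
    intro d hd h
    have h1 := cd_mod d
    have h2 := cd_lt d
    have e2 : norm r = 6 * ((r % 162) / 6) + r % 3 := rfl
    have h3 : cd (pt r) = cd d := by rw [cd_pt, e2]; omega
    rw [cd_inj] at h3
    rwa [h3]
  rcases h with (⟨d, hd, h⟩ | ⟨h1, d, hd, h⟩) | ⟨h1, ⟨d, hd, h⟩ | ⟨h2, d, hd, h⟩⟩
  · exact key d hd (by omega)
  · exact key d hd (by omega)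
  · exact key d hd (by omega)
  · exact key d hd (by omega)

/-- The table `T` describes the lines of the design `D`: shifting the entry for `u - a` by `165 - cd
a` turns the bit set of the differences `q - a` into that of the points `q`. -/
def IsLineTable (T M : ℕ) (D : Finset (Finset Pt)) : Prop :=
  ∀ a u : Pt, a ≠ u → ∀ q, (Nat.shiftRight (lineTab T M (Nat.sub (Nat.add 165 (cd u)) (cd a)))
    (Nat.sub 165 (cd a))).testBit (cd q) = true ↔ q ∈ line D a u ∧ q ≠ a ∧ q ≠ u

theorem thirdMask_eq (P : List Pt) (y z : Pt) : thirdMask (P.map cd) (cd y) (cd z) =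
    ext (maskOf (translate (-y) ((P.toFinset.erase y).erase z))) := by
  unfold thirdMask
  have hb : ∀ p x : Pt, Nat.beq (cd p) (cd x) = decide (p = x) := by
    intro p x
    rw [Bool.eq_iff_iff, decide_eq_true_eq]
    exact ⟨fun h => cd_injective (Nat.eq_of_beq_eq_true h), fun h => h ▸ Nat.beq_refl _⟩
  have h1 : (P.map cd).filter (fun p => Bool.rec (Bool.rec true false (Nat.beq p (cd z))) false
      (Nat.beq p (cd y))) = (P.filter fun p => p ≠ y ∧ p ≠ z).map cd := by
    rw [List.filter_map]
    congr 1
    refine List.filter_congr fun p _ => ?_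
    rw [Function.comp_apply, hb, hb]
    by_cases h : p = y
    · simp [h]
    · rw [decide_eq_false h]
      by_cases h' : p = z
      · rw [decide_eq_true h', decide_eq_false fun hh => hh.2 h']
      · rw [decide_eq_false h', decide_eq_true ⟨h, h'⟩]
  rw [h1, maskAt_eq]
  congr 3
  ext x
  simp only [List.mem_toFinset, List.mem_filter, mem_erase, decide_eq_true_eq]
  exact ⟨fun h => ⟨h.2.2, h.2.1, h.1⟩, fun h => ⟨h.2.2, h.2.1, h.1⟩⟩

theorem isLineTable_of_tableCheck {T M : ℕ} {i : Fin 72}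
    (h : tableCheck T M (codes i) = true) : IsLineTable T M (development (listed i)) := by
  intro a u hau q
  have hD := (decomposes_listed i).isSteinerSystem
  obtain ⟨C, hC, haC, huC⟩ := hD.exists_block hau
  obtain ⟨B, hB, g, rfl⟩ := mem_development.1 hC
  obtain ⟨l, hl, rfl⟩ := mem_listed.1 hB
  obtain ⟨P, rfl, hP, -⟩ := (isBlockCode_codes i l hl).exists_points
  rw [hP] at hC haC huC
  have hmem : ∀ x, x ∈ translate g P.toFinset → cd (x - g) ∈ P.map cd := by
    intro x hx
    rw [mem_translate, List.mem_toFinset] at hx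
    exact List.mem_map_of_mem hx
  unfold tableCheck at h
  rw [List.all_eq_true] at h
  have h1 := List.all_eq_true.1 (h _ hl) _ (hmem a haC)
  have h2 := List.all_eq_true.1 h1 _ (hmem u huC)
  have hne : Nat.beq (cd (u - g)) (cd (a - g)) = false := by
    cases hb : Nat.beq (cd (u - g)) (cd (a - g)) with
    | false => rfl
    | true =>
      have := cd_injective (Nat.eq_of_beq_eq_true hb)
      exact absurd (sub_left_injective this).symm hau
  rw [hne, force_eq, force_eq, norm_sub, sub_sub_sub_cancel_right, thirdMask_eq] at h2
  set S := translate (-(a - g)) ((P.toFinset.erase (a - g)).erase (u - g)) with hS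
  cases h3 : Nat.beq (lineTab T M (cd (u - a))) (ext (maskOf S)) with
  | false => rw [h3] at h2; exact absurd h2 (by simp)
  | true =>
  rw [h3] at h2
  have h3 := Nat.eq_of_beq_eq_true h3
  have h4 : lineTab T M (cd (u - a) + 3) = ext (maskOf S) := Nat.eq_of_beq_eq_true h2
  have hmod : ∀ r s, r % 162 = s % 162 → lineTab T M r = lineTab T M s := by
    intro r s hrs
    have e : ∀ r, lineTab T M r = T >>> (324 * (r % 162)) % M := fun _ => rfl
    rw [e, e, hrs]
  have hnorm := norm_sub u a
  have e : norm (Nat.sub (Nat.add 165 (cd u)) (cd a)) =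
      6 * (((165 + cd u - cd a) % 162) / 6) + (165 + cd u - cd a) % 3 := rfl
  have e1 : Nat.sub (Nat.add 165 (cd u)) (cd a) = 165 + cd u - cd a := rfl
  have ha := cd_lt a
  have hq := cd_lt q
  have htab : lineTab T M (Nat.sub (Nat.add 165 (cd u)) (cd a)) = ext (maskOf S) := by
    rw [e] at hnorm
    rw [e1]
    have h5 : (165 + cd u - cd a) % 162 = cd (u - a) % 162 ∨
        (165 + cd u - cd a) % 162 = (cd (u - a) + 3) % 162 := by omega
    rcases h5 with h5 | h5
    · rw [hmod _ _ h5, h3]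
    · rw [hmod _ _ h5, h4]
  have e2 : Nat.shiftRight (ext (maskOf S)) (Nat.sub 165 (cd a)) =
    ext (maskOf S) >>> (165 - cd a) := rfl
  rw [htab, e2, Nat.testBit_shiftRight, show 165 - cd a + cd q = 165 + cd q - cd a by omega,
    testBit_ext_iff (by omega), pt_sub, hD.line_eq hau hC haC huC, hS, mem_translate, mem_erase,
    mem_erase, mem_translate, show q - a - -(a - g) = q - g by abel]
  rw [Ne, Ne, sub_left_inj, sub_left_inj]
  tauto

theorem testBit_meetMask {T M : ℕ} {D : Finset (Finset Pt)} (hT : IsLineTable T M D) {u : Pt}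
    (q : Pt) :
    ∀ A : List Pt, u ∉ A → ((meetMask T M (A.map cd) (cd u)).testBit (cd q) = true ↔
      ∃ a ∈ A, q ∈ line D a u ∧ q ≠ a ∧ q ≠ u)
  | [] => by simp [meetMask]
  | a :: A => by
    intro hu
    rw [List.mem_cons, not_or] at hu
    have ih := testBit_meetMask hT q A hu.2
    have e : meetMask T M ((a :: A).map cd) (cd u) = meetMask T M (A.map cd) (cd u) |||
      Nat.shiftRight (lineTab T M (Nat.sub (Nat.add 165 (cd u)) (cd a))) (Nat.sub 165 (cd a)) := rfl
    rw [e, Nat.testBit_or, Bool.or_eq_true, ih, hT a u (Ne.symm hu.1), List.exists_mem_cons_iff,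
      or_comm]

theorem IsSteinerSystem.sum_meetCount_le {D : Finset (Finset Pt)} (hD : IsSteinerSystem 2 5 81 D)
    {o : Pt} {A B : Finset Pt} (hA : A ∈ D) (hB : B ∈ D) (hoA : o ∈ A) (hoB : o ∈ B) (hAB : A ≠ B) :
    ∑ p, meetCount D o A B p ≤ 48 := by
  have h1 : ∀ p, meetCount D o A B p = ∑ u ∈ B.erase o,
      if ∃ a ∈ A.erase o, p ∈ line D a u ∧ p ≠ a ∧ p ≠ u then 1 else 0 := fun p =>
    card_filter _ _
  have hcA : #(A.erase o) = 4 := by rw [card_erase_of_mem hoA, hD.2.1 A hA]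
  have hcB : #(B.erase o) = 4 := by rw [card_erase_of_mem hoB, hD.2.1 B hB]
  simp only [h1]
  rw [sum_comm]
  have h2 : ∀ u ∈ B.erase o, (∑ p : Pt,
      if ∃ a ∈ A.erase o, p ∈ line D a u ∧ p ≠ a ∧ p ≠ u then 1 else 0) ≤ 12 := by
    intro u hu
    rw [← card_filter]
    have hsub : ({p : Pt | ∃ a ∈ A.erase o, p ∈ line D a u ∧ p ≠ a ∧ p ≠ u} : Finset Pt) ⊆
        (A.erase o).biUnion fun a => ((line D a u).erase a).erase u := by
      intro p hp
      obtain ⟨a, ha, h3, h4, h5⟩ := (mem_filter.1 hp).2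
      exact mem_biUnion.2 ⟨a, ha, mem_erase.2 ⟨h5, mem_erase.2 ⟨h4, h3⟩⟩⟩
    refine (card_le_card hsub).trans ((card_biUnion_le_card_mul _ _ 3 fun a ha => ?_).trans
      (by rw [hcA]))
    have hau : a ≠ u := by
      rintro rfl
      exact hAB (hD.block_unique (mem_erase.1 hu).1 hA hB (mem_erase.1 ha).2 hoA
        (mem_erase.1 hu).2 hoB)
    obtain ⟨C, hC, haC, huC⟩ := hD.exists_block hau
    rw [hD.line_eq hau hC haC huC, card_erase_of_mem (mem_erase.2 ⟨hau.symm, huC⟩),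
      card_erase_of_mem haC, hD.2.1 C hC]
  refine (sum_le_sum h2).trans ?_
  rw [sum_const, hcB]; rfl

theorem pairHistogram_eq {T M : ℕ} {D : Finset (Finset Pt)} (hT : IsLineTable T M D)
    (hD : IsSteinerSystem 2 5 81 D) {A B : Finset Pt} (hA : A ∈ D) (hB : B ∈ D)
    (hoA : (0 : Pt) ∈ A) (hoB : (0 : Pt) ∈ B) (hAB : A ≠ B) {P Q : List Pt}
    (hP : P.toFinset = A.erase 0) (hQ : Q.toFinset = B.erase 0) (hQn : Q.Nodup)
    (hQl : Q.length = 4) :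
    pairHistogram T M (P.map cd) (Q.map cd) =
      (∑ q with meetCount D 0 A B q + 3 = 4, meetCount D 0 A B q) +
      2 ^ 20 * (∑ q with meetCount D 0 A B q + 2 = 4, meetCount D 0 A B q) +
      2 ^ 40 * (∑ q with meetCount D 0 A B q + 1 = 4, meetCount D 0 A B q) +
      2 ^ 60 * ∑ q with meetCount D 0 A B q + 0 = 4, meetCount D 0 A B q := by
  obtain ⟨b₁, b₂, b₃, b₄, rfl⟩ : ∃ b₁ b₂ b₃ b₄, Q = [b₁, b₂, b₃, b₄] := by
    match Q, hQl with
    | [a, b, c, d], _ => exact ⟨a, b, c, d, rfl⟩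
  have e : pairHistogram T M (P.map cd) ([b₁, b₂, b₃, b₄].map cd) =
      histogram (meetMask T M (P.map cd) (cd b₁)) (meetMask T M (P.map cd) (cd b₂))
        (meetMask T M (P.map cd) (cd b₃)) (meetMask T M (P.map cd) (cd b₄)) := by
    simp only [List.map_cons, List.map_nil, pairHistogram, force_eq]
  rw [e]
  refine histogram_eq (fun q => ?_) (hD.sum_meetCount_le hA hB hoA hoB hAB)
  have hbit : ∀ u ∈ B.erase 0, ((meetMask T M (P.map cd) (cd u)).testBit (cd q)).toNat =
      if ∃ a ∈ A.erase 0, q ∈ line D a u ∧ q ≠ a ∧ q ≠ u then 1 else 0 := by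
    intro u hu
    have huP : u ∉ P := by
      intro huP
      rw [← List.mem_toFinset, hP] at huP
      exact hAB (hD.block_unique (mem_erase.1 hu).1 hA hB (mem_erase.1 huP).2 hoA
        (mem_erase.1 hu).2 hoB)
    have h1 := testBit_meetMask hT q P huP
    simp only [← List.mem_toFinset (l := P), hP] at h1
    by_cases h : ∃ a ∈ A.erase 0, q ∈ line D a u ∧ q ≠ a ∧ q ≠ u
    · rw [h1.2 h, if_pos h]; rfl
    · rw [if_neg h, Bool.eq_false_iff.2 (fun h' => h (h1.1 h'))]; rfl
  have hmem : ∀ u ∈ [b₁, b₂, b₃, b₄], u ∈ B.erase 0 := by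
    intro u hu
    rw [← hQ, List.mem_toFinset]; exact hu
  simp only [List.forall_mem_cons] at hmem
  obtain ⟨g₁, g₂, g₃, g₄, -⟩ := hmem
  rw [hbit _ g₁, hbit _ g₂, hbit _ g₃, hbit _ g₄, meetCount, card_filter, ← hQ,
    List.sum_toFinset _ hQn]
  simp only [List.map_cons, List.map_nil, List.sum_cons, List.sum_nil]
  ring

/-! ### Evaluation for the families in the table -/

/-- Whether the frequencies of the families with the indices `k + i`, where `i < n`, agree with
those of the table. -/
noncomputable def frequencyChecks (k n : ℕ) : Bool :=
  allUpTo (fun i => frequencyCheck (codes (Fin.ofNat 72 (Nat.add k i)))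
    (entry (Fin.ofNat 72 (Nat.add k i))).freq) n

theorem frequencyChecks_0 : frequencyChecks 0 12 = true := by decide +kernel

theorem frequencyChecks_12 : frequencyChecks 12 12 = true := by decide +kernel

theorem frequencyChecks_24 : frequencyChecks 24 12 = true := by decide +kernel

theorem frequencyChecks_36 : frequencyChecks 36 12 = true := by decide +kernel

theorem frequencyChecks_48 : frequencyChecks 48 12 = true := by decide +kernel

theorem frequencyChecks_60 : frequencyChecks 60 12 = true := by decide +kernel

theorem frequencyCheck_codes (i : Fin 72) : frequencyCheck (codes i) (entry i).freq = true := by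
  have h : ∀ k, frequencyChecks k 12 = true → k ≤ i.val → i.val < k + 12 →
      frequencyCheck (codes i) (entry i).freq = true := by
    intro k hk h1 h2
    have h3 := allUpTo_spec hk (i.val - k) (by omega)
    have e : Fin.ofNat 72 (Nat.add k (i.val - k)) = i := by
      have : Nat.add k (i.val - k) = i.val := by
        have : Nat.add k (i.val - k) = k + (i.val - k) := rfl
        omega
      rw [this]
      exact Fin.ext (Nat.mod_eq_of_lt i.isLt)
    rwa [e] at h3
  have hi := i.isLt
  rcases Nat.lt_or_ge i.val 12 with h0 | h0
  · exact h 0 frequencyChecks_0 (by omega) (by omega)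
  rcases Nat.lt_or_ge i.val 24 with h1 | h1
  · exact h 12 frequencyChecks_12 (by omega) (by omega)
  rcases Nat.lt_or_ge i.val 36 with h2 | h2
  · exact h 24 frequencyChecks_24 (by omega) (by omega)
  rcases Nat.lt_or_ge i.val 48 with h3 | h3
  · exact h 36 frequencyChecks_36 (by omega) (by omega)
  rcases Nat.lt_or_ge i.val 60 with h4 | h4
  · exact h 48 frequencyChecks_48 (by omega) (by omega)
  · exact h 60 frequencyChecks_60 (by omega) (by omega)

/-- Whether some line through `0` has the flag frequency `n` at `2`. -/
noncomputable def flagCheck (L : List (List ℕ)) (n : ℕ) : Bool :=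
  withLines L fun T M S => S.any fun A =>
    Nat.beq (Nat.mod (Nat.shiftRight (flagCode T M S A) 20) 1048576) n

/-- Whether no line through `0` has the flag frequency `n` at `2`. -/
noncomputable def noFlagCheck (L : List (List ℕ)) (n : ℕ) : Bool :=
  withLines L fun T M S => S.all fun A =>
    !Nat.beq (Nat.mod (Nat.shiftRight (flagCode T M S A) 20) 1048576) n

theorem flagCheck_35 : flagCheck (codes 35) 304 = true := by decide +kernel

theorem noFlagCheck_56 : noFlagCheck (codes 56) 304 = true := by decide +kernel

/-! ### The fingerprints in the table -/

theorem withLines_spec {L : List (List ℕ)} {k : ℕ → ℕ → List (List ℕ) → Bool}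
    (h : withLines L k = true) :
    ∃ T M, tableCheck T M L = true ∧ k T M ((pointed L).map star) = true := by
  unfold withLines at h
  rw [forceLists_eq, force_eq, force_eq] at h
  refine ⟨lineTable L, Nat.pow 2 324, ?_⟩
  generalize lineTable L = T at *
  generalize Nat.pow 2 324 = M at *
  cases ht : tableCheck T M L with
  | false => rw [ht] at h; exact absurd h (by simp)
  | true =>
    rw [ht, forceLists_eq] at h
    exact ⟨rfl, h⟩

theorem listSum_eq (f : List ℕ → ℕ) (S : List (List ℕ)) : listSum f S = (S.map f).sum := by
  induction S with
  | nil => rfl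
  | cons B S ih =>
    have e : listSum f (B :: S) = listSum f S + f B := rfl
    rw [e, ih, List.map_cons, List.sum_cons, add_comm]

/-- The line through `0` that is a translate of a given block by a given point. -/
def lineAt (x : List ℕ × ℕ) : Finset Pt := translate (-(pt x.2)) (blockOf x.1)

section Lines

variable {i : Fin 72} {j : ℕ}

theorem mem_pointed {L : List (List ℕ)} {x : List ℕ × ℕ} :
    x ∈ pointed L ↔ x.1 ∈ L ∧ x.2 ∈ x.1 := by
  obtain ⟨l, y⟩ := x
  unfold pointed
  simp only [List.mem_flatMap, List.mem_map, Prod.mk.injEq]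
  constructor
  · rintro ⟨_, hl, _, hy, rfl, rfl⟩; exact ⟨hl, hy⟩
  · rintro ⟨hl, hy⟩; exact ⟨l, hl, y, hy, rfl, rfl⟩

theorem lineAt_mem {x : List ℕ × ℕ} (hx : x ∈ pointed (codes i)) :
    lineAt x ∈ development (listed i) :=
  mem_development.2 ⟨_, mem_listed.2 ⟨_, (mem_pointed.1 hx).1, rfl⟩, _, rfl⟩

theorem zero_mem_lineAt {x : List ℕ × ℕ} (hx : x ∈ pointed (codes i)) : 0 ∈ lineAt x := by
  rw [lineAt, mem_translate, sub_neg_eq_add, zero_add, blockOf, List.mem_toFinset]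
  exact List.mem_map_of_mem (mem_pointed.1 hx).2

theorem exists_star_eq {x : List ℕ × ℕ} (hx : x ∈ pointed (codes i)) : ∃ P : List Pt,
    star x = P.map cd ∧ P.toFinset = (lineAt x).erase 0 ∧ P.Nodup ∧ P.length = 4 := by
  have h0 := zero_mem_lineAt hx
  have hcard := (decomposes_listed i).isSteinerSystem.2.1 _ (lineAt_mem hx)
  obtain ⟨l, y⟩ := x
  obtain ⟨hl, hy⟩ := mem_pointed.1 hx
  obtain ⟨Q, rfl, hQ, hnd, h5, -⟩ := (isBlockCode_codes i l hl).exists_points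
  obtain ⟨y, hyQ, rfl⟩ := List.mem_map.1 hy
  refine ⟨(Q.filter fun z => z ≠ y).map fun z => z - y, ?_, ?_⟩
  · unfold star
    rw [List.filter_map, List.map_map, List.map_map]
    have h1 : Q.filter ((fun z => !Nat.beq z (cd y)) ∘ cd) = Q.filter fun z => z ≠ y := by
      refine List.filter_congr fun z _ => ?_
      rw [Function.comp_apply, Bool.eq_iff_iff, decide_eq_true_eq, Bool.not_eq_true']
      constructor
      · rintro h rfl
        rw [Nat.beq_refl] at h
        exact absurd h (by simp)
      · intro h
        exact Bool.eq_false_iff.2 fun h' => h (cd_injective (Nat.eq_of_beq_eq_true h'))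
    rw [h1]
    exact List.map_congr_left fun z _ => norm_sub z y
  have hfin : ((Q.filter fun z => z ≠ y).map fun z => z - y).toFinset =
      (lineAt (Q.map cd, cd y)).erase 0 := by
    ext z
    rw [lineAt, mem_erase, mem_translate, pt_cd, hQ, List.mem_toFinset, List.mem_toFinset,
      List.mem_map]
    constructor
    · rintro ⟨w, hw, rfl⟩
      rw [List.mem_filter, decide_eq_true_eq] at hw
      exact ⟨sub_ne_zero.2 hw.2, by simpa using hw.1⟩
    · rintro ⟨hz, hzQ⟩
      refine ⟨z + y, List.mem_filter.2 ⟨by simpa using hzQ, ?_⟩, add_sub_cancel_right z y⟩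
      simpa using hz
  have hnd' : ((Q.filter fun z => z ≠ y).map fun z => z - y).Nodup :=
    (hnd.filter _).map (sub_left_injective)
  refine ⟨hfin, hnd', ?_⟩
  rw [← List.toFinset_card_of_nodup hnd', hfin, card_erase_of_mem h0, hcard]

theorem nodup_lineAt : ((pointed (codes i)).map lineAt).Nodup := by
  have h := linesCheck_codes i
  unfold linesCheck at h
  rw [forceList_eq] at h
  have h1 := of_decide_eq_true h
  have h2 : (pointed (codes i)).map (fun x => maskAt x.2 x.1) =
      ((pointed (codes i)).map lineAt).map maskOf := by
    rw [List.map_map]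
    refine List.map_congr_left fun x hx => ?_
    obtain ⟨l, y⟩ := x
    obtain ⟨hl, hy⟩ := mem_pointed.1 hx
    obtain ⟨Q, rfl, hQ, -⟩ := (isBlockCode_codes i l hl).exists_points
    obtain ⟨y, hyQ, rfl⟩ := List.mem_map.1 hy
    rw [Function.comp_apply, lineAt, hQ, pt_cd]
    exact maskAt_eq y Q
  rw [h2] at h1
  exact h1.of_map

theorem lines_eq : ((development (listed i)).filter fun A => 0 ∈ A) =
    ((pointed (codes i)).map lineAt).toFinset := by
  ext A
  rw [mem_filter, List.mem_toFinset, List.mem_map]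
  constructor
  · rintro ⟨hA, h0⟩
    obtain ⟨B, hB, g, rfl⟩ := mem_development.1 hA
    obtain ⟨l, hl, rfl⟩ := mem_listed.1 hB
    rw [mem_translate, zero_sub, blockOf, List.mem_toFinset] at h0
    obtain ⟨y, hy, he⟩ := List.mem_map.1 h0
    refine ⟨(l, y), mem_pointed.2 ⟨hl, hy⟩, ?_⟩
    rw [lineAt, he, neg_neg]
  · rintro ⟨x, hx, rfl⟩
    exact ⟨lineAt_mem hx, zero_mem_lineAt hx⟩

theorem sum_lines (g : Finset Pt → ℕ) :
    ∑ A ∈ development (listed i) with 0 ∈ A, g A =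
      ((pointed (codes i)).map fun x => g (lineAt x)).sum := by
  rw [lines_eq, List.sum_toFinset g nodup_lineAt, List.map_map]
  rfl

theorem length_pointed : (pointed (codes i)).length = 20 := by
  revert i; decide +kernel

theorem flagFrequency_le {A : Finset Pt} (hA : A ∈ development (listed i)) (h0 : 0 ∈ A) :
    flagFrequency (development (listed i)) 0 A j ≤ 960 := by
  have hD := (decomposes_listed i).isSteinerSystem
  rw [hD.flagFrequency_eq hA h0]
  have h1 : ∀ B ∈ (development (listed i)).filter (fun B => 0 ∈ B ∧ B ≠ A),
      (∑ p with meetCount (development (listed i)) 0 A B p + j = 4,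
        meetCount (development (listed i)) 0 A B p) ≤ 48 := by
    intro B hB
    obtain ⟨hB, hoB, hBA⟩ := mem_filter.1 hB
    exact (sum_le_sum_of_subset (filter_subset _ _)).trans
      (hD.sum_meetCount_le hA hB h0 hoB hBA.symm)
  refine (sum_le_sum h1).trans ?_
  rw [sum_const, smul_eq_mul]
  have h2 : #((development (listed i)).filter (fun B => 0 ∈ B ∧ B ≠ A)) ≤ 20 := by
    refine (card_le_card fun B hB => ?_).trans (le_of_le_of_eq (List.toFinset_card_le
      ((pointed (codes i)).map lineAt)) (by rw [List.length_map, length_pointed]))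
    rw [← lines_eq]
    obtain ⟨hB, hoB, -⟩ := mem_filter.1 hB
    exact mem_filter.2 ⟨hB, hoB⟩
  omega

theorem flagCode_eq {T M : ℕ} (hT : IsLineTable T M (development (listed i)))
    {x : List ℕ × ℕ} (hx : x ∈ pointed (codes i)) :
    flagCode T M ((pointed (codes i)).map star) (star x) =
      flagFrequency (development (listed i)) 0 (lineAt x) 3 +
      2 ^ 20 * flagFrequency (development (listed i)) 0 (lineAt x) 2 +
      2 ^ 40 * flagFrequency (development (listed i)) 0 (lineAt x) 1 +
      2 ^ 60 * flagFrequency (development (listed i)) 0 (lineAt x) 0 := by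
  have hD := (decomposes_listed i).isSteinerSystem
  have hA := lineAt_mem hx
  have h0 := zero_mem_lineAt hx
  obtain ⟨P, hP, hPfin, hPn, hPl⟩ := exists_star_eq hx
  have hflag : ∀ j, flagFrequency (development (listed i)) 0 (lineAt x) j =
      ((pointed (codes i)).map fun y => if lineAt y ≠ lineAt x then
        ∑ p with meetCount (development (listed i)) 0 (lineAt x) (lineAt y) p + j = 4,
          meetCount (development (listed i)) 0 (lineAt x) (lineAt y) p else 0).sum := by
    intro j
    rw [hD.flagFrequency_eq hA h0, ← filter_filter, sum_filter, sum_lines]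
  unfold flagCode
  rw [listSum_eq, List.map_map, hflag, hflag, hflag, hflag, ← List.sum_map_mul_left,
    ← List.sum_map_mul_left, ← List.sum_map_mul_left, ← List.sum_map_add, ← List.sum_map_add,
    ← List.sum_map_add]
  congr 1
  refine List.map_congr_left fun y hy => ?_
  obtain ⟨Q, hQ, hQfin, hQn, hQl⟩ := exists_star_eq hy
  have hB := lineAt_mem hy
  have h0B := zero_mem_lineAt hy
  rw [Function.comp_apply, hP, hQ]
  by_cases hxy : lineAt y = lineAt x
  · -- equal lines are given by the same list
    have hyx : y = x := List.inj_on_of_nodup_map nodup_lineAt hy hx hxy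
    subst hyx
    have hPQ : P.map cd = Q.map cd := by rw [← hP, hQ]
    rw [hPQ, Nat.beq_refl]
    simp
  · have hhead : Nat.beq (P.map cd).headI (Q.map cd).headI = false := by
      cases hb : Nat.beq (P.map cd).headI (Q.map cd).headI with
      | false => rfl
      | true =>
        exfalso
        have hb := Nat.eq_of_beq_eq_true hb
        obtain ⟨p, P', rfl⟩ := List.exists_cons_of_length_pos (l := P) (by omega)
        obtain ⟨q, Q', rfl⟩ := List.exists_cons_of_length_pos (l := Q) (by omega)
        rw [List.map_cons, List.map_cons, List.headI_cons, List.headI_cons, cd_inj] at hb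
        subst hb
        have h1 : p ∈ (lineAt x).erase 0 := by rw [← hPfin]; simp
        have h2 : p ∈ (lineAt y).erase 0 := by rw [← hQfin]; simp
        obtain ⟨hp0, hpx⟩ := mem_erase.1 h1
        exact hxy (hD.block_unique hp0 hB hA (mem_erase.1 h2).2 h0B hpx h0)
    rw [hhead]
    simp only [ne_eq, hxy, not_false_eq_true, if_true]
    exact pairHistogram_eq hT hD hA hB h0 h0B (Ne.symm hxy) hPfin hQfin hQn hQl

theorem image_development (o : Pt) (F : Multiset (Finset Pt)) :
    (development F).image (fun B => B.image (Equiv.addLeft o)) = development F := by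
  have h : ∀ (o : Pt) (B : Finset Pt), B.image (Equiv.addLeft o) = translate o B := fun _ _ => rfl
  ext C
  simp only [mem_image, h]
  constructor
  · rintro ⟨A, hA, rfl⟩
    obtain ⟨B, hB, g, rfl⟩ := mem_development.1 hA
    refine mem_development.2 ⟨B, hB, o + g, ?_⟩
    ext x
    rw [mem_translate, mem_translate, mem_translate, sub_sub]
  · intro hC
    obtain ⟨B, hB, g, rfl⟩ := mem_development.1 hC
    refine ⟨_, mem_development.2 ⟨B, hB, g - o, rfl⟩, ?_⟩
    ext x
    rw [mem_translate, mem_translate, mem_translate, sub_sub, add_sub_cancel]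

theorem flagFrequency_translate (F : Multiset (Finset Pt)) (o : Pt) (A : Finset Pt) :
    flagFrequency (development F) o (translate o A) j = flagFrequency (development F) 0 A j := by
  have h := flagFrequency_image (j := j) (Equiv.addLeft o) (development F) 0 A
  have h0 : Equiv.addLeft o (0 : Pt) = o := add_zero o
  rw [image_development, h0] at h
  exact h

theorem translate_mem_development {F : Multiset (Finset Pt)} {A : Finset Pt}
    (hA : A ∈ development F) (o : Pt) : translate o A ∈ development F := by
  rw [← image_development o F]
  exact mem_image_of_mem _ hA

theorem translate_neg_translate (o : Pt) (A : Finset Pt) : translate o (translate (-o) A) = A := by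
  ext x
  rw [mem_translate, mem_translate, sub_neg_eq_add, sub_add_cancel]

/-- As the translations are automorphisms, it suffices to count the quadruples with `o = 0`. -/
theorem hyperbolicFrequency_development {F : Multiset (Finset Pt)}
    (hD : IsSteinerSystem 2 5 81 (development F)) : hyperbolicFrequency (development F) j =
      81 * ∑ A ∈ development F with 0 ∈ A, flagFrequency (development F) 0 A j := by
  rw [hD.hyperbolicFrequency_eq, sum_congr rfl (g := fun _ =>
    ∑ A ∈ development F with 0 ∈ A, flagFrequency (development F) 0 A j), sum_const, card_univ,
    card_pt, smul_eq_mul]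
  intro o _
  refine sum_bij' (fun A _ => translate (-o) A) (fun A _ => translate o A) ?_ ?_ ?_ ?_ ?_
  · intro A hA
    obtain ⟨hA, ho⟩ := mem_filter.1 hA
    refine mem_filter.2 ⟨translate_mem_development hA _, ?_⟩
    rw [mem_translate, sub_neg_eq_add, zero_add]; exact ho
  · intro A hA
    obtain ⟨hA, ho⟩ := mem_filter.1 hA
    refine mem_filter.2 ⟨translate_mem_development hA _, ?_⟩
    rw [mem_translate, sub_self]; exact ho
  · intro A _; exact translate_neg_translate o A
  · intro A _
    have := translate_neg_translate (-o) A
    rwa [neg_neg] at this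
  · intro A _
    rw [← flagFrequency_translate F o, translate_neg_translate]

theorem length_freq : ∀ i, (entry i).freq.length = 4 := by decide +kernel

theorem hyperbolicFrequency_listed (i : Fin 72) :
    hyperbolicFrequency (development (listed i)) = listedFrequency i := by
  have hD := (decomposes_listed i).isSteinerSystem
  funext j
  rw [hyperbolicFrequency_development hD]
  rcases Nat.lt_or_ge j 4 with hj | hj
  · obtain ⟨T, M, hT, h⟩ := withLines_spec (frequencyCheck_codes i)
    have hT := isLineTable_of_tableCheck hT
    set W : ℕ → ℕ := fun j => ∑ A ∈ development (listed i) with 0 ∈ A,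
      flagFrequency (development (listed i)) 0 A j with hW
    have hWle : ∀ j, W j ≤ 19200 := by
      intro j
      have h1 : W j ≤ ∑ A ∈ development (listed i) with 0 ∈ A, 960 :=
        sum_le_sum fun A hA => flagFrequency_le (mem_filter.1 hA).1 (mem_filter.1 hA).2
      rw [sum_lines (fun _ => 960), List.map_const', List.sum_replicate, length_pointed] at h1
      exact h1
    have hsum : listSum (flagCode T M ((pointed (codes i)).map star))
        ((pointed (codes i)).map star) = W 3 + 2 ^ 20 * W 2 + 2 ^ 40 * W 1 + 2 ^ 60 * W 0 := by
      rw [listSum_eq, List.map_map, hW]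
      simp only [sum_lines]
      rw [← List.sum_map_mul_left, ← List.sum_map_mul_left, ← List.sum_map_mul_left,
        ← List.sum_map_add, ← List.sum_map_add, ← List.sum_map_add]
      refine congrArg List.sum (List.map_congr_left fun x hx => ?_)
      rw [Function.comp_apply, flagCode_eq hT hx]
    rw [hsum, force_eq] at h
    have h1 := Nat.eq_of_beq_eq_true (allUpTo_spec h j hj)
    have e : ∀ g, Nat.mul 81 (Nat.mod (Nat.shiftRight g (Nat.mul 20 (Nat.sub 3 j))) 1048576) =
        81 * (g >>> (20 * (3 - j)) % 1048576) := fun _ => rfl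
    replace h1 := (e _).symm.trans h1
    rw [Nat.shiftRight_eq_div_pow] at h1
    rw [listedFrequency, ← h1]
    have g0 := hWle 0
    have g1 := hWle 1
    have g2 := hWle 2
    have g3 := hWle 3
    have hgoal : W j = (W 3 + 2 ^ 20 * W 2 + 2 ^ 40 * W 1 + 2 ^ 60 * W 0) / 2 ^ (20 * (3 - j)) %
        1048576 := by
      clear_value W
      interval_cases j <;> norm_num <;> omega
    exact congrArg (81 * ·) hgoal
  · rw [listedFrequency, List.getD_eq_default _ _ (by rw [length_freq]; exact hj)]
    refine mul_eq_zero_of_right _ (sum_eq_zero fun A hA => ?_)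
    obtain ⟨hA, h0⟩ := mem_filter.1 hA
    rw [hD.flagFrequency_eq hA h0]
    refine sum_eq_zero fun B _ => sum_eq_zero fun p hp => ?_
    have := (mem_filter.1 hp).2
    omega

end Lines

/-! ### Isomorphism of the designs -/

theorem DesignIso.hyperbolicFrequency_eq {V W : Type*} [Fintype V] [DecidableEq V] [Fintype W]
    [DecidableEq W] {D : Finset (Finset V)} {E : Finset (Finset W)} (h : DesignIso D E) :
    hyperbolicFrequency D = hyperbolicFrequency E := by
  obtain ⟨e, rfl⟩ := h
  funext j
  exact (hyperbolicFrequency_image e D).symm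

theorem DesignIso.symm {V W : Type*} [Fintype V] [DecidableEq V] [Fintype W]
    [DecidableEq W] {D : Finset (Finset V)} {E : Finset (Finset W)} (h : DesignIso D E) :
    DesignIso E D := by
  obtain ⟨e, rfl⟩ := h
  refine ⟨e.symm, ?_⟩
  rw [image_image]
  conv_rhs => rw [← image_id (s := D)]
  refine image_congr fun B _ => ?_
  rw [Function.comp_apply, image_image, Equiv.symm_comp_self, image_id]
  rfl

theorem listedFrequency_eq_iff {i j : Fin 72} (hij : i ≠ j) :
    listedFrequency i = listedFrequency j ↔ (i = 35 ∧ j = 56) ∨ (i = 56 ∧ j = 35) := by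
  have h : ∀ i j : Fin 72, i ≠ j → ((entry i).freq = (entry j).freq ↔
      (i = 35 ∧ j = 56) ∨ (i = 56 ∧ j = 35)) := by decide +kernel
  rw [← h i j hij]
  constructor
  · intro he
    refine List.ext_getElem (by rw [length_freq, length_freq]) fun n h1 h2 => ?_
    have := congrFun he n
    rwa [listedFrequency, listedFrequency, List.getD_eq_getElem _ _ h1,
      List.getD_eq_getElem _ _ h2] at this
  · intro he
    funext n
    rw [listedFrequency, listedFrequency, he]

theorem flagCode_field {i : Fin 72} {T M : ℕ} (hT : IsLineTable T M (development (listed i)))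
    {x : List ℕ × ℕ} (hx : x ∈ pointed (codes i)) : Nat.mod (Nat.shiftRight
      (flagCode T M ((pointed (codes i)).map star) (star x)) 20) 1048576 =
        flagFrequency (development (listed i)) 0 (lineAt x) 2 := by
  have e : ∀ g, Nat.mod (Nat.shiftRight g 20) 1048576 = g >>> 20 % 1048576 := fun _ => rfl
  rw [e, flagCode_eq hT hx, Nat.shiftRight_eq_div_pow]
  have h := fun j => flagFrequency_le (j := j) (lineAt_mem hx) (zero_mem_lineAt hx)
  have h2 := h 2
  have h3 := h 3
  norm_num
  omega

/-- The flag frequencies distinguish the two designs with the same fingerprint. -/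
theorem not_designIso_35_56 : ¬ DesignIso (development (listed 35)) (development (listed 56)) := by
  rintro ⟨e, he⟩
  obtain ⟨T, M, hT, h⟩ := withLines_spec flagCheck_35
  obtain ⟨T', M', hT', h'⟩ := withLines_spec noFlagCheck_56
  have hT := isLineTable_of_tableCheck hT
  have hT' := isLineTable_of_tableCheck hT'
  obtain ⟨s, hs, hb⟩ := List.any_eq_true.1 h
  obtain ⟨x, hx, rfl⟩ := List.mem_map.1 hs
  have h304 := Nat.eq_of_beq_eq_true hb
  rw [flagCode_field hT hx] at h304
  have h1 := flagFrequency_image (j := 2) e (development (listed 35)) 0 (lineAt x)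
  rw [he, h304] at h1
  set A := (lineAt x).image e with hA
  have hAmem : A ∈ development (listed 56) := by
    rw [← he]; exact mem_image_of_mem _ (lineAt_mem hx)
  have h0A : e 0 ∈ A := mem_image_of_mem _ (zero_mem_lineAt hx)
  rw [← translate_neg_translate (e 0) A, flagFrequency_translate] at h1
  have hmem : translate (-e 0) A ∈ (development (listed 56)).filter fun A => 0 ∈ A := by
    refine mem_filter.2 ⟨translate_mem_development hAmem _, ?_⟩
    rw [mem_translate, sub_neg_eq_add, zero_add]; exact h0A
  rw [lines_eq, List.mem_toFinset] at hmem
  obtain ⟨y, hy, hye⟩ := List.mem_map.1 hmem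
  have h2 := List.all_eq_true.1 h' _ (List.mem_map_of_mem hy)
  rw [flagCode_field hT' hy, hye, h1] at h2
  exact absurd h2 (by simp)

theorem not_designIso_listed {i j : Fin 72} (hij : i ≠ j) :
    ¬ DesignIso (development (listed i)) (development (listed j)) := by
  intro h
  have h1 := h.hyperbolicFrequency_eq
  rw [hyperbolicFrequency_listed, hyperbolicFrequency_listed, listedFrequency_eq_iff hij] at h1
  rcases h1 with ⟨rfl, rfl⟩ | ⟨rfl, rfl⟩
  · exact not_designIso_35_56 h
  · exact not_designIso_35_56 h.symm

theorem TranslationEquiv.development_eq {F F' : Multiset (Finset Pt)} (h : TranslationEquiv F F') :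
    development F = development F' := by
  have key : ∀ {F F' : Multiset (Finset Pt)}, TranslationEquiv F F' →
      development F ⊆ development F' := by
    intro F F' h C hC
    obtain ⟨B, hB, g, rfl⟩ := mem_development.1 hC
    obtain ⟨B', hB', g', rfl⟩ := Multiset.exists_mem_of_rel_of_mem h hB
    refine mem_development.2 ⟨_, hB', g - g', ?_⟩
    ext x
    rw [mem_translate, mem_translate, mem_translate, sub_sub, sub_add_cancel]
  exact (key h).antisymm (key h.symm)

theorem MultiplierEquiv.designIso {F F' : Multiset (Finset Pt)} (h : MultiplierEquiv F F') :
    DesignIso (development F) (development F') := by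
  obtain ⟨α, h⟩ := h
  refine ⟨α.toEquiv, ?_⟩
  rw [← h.development_eq]
  ext C
  rw [mem_image, mem_development]
  constructor
  · rintro ⟨A, hA, rfl⟩
    obtain ⟨B, hB, g, rfl⟩ := mem_development.1 hA
    refine ⟨B.image α, Multiset.mem_map_of_mem _ hB, α g, ?_⟩
    ext x
    rw [mem_translate, mem_image_addEquiv]
    show _ ↔ x ∈ (translate g B).image α
    rw [mem_image_addEquiv, mem_translate, map_sub, AddEquiv.symm_apply_apply]
  · rintro ⟨B', hB', g, rfl⟩
    obtain ⟨B, hB, rfl⟩ := Multiset.mem_map.1 hB'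
    refine ⟨translate (α.symm g) B, mem_development.2 ⟨B, hB, _, rfl⟩, ?_⟩
    show (translate (α.symm g) B).image α = _
    ext x
    rw [mem_translate, mem_image_addEquiv, mem_image_addEquiv, mem_translate, map_sub]

theorem DesignIso.trans {U V W : Type*} [Fintype U] [DecidableEq U] [Fintype V] [DecidableEq V]
    [Fintype W] [DecidableEq W] {C : Finset (Finset U)} {D : Finset (Finset V)}
    {E : Finset (Finset W)} (h : DesignIso C D) (h' : DesignIso D E) : DesignIso C E := by
  obtain ⟨e, rfl⟩ := h
  obtain ⟨e', rfl⟩ := h'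
  refine ⟨e.trans e', ?_⟩
  rw [image_image]
  refine image_congr fun B _ => ?_
  rw [Function.comp_apply, image_image]
  rfl

end DiffFamily

theorem mainTheorem6 :
    -- each listed family is a difference family with multiplier 1 that generates an `S(2,5,81)`
    -- with the listed fingerprint
    (∀ i : Fin 72, IsDifferenceFamily 5 1 (listed i) ∧ multiplierCount (listed i) = 1 ∧
      IsSteinerSystem 2 5 81 (development (listed i)) ∧
      hyperbolicFrequency (development (listed i)) = listedFrequency i) ∧
    -- the list is exhaustive and irredundant up to multipliers
    (∀ F : Multiset (Finset (ZMod 3 × ZMod 27)), IsDifferenceFamily 5 1 F →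
      ∃! i : Fin 72, MultiplierEquiv (listed i) F) ∧
    -- the fingerprints are distinct, except that the families with indices 35 and 56 share theirs
    (∀ i j : Fin 72, i ≠ j →
      (hyperbolicFrequency (development (listed i)) = hyperbolicFrequency (development (listed j)) ↔
        (i = 35 ∧ j = 56) ∨ (i = 56 ∧ j = 35))) ∧
    -- the designs are pairwise non-isomorphic
    (∀ i j : Fin 72, i ≠ j →
      ¬ DesignIso (development (listed i)) (development (listed j))) := by
  refine ⟨fun i => ⟨isDifferenceFamily_iff.2 (decomposes_listed i), multiplierCount_listed i,
    (decomposes_listed i).isSteinerSystem, hyperbolicFrequency_listed i⟩, fun F hF => ?_,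
    fun i j hij => ?_, fun i j hij => not_designIso_listed hij⟩
  · obtain ⟨i, hi⟩ :=
      (classified_of_decomposes (isDifferenceFamily_iff.1 hF)).exists_multiplierEquiv
    refine ⟨i, hi, fun j hj => ?_⟩
    -- both indices would give designs isomorphic to that of `F`
    by_contra hji
    exact not_designIso_listed hji (hj.designIso.trans hi.designIso.symm)
  · rw [hyperbolicFrequency_listed, hyperbolicFrequency_listed]
    exact listedFrequency_eq_iff hij
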